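/- Let $(M^m,g)$ and $(N^n,h)$ be smooth Riemannian manifolds (without boundary), let $p,q\ge 2$ be real numbers and let $\varphi:M\to N$ be a smooth map. Write $\nabla^{\varphi}$ for the pull-back to $\varphi^{-1}TN$ of the Levi-Civita connection of $N$, $R^N(X,Y)Z=\nabla_X\nabla_YZ-\nabla_Y\nabla_XZ-\nabla_{[X,Y]}Z$ for the curvature tensor of $N$, $|d\varphi|$ for the Hilbert–Schmidt norm of $d\varphi$, $v_g$ for the Riemannian volume measure of $g$, and, for a one-form $S$ with values in $\varphi^{-1}TN$, $\operatorname{div}S=\operatorname{trace}_g\nabla S$. Put $$\tau_p(\varphi)=\operatorname{div}\big(|d\varphi|^{p-2}d\varphi\big),\qquad W=|\tau_p(\varphi)|^{q-2}\tau_p(\varphi),\qquad E_{p,q}(\varphi;D)=\frac1q\int_D|\tau_p(\varphi)|^q\,v_g$$ for $D\subset M$ compact, and $$\tau_{p,q}(\varphi)=-|d\varphi|^{p-2}|\tau_p(\varphi)|^{q-2}\operatorname{trace}R^N(\tau_p(\varphi),d\varphi)d\varphi-\operatorname{div}\big(|d\varphi|^{p-2}\nabla^{\varphi}W\big)-(p-2)\operatorname{div}\big(|d\varphi|^{p-4}\langle\nabla^{\varphi}W,d\varphi\rangle\,d\varphi\big).$$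 Here $|d\varphi|^{p-4}\langle\nabla^{\varphi}W,d\varphi\rangle\,d\varphi$ is understood to be $0$ at the zeros of $d\varphi$, and the last term is understood to be $0$ if $p=2$. Call $\varphi$ regular on a set $A\subset M$ if (i) $p=2$, or $p>3$, or $d\varphi_x\ne0$ for all $x\in A$; and (ii) $W$ is of class $C^2$ near every point of $A$. (a) Let $D\subset M$ be compact, let $\varphi$ be regular on $D$, and let $\{\varphi_t\}_{t\in(-\epsilon,\epsilon)}$ be a smooth variation of $\varphi$ with support in $D$ (that is, $(t,x)\mapsto\varphi_t(x)$ is smooth on $(-\epsilon,\epsilon)\times M$, $\varphi_0=\varphi$, and $\varphi_t=\varphi$ outside $D$), with variation field $v=\frac{d\varphi_t}{dt}\big|_{t=0}$. Then $|\tau_p(\varphi_t)|^q$ is integrable on $D$ for every $t$, $h(v,\tau_{p,q}(\varphi))$ is integrable on $D$, $t\mapsto E_{p,q}(\varphi_t;D)$ is differentiable at $t=0$, and $$\frac{d}{dt}E_{p,q}(\varphi_t;D)\Big|_{t=0}=-\int_Dh\big(v,\tau_{p,q}(\varphi)\big)\,v_g .$$ (b) If $\varphi$ is regular on $M$, then $\varphi$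 is $(p,q)$-harmonic (that is, for every compact $D\subset M$ and every smooth variation $\{\varphi_t\}$ of $\varphi$ with support in $D$, the function $t\mapsto E_{p,q}(\varphi_t;D)$ has derivative $0$ at $t=0$) if and only if $\tau_{p,q}(\varphi)=0$ on $M$. -/

import Mathlib

open Set MeasureTheory Bundle
open scoped Manifold ContDiff

noncomputable section

namespace PQHarmonic

section Euclidean

/-! ### Coordinate expressions on an open piece of `ℝᵈ`

Here `G z u w` is the value at the point `z` of a metric on the constant vectors `u`, `w`. -/

variable {d : ℕ}

/-- The standard basis vector `∂ᵢ` of `ℝᵈ`. -/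
def stdVec (i : Fin d) : EuclideanSpace ℝ (Fin d) := EuclideanSpace.single i 1

/-- The matrix `(g_{ij})` of a bilinear form in the standard basis. -/
def gram (B : EuclideanSpace ℝ (Fin d) → EuclideanSpace ℝ (Fin d) → ℝ) :
    Matrix (Fin d) (Fin d) ℝ :=
  Matrix.of fun i j => B (stdVec i) (stdVec j)

/-- The Christoffel symbols of the Levi-Civita connection, as a vector:
`Γ(u, w) = ½ g^{kl} (∂_u g(w, ∂_l) + ∂_w g(u, ∂_l) - ∂_l g(u, w)) ∂_k`. -/
def christoffel
    (G : EuclideanSpace ℝ (Fin d) → EuclideanSpace ℝ (Fin d) → EuclideanSpace ℝ (Fin d) → ℝ)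
    (z u w : EuclideanSpace ℝ (Fin d)) : EuclideanSpace ℝ (Fin d) :=
  ∑ k, ∑ l, ((gram (G z))⁻¹ k l * ((1 / 2 : ℝ) *
    (fderiv ℝ (fun y => G y w (stdVec l)) z u
      + fderiv ℝ (fun y => G y u (stdVec l)) z w
      - fderiv ℝ (fun y => G y u w) z (stdVec l)))) • stdVec k

/-- The Riemann curvature tensor, with the convention
`R(u, v) w = ∇_u ∇_v w - ∇_v ∇_u w - ∇_{[u, v]} w`. -/
def coordCurvature
    (G : EuclideanSpace ℝ (Fin d) → EuclideanSpace ℝ (Fin d) → EuclideanSpace ℝ (Fin d) → ℝ)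
    (z u v w : EuclideanSpace ℝ (Fin d)) : EuclideanSpace ℝ (Fin d) :=
  fderiv ℝ (fun y => christoffel G y v w) z u - fderiv ℝ (fun y => christoffel G y u w) z v
    + christoffel G z u (christoffel G z v w) - christoffel G z v (christoffel G z u w)

end Euclidean

section Metric

variable {d : ℕ} {X : Type*} [TopologicalSpace X] [ChartedSpace (EuclideanSpace ℝ (Fin d)) X]
  [IsManifold (𝓡 d) ∞ X]

/-- Smooth Riemannian metrics on the smooth `d`-dimensional manifold `X` (without boundary). -/
abbrev Metric (d : ℕ) (X : Type*) [TopologicalSpace X]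
    [ChartedSpace (EuclideanSpace ℝ (Fin d)) X] [IsManifold (𝓡 d) ∞ X] :=
  ContMDiffRiemannianMetric (𝓡 d) ∞ (EuclideanSpace ℝ (Fin d))
    (fun x : X => TangentSpace (𝓡 d) x)

/-- The length of a tangent vector. -/
def vnorm (g : Metric d X) (x : X) (v : TangentSpace (𝓡 d) x) : ℝ :=
  Real.sqrt (g.inner x v v)

/-- The vector field, on the domain of the preferred chart at `x₀`, whose components in that chart
are the constants `w`. -/
def coordField (x₀ : X) (w : EuclideanSpace ℝ (Fin d)) (y : X) : TangentSpace (𝓡 d) y :=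
  (trivializationAt (EuclideanSpace ℝ (Fin d)) (fun x : X => TangentSpace (𝓡 d) x) x₀).symmL ℝ y w

/-- The metric `g` in the preferred chart at `x₀`. -/
def metricInChart (g : Metric d X) (x₀ : X) (z u w : EuclideanSpace ℝ (Fin d)) : ℝ :=
  g.inner ((extChartAt (𝓡 d) x₀).symm z)
    (coordField x₀ u ((extChartAt (𝓡 d) x₀).symm z))
    (coordField x₀ w ((extChartAt (𝓡 d) x₀).symm z))

/-- The trace `g^{ij} B(∂ᵢ, ∂ⱼ)` with respect to `g` of a bilinear map `B` on the tangent space at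
`x`; for a `g`-orthonormal basis `(eᵢ)` it is `∑ᵢ B(eᵢ, eᵢ)`. -/
def trace {F : Type*} [AddCommGroup F] [Module ℝ F] (g : Metric d X) (x : X)
    (B : TangentSpace (𝓡 d) x → TangentSpace (𝓡 d) x → F) : F :=
  ∑ i : Fin d, ∑ j : Fin d,
    (gram (fun u w : EuclideanSpace ℝ (Fin d) => g.inner x u w))⁻¹ i j • B (stdVec i) (stdVec j)

/-- The Christoffel symbols of `g` at `x₀` in the preferred chart at `x₀`. -/
def gamma (g : Metric d X) (x₀ : X) (u w : TangentSpace (𝓡 d) x₀) : TangentSpace (𝓡 d) x₀ :=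
  christoffel (metricInChart g x₀) (extChartAt (𝓡 d) x₀ x₀) u w

/-- The Riemann curvature tensor `R(u, v) w` of `g` at `x₀`. -/
def curvature (g : Metric d X) (x₀ : X) (u v w : TangentSpace (𝓡 d) x₀) :
    TangentSpace (𝓡 d) x₀ :=
  coordCurvature (metricInChart g x₀) (extChartAt (𝓡 d) x₀ x₀) u v w

/-- The measure `√(det g_{ij}) dz` of the preferred chart at `x₀`, transported to the domain of the
chart (and zero outside it). -/
def chartVolume [MeasurableSpace X] (g : Metric d X) (x₀ : X) : Measure X :=
  Measure.map (extChartAt (𝓡 d) x₀).symm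
    ((volume.restrict (extChartAt (𝓡 d) x₀).target).withDensity
      fun z => ENNReal.ofReal (Real.sqrt (gram (metricInChart g x₀ z)).det))

/-- The Riemannian volume measure `v_g`. The measures `√(det g_{ij}) dz` of any two charts agree on
the intersection of their domains, so that their least upper bound is the measure that restricts to
`√(det g_{ij}) dz` on the domain of each chart. -/
def riemannianVolume [MeasurableSpace X] (g : Metric d X) : Measure X :=
  ⨆ x₀ : X, chartVolume g x₀

end Metric

section Maps

variable {m n : ℕ}
  {M : Type*} [TopologicalSpace M] [ChartedSpace (EuclideanSpace ℝ (Fin m)) M]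
  [IsManifold (𝓡 m) ∞ M]
  {N : Type*} [TopologicalSpace N] [ChartedSpace (EuclideanSpace ℝ (Fin n)) N]
  [IsManifold (𝓡 n) ∞ N]

/-- A vector field `V` along `φ`, in the preferred charts at `x₀` and `φ x₀`. -/
def alongInChart (φ : M → N) (V : ∀ x, TangentSpace (𝓡 n) (φ x)) (x₀ : M)
    (z : EuclideanSpace ℝ (Fin m)) : EuclideanSpace ℝ (Fin n) :=
  (trivializationAt (EuclideanSpace ℝ (Fin n)) (fun y : N => TangentSpace (𝓡 n) y) (φ x₀)
    ⟨φ ((extChartAt (𝓡 m) x₀).symm z), V ((extChartAt (𝓡 m) x₀).symm z)⟩).2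

/-- The derivative `(u(V^k))` of the components of `V` in direction `u`. -/
def alongDeriv (φ : M → N) (V : ∀ x, TangentSpace (𝓡 n) (φ x)) (x : M)
    (u : TangentSpace (𝓡 m) x) : TangentSpace (𝓡 n) (φ x) :=
  fderiv ℝ (alongInChart φ V x) (extChartAt (𝓡 m) x x) u

/-- The pull-back `∇^φ` of the Levi-Civita connection of `(N, h)`:
`(∇^φ_u V)^k = u(V^k) + Γ^k_{ij} (dφ u)^i V^j`. The chart at `x` induces the identity of
`TangentSpace (𝓡 m) x`, and similarly at `φ x`, so the components of a tangent vector at the centre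
of its chart are the vector itself. -/
def covDeriv (h : Metric n N) (φ : M → N) (V : ∀ x, TangentSpace (𝓡 n) (φ x)) (x : M)
    (u : TangentSpace (𝓡 m) x) : TangentSpace (𝓡 n) (φ x) :=
  alongDeriv φ V x u + gamma h (φ x) (mfderiv (𝓡 m) (𝓡 n) φ x u) (V x)

/-- The divergence of a one-form `S` with values in `φ⁻¹TN`: the trace over `(u, w)` of
`(∇_u S)(w) = ∇^φ_u (S w) - S (∇^M_u w)`, where `w` is extended with constant components in the
chart at `x`, for which `∇^M_u w = Γ(u, w)` at `x`. -/
def divergence (g : Metric m M) (h : Metric n N) (φ : M → N)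
    (S : ∀ x, TangentSpace (𝓡 m) x → TangentSpace (𝓡 n) (φ x)) (x : M) :
    TangentSpace (𝓡 n) (φ x) :=
  trace g x fun u w =>
    covDeriv h φ (fun y => S y (coordField x w y)) x u - S x (gamma g x u w)

/-- The inner product `⟨S, T⟩` of two linear maps from the tangent space at `x` to the tangent space
at `y`. -/
def innerHom (g : Metric m M) (h : Metric n N) (x : M) (y : N)
    (S T : TangentSpace (𝓡 m) x → TangentSpace (𝓡 n) y) : ℝ :=
  trace g x fun u w => h.inner y (S u) (T w)

/-- The Hilbert–Schmidt norm `|dφ|` at `x`. -/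
def dnorm (g : Metric m M) (h : Metric n N) (φ : M → N) (x : M) : ℝ :=
  Real.sqrt (innerHom g h x (φ x) (mfderiv (𝓡 m) (𝓡 n) φ x) (mfderiv (𝓡 m) (𝓡 n) φ x))

/-- The `p`-tension field `τ_p(φ) = div(|dφ|^{p-2} dφ)`. -/
def pTension (p : ℝ) (g : Metric m M) (h : Metric n N) (φ : M → N) (x : M) :
    TangentSpace (𝓡 n) (φ x) :=
  divergence g h φ (fun y u => (dnorm g h φ y ^ (p - 2)) • mfderiv (𝓡 m) (𝓡 n) φ y u) x

/-- The vector field `|τ_p(φ)|^{q-2} τ_p(φ)` along `φ`. -/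
def weightedTension (p q : ℝ) (g : Metric m M) (h : Metric n N) (φ : M → N) (x : M) :
    TangentSpace (𝓡 n) (φ x) :=
  (vnorm h (φ x) (pTension p g h φ x) ^ (q - 2)) • pTension p g h φ x

/-- The `(p, q)`-tension field `τ_{p,q}(φ)`. -/
def pqTension (p q : ℝ) (g : Metric m M) (h : Metric n N) (φ : M → N) (x : M) :
    TangentSpace (𝓡 n) (φ x) :=
  -((dnorm g h φ x ^ (p - 2) * vnorm h (φ x) (pTension p g h φ x) ^ (q - 2)) •
      trace g x fun u w => curvature h (φ x) (pTension p g h φ x)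
        (mfderiv (𝓡 m) (𝓡 n) φ x u) (mfderiv (𝓡 m) (𝓡 n) φ x w))
  - divergence g h φ
      (fun y u => (dnorm g h φ y ^ (p - 2)) • covDeriv h φ (weightedTension p q g h φ) y u) x
  - (p - 2) • divergence g h φ
      (fun y u => (dnorm g h φ y ^ (p - 4) *
        innerHom g h y (φ y) (covDeriv h φ (weightedTension p q g h φ) y)
          (mfderiv (𝓡 m) (𝓡 n) φ y)) • mfderiv (𝓡 m) (𝓡 n) φ y u) x

/-- The `(p, q)`-energy `E_{p,q}(φ; D) = (1/q) ∫_D |τ_p(φ)|^q v_g`. -/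
def pqEnergy [MeasurableSpace M] (p q : ℝ) (g : Metric m M) (h : Metric n N) (φ : M → N)
    (D : Set M) : ℝ :=
  (1 / q) * ∫ x in D, vnorm h (φ x) (pTension p g h φ x) ^ q ∂(riemannianVolume g)

variable (m n) in
/-- `Φ` is a smooth variation `(φ_t)`, `t ∈ (-ε, ε)`, of `φ` with support in `D`. -/
structure IsVariation (φ : M → N) (D : Set M) (ε : ℝ) (Φ : ℝ → M → N) : Prop where
  smooth : ContMDiffOn (𝓘(ℝ, ℝ).prod (𝓡 m)) (𝓡 n) ∞ (fun a : ℝ × M => Φ a.1 a.2)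
    (Ioo (-ε) ε ×ˢ univ)
  zero : Φ 0 = φ
  support : ∀ t ∈ Ioo (-ε) ε, ∀ x ∉ D, Φ t x = φ x

variable (n) in
/-- The variation vector field `v = dφ_t/dt` at `t = 0`. -/
def variationField (Φ : ℝ → M → N) (x : M) : TangentSpace (𝓡 n) (Φ 0 x) :=
  mfderiv 𝓘(ℝ, ℝ) (𝓡 n) (fun t => Φ t x) 0 (1 : ℝ)

/-- `φ` is `(p, q)`-harmonic: a critical point of `E_{p,q}(·; D)`, for every compact `D`, with
respect to the smooth variations with support in `D`. -/
def IsPQHarmonic [MeasurableSpace M] (p q : ℝ) (g : Metric m M) (h : Metric n N) (φ : M → N) :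
    Prop :=
  ∀ (D : Set M) (ε : ℝ) (Φ : ℝ → M → N), IsCompact D → 0 < ε → IsVariation m n φ D ε Φ →
    HasDerivAt (fun t => pqEnergy p q g h (Φ t) D) 0 0

/-- The expressions that define `τ_{p,q}(φ)` make classical sense on `A`: for `2 < p ≤ 3` the
singular weights `|dφ|^{p-2}`, `|dφ|^{p-4}` are not evaluated at zeros of `dφ`, and the field
`|τ_p(φ)|^{q-2} τ_p(φ)`, which is differentiated twice, is of class `C²`. -/
def IsRegularOn (p q : ℝ) (g : Metric m M) (h : Metric n N) (φ : M → N) (A : Set M) : Prop :=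
  (p = 2 ∨ 3 < p ∨ ∀ x ∈ A, mfderiv (𝓡 m) (𝓡 n) φ x ≠ 0) ∧
  ∀ x ∈ A, ContMDiffAt (𝓡 m) (𝓡 n).tangent 2
    (fun y => (⟨φ y, weightedTension p q g h φ y⟩ : TangentBundle (𝓡 n) N)) x

end Maps

end PQHarmonic

end

set_option maxSynthPendingDepth 3

/-! Write `v` for the variation field, `W = |τ_p|^{q-2} τ_p`, and `s = (p-2)/2`, so that `|dφ|^{p-2}
= Q^s` with `Q = |dφ|²`.

Along a variation, the metric property of the connection gives `(1/q) ∂_t |τ_p(φ_t)|^q = ⟨W, ∇_t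
τ_p⟩` (`energy_density`). Interchanging `∇_t` with the divergence costs a curvature term, `∇_t div S
= div ∇_t S + trace R(v, dφ) S` (`IsMetricOn.covE_divP`). For `S = |dφ|^{p-2} dφ` the inner
derivative is `∇_t S = T(∇v)`, where `T(X) = |dφ|^{p-2} X + (p-2) |dφ|^{p-4} ⟨X, dφ⟩ dφ`. The map
`T` is self-adjoint (`hsForm_linMap`), so `⟨W, div T(∇v)⟩ - ⟨v, div T(∇W)⟩` is the divergence of the
one-form `θ = ⟨W, T(∇v)⟩ - ⟨v, T(∇W)⟩` (`divForm_greenForm`). By the pair symmetry of the curvature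
tensor, `IsMetricOn.curvE_pair`, the trace of `⟨W, R(v, dφ) dφ⟩` equals that of `⟨v, R(W, dφ) dφ⟩`.
Altogether the pointwise identity `(1/q) ∂_t |τ_p|^q + ⟨v, τ_{p,q}⟩ = div θ` holds at `t = 0`
(`first_variation_identity`, `deriv_density_add`). It integrates to the first variation formula,
because `θ` vanishes off `D` and the divergence theorem `integral_divForm_eq_zero` applies;
differentiation under the integral sign is `hasDerivAt_integral_density`.

Three matters need care. First, the powers of `Q` are singular where `dφ = 0`. There the loss of
smoothness is offset by factors that vanish with `dφ`: `contDiffAt_rpow_smul` counts orders of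
vanishing. It shows that `Q^s dφ` is always `C¹`, and is `C²` if `s = 0`, `s > 1/2` or `dφ ≠ 0`,
which is the regularity hypothesis. Second, every operator of the statement is defined in the
preferred charts at the point in question, whereas derivatives of it need one fixed pair of charts
near that point. The naturality results `covE_natural`, `divE_natural` and `curvE_natural` bridge
this. Third, `riemannianVolume` is a supremum of chart measures; `riemannianVolume_restrict`
identifies it on each chart domain.

For the Euler–Lagrange equation, if `τ_{p,q}(φ) ≠ 0` at `x₀`, the map is moved near `x₀` in the
constant chart direction of `τ_{p,q}(φ)(x₀)` with a bump function as speed. The integrand of the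
first variation is then continuous and nonnegative, and positive near `x₀`, although its integral is
zero (`IsPQHarmonic.pqTension_eq_zero`). -/

namespace PQHarmonic

open scoped Topology

noncomputable section

/-! ### Linear algebra: Gram matrices, traces and their invariance. -/

section
/-- The model space `ℝᵈ`. -/
abbrev Euc (d : ℕ) := EuclideanSpace ℝ (Fin d)

/-- Bilinear forms on `ℝᵈ`. -/
abbrev Form (d : ℕ) := Euc d →L[ℝ] Euc d →L[ℝ] ℝ

/-- Symmetric positive definite bilinear forms. -/
structure IsInner {d : ℕ} (B : Form d) : Prop where
  symm : ∀ u w, B u w = B w u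
  pos : ∀ u, u ≠ 0 → 0 < B u u

/-- The inverse `(g^{ij})` of the Gram matrix. -/
def ginv {d : ℕ} (B : Form d) : Matrix (Fin d) (Fin d) ℝ :=
  (gram fun u w => B u w)⁻¹

/-- The trace `g^{ij} β(∂ᵢ, ∂ⱼ)`. -/
def formTrace {d : ℕ} {F : Type*} [AddCommGroup F] [Module ℝ F] (B : Form d)
    (β : Euc d → Euc d → F) : F :=
  ∑ i : Fin d, ∑ j : Fin d, ginv B i j • β (stdVec i) (stdVec j)

variable {d : ℕ}

theorem sum_smul_stdVec (v : Euc d) : ∑ i, v i • stdVec i = v := by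
  have := (EuclideanSpace.basisFun (Fin d) ℝ).sum_repr v
  simpa [stdVec] using this

theorem gram_apply (B : Euc d → Euc d → ℝ) (i j : Fin d) :
    gram B i j = B (stdVec i) (stdVec j) := rfl

theorem form_eq_sum (B : Form d) (u w : Euc d) :
    B u w = ∑ i, ∑ j, u i * w j * gram (fun u w => B u w) i j := by
  conv_lhs => rw [← sum_smul_stdVec u, ← sum_smul_stdVec w]
  simp only [gram_apply, map_sum, map_smul, _root_.sum_apply, _root_.smul_apply, smul_eq_mul,
    Finset.mul_sum]
  rw [Finset.sum_comm]
  refine Finset.sum_congr rfl fun i _ => Finset.sum_congr rfl fun j _ => ?_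
  ring

namespace IsInner

variable {B : Form d} (hB : IsInner B)
include hB

theorem posDef_gram : (gram fun u w => B u w).PosDef := by
  refine Matrix.PosDef.of_dotProduct_mulVec_pos ?_ ?_
  · ext i j
    simp [Matrix.conjTranspose, gram_apply, hB.symm]
  · intro x hx
    have h0 : (WithLp.toLp 2 x : Euc d) ≠ 0 := by
      intro h
      exact hx (by simpa using congrArg (WithLp.ofLp) h)
    have := hB.pos _ h0
    rw [form_eq_sum] at this
    refine this.trans_eq ?_
    simp only [dotProduct, Matrix.mulVec, Finset.mul_sum, star_trivial]
    refine Finset.sum_congr rfl fun i _ => Finset.sum_congr rfl fun j _ => ?_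
    ring

theorem det_pos : 0 < (gram fun u w => B u w).det := hB.posDef_gram.det_pos

theorem isUnit_det : IsUnit (gram fun u w => B u w).det := hB.det_pos.ne'.isUnit

theorem ginv_posDef : (ginv B).PosDef := hB.posDef_gram.inv

theorem ginv_symm (i j : Fin d) : ginv B i j = ginv B j i := by
  have := hB.ginv_posDef.isHermitian
  have h2 := congrFun (congrFun this i) j
  simpa [Matrix.conjTranspose] using h2.symm

theorem ginv_mul_gram (i j : Fin d) :
    ∑ k, ginv B i k * B (stdVec k) (stdVec j) = if i = j then 1 else 0 := by
  have := Matrix.nonsing_inv_mul _ hB.isUnit_det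
  have h2 := congrFun (congrFun this i) j
  rw [Matrix.mul_apply, Matrix.one_apply] at h2
  exact h2

theorem gram_mul_ginv (i j : Fin d) :
    ∑ k, B (stdVec i) (stdVec k) * ginv B k j = if i = j then 1 else 0 := by
  have := Matrix.mul_nonsing_inv _ hB.isUnit_det
  have h2 := congrFun (congrFun this i) j
  rw [Matrix.mul_apply, Matrix.one_apply] at h2
  exact h2

theorem ext_right {u w : Euc d} (h : ∀ y, B u y = B w y) : u = w := by
  by_contra hne
  have := hB.pos (u - w) (sub_ne_zero.2 hne)
  simp [h] at this

end IsInner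

/-- The vector that represents a linear form. -/
def sharp (B : Form d) : (Euc d →L[ℝ] ℝ) →L[ℝ] Euc d :=
  ∑ k, ∑ l, ginv B k l • (ContinuousLinearMap.apply ℝ ℝ (stdVec l)).smulRight (stdVec k)

theorem sharp_apply (B : Form d) (ℓ : Euc d →L[ℝ] ℝ) :
    sharp B ℓ = ∑ k, ∑ l, (ginv B k l * ℓ (stdVec l)) • stdVec k := by
  simp [sharp, mul_smul]

theorem IsInner.apply_sharp {B : Form d} (hB : IsInner B) (ℓ : Euc d →L[ℝ] ℝ) (y : Euc d) :
    B (sharp B ℓ) y = ℓ y := by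
  have key : ∀ j, B (sharp B ℓ) (stdVec j) = ℓ (stdVec j) := by
    intro j
    rw [sharp_apply]
    simp only [map_sum, map_smul, _root_.sum_apply, _root_.smul_apply,
      smul_eq_mul]
    rw [Finset.sum_comm]
    calc ∑ l, ∑ k, ginv B k l * ℓ (stdVec l) * B (stdVec k) (stdVec j)
        = ∑ l, ℓ (stdVec l) * ∑ k, ginv B l k * B (stdVec k) (stdVec j) := by
          refine Finset.sum_congr rfl fun l _ => ?_
          rw [Finset.mul_sum]
          refine Finset.sum_congr rfl fun k _ => ?_
          rw [hB.ginv_symm k l]; ring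
      _ = ℓ (stdVec j) := by simp [hB.ginv_mul_gram]
  rw [← sum_smul_stdVec y]
  simp [key]

section Trace

variable {F F' : Type*} [AddCommGroup F] [Module ℝ F] [AddCommGroup F'] [Module ℝ F']

theorem formTrace_congr (B : Form d) {β γ : Euc d → Euc d → F}
    (h : ∀ i j, β (stdVec i) (stdVec j) = γ (stdVec i) (stdVec j)) :
    formTrace B β = formTrace B γ := by
  simp [formTrace, h]

theorem formTrace_add (B : Form d) (β γ : Euc d → Euc d → F) :
    formTrace B (fun u w => β u w + γ u w) = formTrace B β + formTrace B γ := by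
  simp [formTrace, Finset.sum_add_distrib]

theorem formTrace_sub (B : Form d) (β γ : Euc d → Euc d → F) :
    formTrace B (fun u w => β u w - γ u w) = formTrace B β - formTrace B γ := by
  simp [formTrace, Finset.sum_sub_distrib, smul_sub]

theorem map_formTrace (B : Form d) (L : F →ₗ[ℝ] F') (β : Euc d → Euc d → F) :
    L (formTrace B β) = formTrace B (fun u w => L (β u w)) := by
  simp [formTrace]

theorem formTrace_smul (B : Form d) (c : ℝ) (β : Euc d → Euc d → F) :
    formTrace B (fun u w => c • β u w) = c • formTrace B β := by
  simp [formTrace, Finset.smul_sum, smul_comm c]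

theorem IsInner.formTrace_swap {B : Form d} (hB : IsInner B) (β : Euc d → Euc d → F) :
    formTrace B (fun u w => β w u) = formTrace B β := by
  simp only [formTrace]
  rw [Finset.sum_comm]
  simp [hB.ginv_symm]

/-- The inverse Gram matrix is positive definite, hence of the form `Cᵀ C` with `C` invertible. The
rows of `C` form an orthonormal basis for `B`, and the trace is the sum over it. This is what yields
positivity of the Hilbert–Schmidt product. -/
theorem exists_formTrace_eq_sum {B : Form d} (hB : IsInner B) :
    ∃ C : Matrix (Fin d) (Fin d) ℝ, IsUnit C.det ∧ ∀ β : Euc d →ₗ[ℝ] Euc d →ₗ[ℝ] ℝ,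
      formTrace B (fun u w => β u w) =
        ∑ k, β (∑ i, C k i • stdVec i) (∑ i, C k i • stdVec i) := by
  open scoped MatrixOrder in
  obtain ⟨C, hC⟩ := CStarAlgebra.nonneg_iff_eq_star_mul_self.mp hB.ginv_posDef.posSemidef.nonneg
  refine ⟨C, ?_, fun β => ?_⟩
  · have h1 := hB.ginv_posDef.det_pos
    rw [hC, Matrix.det_mul] at h1
    exact isUnit_iff_ne_zero.2 (right_ne_zero_of_mul h1.ne')
  · have h : ∀ i j, ginv B i j = ∑ k, C k i * C k j := by
      intro i j
      rw [hC]; simp [Matrix.mul_apply, Matrix.star_apply]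
    simp only [formTrace, h, map_sum, map_smul, LinearMap.sum_apply, LinearMap.smul_apply,
      smul_eq_mul, Finset.sum_mul, Finset.mul_sum]
    rw [Finset.sum_comm_cycle]
    refine Finset.sum_congr rfl fun k _ => ?_
    rw [Finset.sum_comm]
    refine Finset.sum_congr rfl fun i _ => Finset.sum_congr rfl fun j _ => ?_
    ring

/-- The trace of a bilinear form does not depend on the coordinates. -/
theorem IsInner.formTrace_comp {B B' : Form d} (hB : IsInner B) (A : Euc d →L[ℝ] Euc d)
    (A' : Euc d →L[ℝ] Euc d) (hA : ∀ u, A (A' u) = u)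
    (hBB' : ∀ u w, B' u w = B (A u) (A w)) (β : Euc d →ₗ[ℝ] Euc d →ₗ[ℝ] F) :
    formTrace B' (fun u w => β (A u) (A w)) = formTrace B (fun u w => β u w) := by
  obtain ⟨P, hP⟩ : ∃ P : Matrix (Fin d) (Fin d) ℝ, ∀ k i, P k i = A (stdVec i) k :=
    ⟨Matrix.of fun k i => A (stdVec i) k, fun _ _ => rfl⟩
  obtain ⟨P', hP'⟩ : ∃ P : Matrix (Fin d) (Fin d) ℝ, ∀ k i, P k i = A' (stdVec i) k :=
    ⟨Matrix.of fun k i => A' (stdVec i) k, fun _ _ => rfl⟩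
  have hAe : ∀ i, A (stdVec i) = ∑ k, P k i • stdVec k := fun i => by
    simp only [hP, sum_smul_stdVec]
  have hAe' : ∀ i, A' (stdVec i) = ∑ k, P' k i • stdVec k := fun i => by
    simp only [hP', sum_smul_stdVec]
  have hPP : P * P' = 1 := by
    ext k i
    have h1 := hA (stdVec i)
    rw [hAe', map_sum] at h1
    have h2 := congrArg (fun v : Euc d => v k) h1
    simp only [map_smul, WithLp.ofLp_sum, WithLp.ofLp_smul, Finset.sum_apply, Pi.smul_apply,
      smul_eq_mul] at h2
    rw [Matrix.mul_apply]
    simp only [hP]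
    rw [Finset.sum_congr rfl fun l _ => mul_comm (A (stdVec l) k) (P' l i), h2]
    simp [stdVec, Matrix.one_apply]
  -- The Gram matrix is covariant, so its inverse is contravariant. The factors `P` that come from
  -- `A` in the two slots of `β` turn `ginv B'` back into `ginv B`, which is `hback`.
  have hgram : gram (fun u w => B' u w) = P.transpose * gram (fun u w => B u w) * P := by
    ext i j
    rw [gram_apply, hBB', hAe, hAe]
    simp only [map_sum, map_smul, _root_.sum_apply, _root_.smul_apply,
      smul_eq_mul, Matrix.mul_apply, Matrix.transpose_apply, gram_apply, Finset.sum_mul,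
      Finset.mul_sum]
    refine Finset.sum_congr rfl fun l _ => Finset.sum_congr rfl fun k _ => ?_
    ring
  have hPP2 : P' * P = 1 := mul_eq_one_comm.1 hPP
  have hinv : ginv B' = P' * ginv B * P'.transpose := by
    unfold ginv
    refine Matrix.inv_eq_left_inv ?_
    rw [hgram]
    have hT : P'.transpose * P.transpose = 1 := by
      rw [← Matrix.transpose_mul, hPP, Matrix.transpose_one]
    calc P' * (gram fun u w => B u w)⁻¹ * P'.transpose *
          (P.transpose * gram (fun u w => B u w) * P)
        = P' * (gram fun u w => B u w)⁻¹ * (P'.transpose * P.transpose) *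
          gram (fun u w => B u w) * P := by simp only [Matrix.mul_assoc]
      _ = 1 := by
        rw [hT, Matrix.mul_one, Matrix.mul_assoc P', Matrix.nonsing_inv_mul _ hB.isUnit_det,
          Matrix.mul_one, hPP2]
  have hback : ∀ k l, ginv B k l = ∑ i, ∑ j, P k i * ginv B' i j * P l j := by
    intro k l
    have : ginv B = P * ginv B' * P.transpose := by
      rw [hinv]
      have hT : P'.transpose * P.transpose = 1 := by
        rw [← Matrix.transpose_mul, hPP, Matrix.transpose_one]
      calc ginv B = (P * P') * ginv B * (P'.transpose * P.transpose) := by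
            rw [hPP, hT, Matrix.one_mul, Matrix.mul_one]
        _ = _ := by simp only [Matrix.mul_assoc]
    rw [this]
    simp only [Matrix.mul_apply, Matrix.transpose_apply, Finset.sum_mul]
    rw [Finset.sum_comm]
  simp only [formTrace, hAe, map_sum, map_smul, LinearMap.sum_apply, LinearMap.smul_apply, hback,
    Finset.sum_smul, Finset.smul_sum, smul_smul]
  calc ∑ i, ∑ j, ∑ k, ∑ l, (ginv B' i j * (P k j * P l i)) • β (stdVec l) (stdVec k)
      = ∑ i, ∑ j, ∑ l, ∑ k, (ginv B' i j * (P k j * P l i)) • β (stdVec l) (stdVec k) := by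
        refine Finset.sum_congr rfl fun i _ => Finset.sum_congr rfl fun j _ => Finset.sum_comm
    _ = ∑ i, ∑ l, ∑ j, ∑ k, (ginv B' i j * (P k j * P l i)) • β (stdVec l) (stdVec k) := by
        refine Finset.sum_congr rfl fun i _ => Finset.sum_comm
    _ = ∑ l, ∑ i, ∑ k, ∑ j, (ginv B' i j * (P k j * P l i)) • β (stdVec l) (stdVec k) := by
        rw [Finset.sum_comm]
        refine Finset.sum_congr rfl fun l _ => Finset.sum_congr rfl fun i _ => Finset.sum_comm
    _ = ∑ l, ∑ k, ∑ i, ∑ j, (P l i * ginv B' i j * P k j) • β (stdVec l) (stdVec k) := by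
        refine Finset.sum_congr rfl fun l _ => ?_
        rw [Finset.sum_comm]
        refine Finset.sum_congr rfl fun k _ => Finset.sum_congr rfl fun i _ =>
          Finset.sum_congr rfl fun j _ => ?_
        congr 1; ring

end Trace

end

/-! ### Coordinate Riemannian geometry: Levi-Civita connection and curvature on open subsets of
`ℝᵈ`. -/

section
variable {d : ℕ}

theorem two_le_infty : minSmoothness ℝ 2 ≤ (∞ : WithTop ℕ∞) := by
  rw [minSmoothness_of_isRCLikeNormedField]
  exact WithTop.coe_le_coe.2 (le_top (a := (2 : ℕ∞)))

/-- `𝒢` is a smooth Riemannian metric on the open set `U`. -/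
structure IsMetricOn (𝒢 : Euc d → Form d) (U : Set (Euc d)) : Prop where
  isOpen : IsOpen U
  smooth : ContDiffOn ℝ ∞ 𝒢 U
  inner : ∀ z ∈ U, IsInner (𝒢 z)

section Smoothness

variable {P : Type*} [NormedAddCommGroup P] [NormedSpace ℝ P] {k : WithTop ℕ∞}

theorem contDiffAt_det {ι : Type*} [Fintype ι] [DecidableEq ι] {A : P → Matrix ι ι ℝ} {a : P}
    (hA : ∀ i j, ContDiffAt ℝ k (fun x => A x i j) a) :
    ContDiffAt ℝ k (fun x => (A x).det) a := by
  simp only [Matrix.det_apply]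
  refine ContDiffAt.sum fun σ _ => ContDiffAt.const_smul _ ?_
  exact contDiffAt_prod fun i _ => hA _ _

/-- Cramer's rule: the entries of the inverse are cofactors, which are themselves determinants,
divided by the determinant. -/
theorem contDiffAt_matrix_inv {ι : Type*} [Fintype ι] [DecidableEq ι] {A : P → Matrix ι ι ℝ}
    {a : P} (hA : ∀ i j, ContDiffAt ℝ k (fun x => A x i j) a) (h0 : (A a).det ≠ 0) (i j : ι) :
    ContDiffAt ℝ k (fun x => (A x)⁻¹ i j) a := by
  simp only [Matrix.inv_def, Matrix.smul_apply, Ring.inverse_eq_inv', smul_eq_mul]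
  refine ((contDiffAt_det hA).inv h0).mul ?_
  simp only [Matrix.adjugate_apply]
  refine contDiffAt_det fun k l => ?_
  by_cases h : k = j
  · subst h; simpa using contDiffAt_const
  · simpa [Matrix.updateRow_ne h] using hA k l

theorem contDiffAt_gram {𝒢 : P → Form d} {a : P} (h𝒢 : ContDiffAt ℝ k 𝒢 a) (i j : Fin d) :
    ContDiffAt ℝ k (fun x => gram (fun u w => 𝒢 x u w) i j) a :=
  (h𝒢.clm_apply contDiffAt_const).clm_apply contDiffAt_const

theorem contDiffAt_ginv {𝒢 : P → Form d} {a : P} (h𝒢 : ContDiffAt ℝ k 𝒢 a)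
    (h : IsInner (𝒢 a)) (i j : Fin d) : ContDiffAt ℝ k (fun x => ginv (𝒢 x) i j) a :=
  contDiffAt_matrix_inv (fun i j => contDiffAt_gram h𝒢 i j) h.det_pos.ne' i j

theorem contDiffAt_sharp {𝒢 : P → Form d} {a : P} (h𝒢 : ContDiffAt ℝ k 𝒢 a)
    (h : IsInner (𝒢 a)) : ContDiffAt ℝ k (fun x => sharp (𝒢 x)) a := by
  unfold sharp
  exact ContDiffAt.sum fun i _ => ContDiffAt.sum fun j _ =>
    (contDiffAt_ginv h𝒢 h i j).smul contDiffAt_const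

end Smoothness

/-- The Koszul form `½ (∂_u g(w, y) + ∂_w g(u, y) - ∂_y g(u, w))` in terms of the derivative `D` of
the metric. -/
def koszul (D : Euc d →L[ℝ] Form d) : Euc d →L[ℝ] Euc d →L[ℝ] Euc d →L[ℝ] ℝ :=
  (1 / 2 : ℝ) • (D + D.flip -
    ((ContinuousLinearMap.flipₗᵢ ℝ (Euc d) (Euc d) ℝ).toContinuousLinearEquiv :
      Form d →L[ℝ] Form d) ∘L D.flip)

theorem koszul_apply (D : Euc d →L[ℝ] Form d) (u w y : Euc d) :
    koszul D u w y = (1 / 2 : ℝ) * (D u w y + D w u y - D y u w) := by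
  simp [koszul]

/-- `koszul` as a continuous linear map. -/
def koszulL : (Euc d →L[ℝ] Form d) →L[ℝ] (Euc d →L[ℝ] Form d) :=
  LinearMap.toContinuousLinearMap
    { toFun := koszul
      map_add' := fun D D' => by ext u w y; simp only [koszul_apply, _root_.add_apply]; ring
      map_smul' := fun c D => by
        ext u w y; simp only [koszul_apply, _root_.smul_apply, smul_eq_mul, RingHom.id_apply]; ring }

/-- The Christoffel symbols as a field of bilinear maps. -/
def chr (𝒢 : Euc d → Form d) (z : Euc d) : Euc d →L[ℝ] Euc d →L[ℝ] Euc d :=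
  (ContinuousLinearMap.compL ℝ (Euc d) (Euc d →L[ℝ] ℝ) (Euc d) (sharp (𝒢 z))) ∘L
    koszul (fderiv ℝ 𝒢 z)

theorem chr_apply (𝒢 : Euc d → Form d) (z u w : Euc d) :
    chr 𝒢 z u w = sharp (𝒢 z) (koszul (fderiv ℝ 𝒢 z) u w) := rfl

theorem fderiv_form_apply {𝒢 : Euc d → Form d} {z : Euc d} (h : DifferentiableAt ℝ 𝒢 z)
    (u w y : Euc d) : fderiv ℝ (fun x => 𝒢 x w y) z u = fderiv ℝ 𝒢 z u w y := by
  have := (h.hasFDerivAt.clm_apply (hasFDerivAt_const w z)).clm_apply (hasFDerivAt_const y z)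
  rw [this.fderiv]
  simp

namespace IsMetricOn

variable {𝒢 : Euc d → Form d} {U : Set (Euc d)} (hG : IsMetricOn 𝒢 U) {z : Euc d} (hz : z ∈ U)
include hG hz

theorem contDiffAt : ContDiffAt ℝ ∞ 𝒢 z := hG.smooth.contDiffAt (hG.isOpen.mem_nhds hz)

theorem differentiableAt : DifferentiableAt ℝ 𝒢 z :=
  (hG.contDiffAt hz).differentiableAt (by simp)

theorem contDiffAt_fderiv : ContDiffAt ℝ ∞ (fderiv ℝ 𝒢) z :=
  (hG.contDiffAt hz).fderiv_right (by simp)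

/-- The bridge from the coordinate sum in the definition to the bundled field `chr`, which can be
differentiated as a map into a normed space. -/
theorem christoffel_eq (u w : Euc d) :
    christoffel (fun z u w => 𝒢 z u w) z u w = chr 𝒢 z u w := by
  rw [chr_apply, sharp_apply]
  simp only [christoffel, koszul_apply, fderiv_form_apply (hG.differentiableAt hz)]
  rfl

theorem apply_chr (u w y : Euc d) :
    𝒢 z (chr 𝒢 z u w) y = (1 / 2 : ℝ) *
      (fderiv ℝ 𝒢 z u w y + fderiv ℝ 𝒢 z w u y - fderiv ℝ 𝒢 z y u w) := by
  rw [chr_apply, (hG.inner z hz).apply_sharp, koszul_apply]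

theorem fderiv_symm (v u w : Euc d) : fderiv ℝ 𝒢 z v u w = fderiv ℝ 𝒢 z v w u := by
  rw [← fderiv_form_apply (hG.differentiableAt hz), ← fderiv_form_apply (hG.differentiableAt hz)]
  refine congrArg (fun L : Euc d →L[ℝ] ℝ => L v) (Filter.EventuallyEq.fderiv_eq ?_)
  filter_upwards [hG.isOpen.mem_nhds hz] with y hy
  exact (hG.inner y hy).symm _ _

theorem chr_symm (u w : Euc d) : chr 𝒢 z u w = chr 𝒢 z w u := by
  refine (hG.inner z hz).ext_right fun y => ?_
  rw [hG.apply_chr hz, hG.apply_chr hz, hG.fderiv_symm hz y u w]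
  ring

/-- The Levi-Civita connection is metric. -/
theorem fderiv_eq (v u w : Euc d) :
    fderiv ℝ 𝒢 z v u w = 𝒢 z (chr 𝒢 z v u) w + 𝒢 z u (chr 𝒢 z v w) := by
  rw [(hG.inner z hz).symm u, hG.apply_chr hz, hG.apply_chr hz, hG.fderiv_symm hz v w u]
  ring

theorem contDiffAt_chr : ContDiffAt ℝ ∞ (chr 𝒢) z := by
  have h1 : ContDiffAt ℝ ∞ (fun x => koszul (fderiv ℝ 𝒢 x)) z :=
    (koszulL (d := d)).contDiff.contDiffAt.comp z (hG.contDiffAt_fderiv hz)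
  have h2 := contDiffAt_sharp (hG.contDiffAt hz) (hG.inner z hz)
  have h3 := (ContinuousLinearMap.compL ℝ (Euc d) (Euc d →L[ℝ] ℝ) (Euc d)).contDiff.contDiffAt.comp
    z h2
  exact h3.clm_comp h1

theorem differentiableAt_chr : DifferentiableAt ℝ (chr 𝒢) z :=
  (hG.contDiffAt_chr hz).differentiableAt (by simp)

end IsMetricOn

/-- The transformation law of the Christoffel symbols: if `𝒢` is the pull-back of `ℋ` under `β`,
then `Γ^ℋ(Dβ u, Dβ w) + D²β(u, w) = Dβ Γ^𝒢(u, w)`. -/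
theorem chr_transform {𝒢 ℋ : Euc d → Form d} {U V : Set (Euc d)} (hG : IsMetricOn 𝒢 U)
    (hH : IsMetricOn ℋ V) {β : Euc d → Euc d} {z : Euc d} (hz : z ∈ U) (hβz : β z ∈ V)
    (hβ : ContDiffAt ℝ ∞ β z)
    (hsurj : Function.Surjective (fderiv ℝ β z))
    (hpull : ∀ᶠ y in 𝓝 z, ∀ u w, 𝒢 y u w = ℋ (β y) (fderiv ℝ β y u) (fderiv ℝ β y w))
    (u w : Euc d) :
    chr ℋ (β z) (fderiv ℝ β z u) (fderiv ℝ β z w) + fderiv ℝ (fderiv ℝ β) z u w =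
      fderiv ℝ β z (chr 𝒢 z u w) := by
  have hβ1 : HasFDerivAt β (fderiv ℝ β z) z := (hβ.differentiableAt (by simp)).hasFDerivAt
  have hβ' : ContDiffAt ℝ ∞ (fderiv ℝ β) z := hβ.fderiv_right (by simp)
  have hβ2 : HasFDerivAt (fderiv ℝ β) (fderiv ℝ (fderiv ℝ β) z) z :=
    (hβ'.differentiableAt (by simp)).hasFDerivAt
  have hsymm2 : ∀ u w, fderiv ℝ (fderiv ℝ β) z u w = fderiv ℝ (fderiv ℝ β) z w u := fun u w =>
    (hβ.isSymmSndFDerivAt two_le_infty).eq u w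
  -- The pull-back relation is differentiated once. Of the terms with `D²β`, the Koszul combination
  -- retains only `D²β(u, w)`; the others cancel by the symmetry of second derivatives.
  have hD : ∀ v u w, fderiv ℝ 𝒢 z v u w =
      fderiv ℝ ℋ (β z) (fderiv ℝ β z v) (fderiv ℝ β z u) (fderiv ℝ β z w)
      + ℋ (β z) (fderiv ℝ (fderiv ℝ β) z v u) (fderiv ℝ β z w)
      + ℋ (β z) (fderiv ℝ β z u) (fderiv ℝ (fderiv ℝ β) z v w) := by
    intro v u w
    rw [← fderiv_form_apply (hG.differentiableAt hz)]
    have h1 : (fun x => 𝒢 x u w) =ᶠ[𝓝 z]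
        fun x => ℋ (β x) (fderiv ℝ β x u) (fderiv ℝ β x w) := by
      filter_upwards [hpull] with y hy using hy u w
    rw [h1.fderiv_eq]
    have h2 : HasFDerivAt (fun x => ℋ (β x)) (fderiv ℝ ℋ (β z) ∘L fderiv ℝ β z) z :=
      (hH.differentiableAt hβz).hasFDerivAt.comp z hβ1
    have h3 := hβ2.clm_apply (hasFDerivAt_const u z)
    have h4 := hβ2.clm_apply (hasFDerivAt_const w z)
    rw [((h2.clm_apply h3).clm_apply h4).fderiv]
    simp
    ring
  -- Both sides are determined by their products with all vectors, and surjectivity makes each of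
  -- these `Dβ y`. The products are then Koszul expressions in `hD`.
  refine (hH.inner _ hβz).ext_right fun y' => ?_
  obtain ⟨y, rfl⟩ := hsurj y'
  have hz' := hpull.self_of_nhds
  rw [map_add, _root_.add_apply, ← hz', hH.apply_chr hβz, hG.apply_chr hz, hD, hD, hD,
    hsymm2 w u, hsymm2 y u, hsymm2 y w, (hH.inner _ hβz).symm _ (fderiv ℝ (fderiv ℝ β) z w y),
    (hH.inner _ hβz).symm _ (fderiv ℝ (fderiv ℝ β) z u y)]
  ring

/-! ### Covariant derivative along a map and curvature -/

section Covariant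

variable {P : Type*} [NormedAddCommGroup P] [NormedSpace ℝ P]

/-- The covariant derivative of the vector field `V` along the map `f`. -/
def covE (ℋ : Euc d → Form d) (f V : P → Euc d) (a ξ : P) : Euc d :=
  fderiv ℝ V a ξ + chr ℋ (f a) (fderiv ℝ f a ξ) (V a)

/-- The curvature tensor. -/
def curvE (ℋ : Euc d → Form d) (z u v w : Euc d) : Euc d :=
  fderiv ℝ (chr ℋ) z u v w - fderiv ℝ (chr ℋ) z v u w
    + chr ℋ z u (chr ℋ z v w) - chr ℋ z v (chr ℋ z u w)

variable {ℋ : Euc d → Form d} {V : Set (Euc d)} (hH : IsMetricOn ℋ V)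
include hH

theorem IsMetricOn.coordCurvature_eq {z : Euc d} (hz : z ∈ V) (u v w : Euc d) :
    coordCurvature (fun z u w => ℋ z u w) z u v w = curvE ℋ z u v w := by
  have key : ∀ u v w : Euc d,
      fderiv ℝ (fun y => christoffel (fun z u w => ℋ z u w) y v w) z u =
        fderiv ℝ (chr ℋ) z u v w := by
    intro u v w
    have h1 : (fun y => christoffel (fun z u w => ℋ z u w) y v w) =ᶠ[𝓝 z]
        fun y => chr ℋ y v w := by
      filter_upwards [hH.isOpen.mem_nhds hz] with y hy using hH.christoffel_eq hy v w
    rw [h1.fderiv_eq]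
    have := ((hH.differentiableAt_chr hz).hasFDerivAt.clm_apply (hasFDerivAt_const v z)).clm_apply
      (hasFDerivAt_const w z)
    rw [this.fderiv]
    simp
  simp only [coordCurvature, key, hH.christoffel_eq hz, curvE]

theorem IsMetricOn.hasFDerivAt_inner {f X Y : P → Euc d} {a : P} (ha : f a ∈ V)
    (hf : DifferentiableAt ℝ f a) (hX : DifferentiableAt ℝ X a) (hY : DifferentiableAt ℝ Y a)
    (ξ : P) :
    fderiv ℝ (fun x => ℋ (f x) (X x) (Y x)) a ξ =
      ℋ (f a) (covE ℋ f X a ξ) (Y a) + ℋ (f a) (X a) (covE ℋ f Y a ξ) := by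
  have h2 : HasFDerivAt (fun x => ℋ (f x)) (fderiv ℝ ℋ (f a) ∘L fderiv ℝ f a) a :=
    (hH.differentiableAt ha).hasFDerivAt.comp a hf.hasFDerivAt
  rw [((h2.clm_apply hX.hasFDerivAt).clm_apply hY.hasFDerivAt).fderiv]
  simp [covE, hH.fderiv_eq ha]
  ring

/-- Covariant derivatives of the velocities of a map commute. -/
theorem IsMetricOn.covE_fderiv_comm {f : P → Euc d} {a : P} (ha : f a ∈ V)
    (hf : ContDiffAt ℝ ∞ f a) (ξ η : P) :
    covE ℋ f (fun x => fderiv ℝ f x η) a ξ = covE ℋ f (fun x => fderiv ℝ f x ξ) a η := by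
  have h1 : DifferentiableAt ℝ (fderiv ℝ f) a :=
    ((hf.fderiv_right (m := ∞) (by simp)).differentiableAt (by simp))
  have h2 : ∀ ξ η : P, fderiv ℝ (fun x => fderiv ℝ f x η) a ξ = fderiv ℝ (fderiv ℝ f) a ξ η := by
    intro ξ η
    rw [(h1.hasFDerivAt.clm_apply (hasFDerivAt_const η a)).fderiv]
    simp
  have h3 : fderiv ℝ (fderiv ℝ f) a ξ η = fderiv ℝ (fderiv ℝ f) a η ξ :=
    (hf.isSymmSndFDerivAt two_le_infty).eq ξ η
  simp only [covE, h2]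
  rw [h3, hH.chr_symm ha]

/-- The commutator of covariant derivatives is the curvature. -/
theorem IsMetricOn.covE_commutator {f X : P → Euc d} {a : P} (ha : f a ∈ V)
    (hf : ContDiffAt ℝ ∞ f a) (hX : ContDiffAt ℝ 2 X a) (ξ η : P) :
    covE ℋ f (fun x => covE ℋ f X x η) a ξ =
      covE ℋ f (fun x => covE ℋ f X x ξ) a η +
        curvE ℋ (f a) (fderiv ℝ f a ξ) (fderiv ℝ f a η) (X a) := by
  have hf1 : HasFDerivAt (fderiv ℝ f) (fderiv ℝ (fderiv ℝ f) a) a :=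
    ((hf.fderiv_right (m := ∞) (by simp)).differentiableAt (by simp)).hasFDerivAt
  have hX1 : HasFDerivAt (fderiv ℝ X) (fderiv ℝ (fderiv ℝ X) a) a :=
    ((hX.fderiv_right (m := 1) (by norm_num)).differentiableAt (by simp)).hasFDerivAt
  have hX0 : HasFDerivAt X (fderiv ℝ X a) a := (hX.differentiableAt (by simp)).hasFDerivAt
  have hf0 : HasFDerivAt f (fderiv ℝ f a) a := (hf.differentiableAt (by simp)).hasFDerivAt
  have hΓ : HasFDerivAt (fun x => chr ℋ (f x)) (fderiv ℝ (chr ℋ) (f a) ∘L fderiv ℝ f a) a :=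
    (hH.differentiableAt_chr ha).hasFDerivAt.comp a hf0
  have hsf : ∀ ξ η, fderiv ℝ (fderiv ℝ f) a ξ η = fderiv ℝ (fderiv ℝ f) a η ξ := fun ξ η =>
    (hf.isSymmSndFDerivAt two_le_infty).eq ξ η
  have hsX : ∀ ξ η, fderiv ℝ (fderiv ℝ X) a ξ η = fderiv ℝ (fderiv ℝ X) a η ξ := fun ξ η =>
    (hX.isSymmSndFDerivAt (by simp)).eq ξ η
  -- The second derivatives of `X` and `f` are symmetric in `ξ` and `η` and drop out of the
  -- commutator. What is left are the derivative of the Christoffel field and the products of two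
  -- Christoffel symbols, that is, the curvature.
  have key : ∀ ξ η : P, fderiv ℝ (fun x => covE ℋ f X x η) a ξ =
      fderiv ℝ (fderiv ℝ X) a ξ η + (fderiv ℝ (chr ℋ) (f a) (fderiv ℝ f a ξ) (fderiv ℝ f a η) (X a)
        + chr ℋ (f a) (fderiv ℝ (fderiv ℝ f) a ξ η) (X a)
        + chr ℋ (f a) (fderiv ℝ f a η) (fderiv ℝ X a ξ)) := by
    intro ξ η
    have := (hX1.clm_apply (hasFDerivAt_const η a)).add
      ((hΓ.clm_apply (hf1.clm_apply (hasFDerivAt_const η a))).clm_apply hX0)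
    have h2 : fderiv ℝ (fun x => covE ℋ f X x η) a = _ := this.fderiv
    rw [h2]
    simp
    abel
  have e1 : ∀ ξ η : P, covE ℋ f (fun x => covE ℋ f X x η) a ξ =
      fderiv ℝ (fun x => covE ℋ f X x η) a ξ + chr ℋ (f a) (fderiv ℝ f a ξ)
        (fderiv ℝ X a η + chr ℋ (f a) (fderiv ℝ f a η) (X a)) := fun ξ η => rfl
  rw [e1, e1, key, key, hsf η ξ, hsX η ξ, curvE]
  simp only [map_add]
  abel

/-- Second derivatives of the metric commute. Expressing them by the Christoffel symbols through
metric compatibility (`fderiv_eq`), their antisymmetrisation in `u`, `v` is `⟨R(u,v)a, b⟩ + ⟨a,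
R(u,v)b⟩`. -/
theorem IsMetricOn.curvE_inner_skew {z : Euc d} (hz : z ∈ V) (u v a b : Euc d) :
    ℋ z (curvE ℋ z u v a) b = - ℋ z a (curvE ℋ z u v b) := by
  have hD2 : DifferentiableAt ℝ (fderiv ℝ ℋ) z :=
    (hH.contDiffAt_fderiv hz).differentiableAt (by simp)
  have hs : ∀ u v, fderiv ℝ (fderiv ℝ ℋ) z u v = fderiv ℝ (fderiv ℝ ℋ) z v u := fun u v =>
    ((hH.contDiffAt hz).isSymmSndFDerivAt two_le_infty).eq u v
  have hH1 := (hH.differentiableAt hz).hasFDerivAt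
  have hΓ := (hH.differentiableAt_chr hz).hasFDerivAt
  have key : ∀ u v a b : Euc d, fderiv ℝ (fderiv ℝ ℋ) z u v a b =
      ℋ z (chr ℋ z u (chr ℋ z v a)) b + ℋ z (chr ℋ z v a) (chr ℋ z u b)
      + ℋ z (fderiv ℝ (chr ℋ) z u v a) b
      + (ℋ z (chr ℋ z u a) (chr ℋ z v b) + ℋ z a (chr ℋ z u (chr ℋ z v b))
      + ℋ z a (fderiv ℝ (chr ℋ) z u v b)) := by
    intro u v a b
    have h1 : fderiv ℝ (fun x => fderiv ℝ ℋ x v a b) z u = fderiv ℝ (fderiv ℝ ℋ) z u v a b := by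
      have := ((hD2.hasFDerivAt.clm_apply (hasFDerivAt_const v z)).clm_apply
        (hasFDerivAt_const a z)).clm_apply (hasFDerivAt_const b z)
      rw [this.fderiv]
      simp
    rw [← h1]
    have h2 : (fun x => fderiv ℝ ℋ x v a b) =ᶠ[𝓝 z]
        fun x => ℋ x (chr ℋ x v a) b + ℋ x a (chr ℋ x v b) := by
      filter_upwards [hH.isOpen.mem_nhds hz] with y hy using hH.fderiv_eq hy v a b
    rw [h2.fderiv_eq]
    have hc : ∀ a : Euc d, HasFDerivAt (fun x => chr ℋ x v a) _ z := fun a =>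
      (hΓ.clm_apply (hasFDerivAt_const v z)).clm_apply (hasFDerivAt_const a z)
    have h3 := ((hH1.clm_apply (hc a)).clm_apply (hasFDerivAt_const b z)).add
      ((hH1.clm_apply (hasFDerivAt_const a z)).clm_apply (hc b))
    have h4 : fderiv ℝ (fun x => ℋ x (chr ℋ x v a) b + ℋ x a (chr ℋ x v b)) z = _ := h3.fderiv
    rw [h4]
    simp [hH.fderiv_eq hz]
    ring
  have h1 := key u v a b
  rw [hs, key v u a b] at h1
  simp only [curvE, map_add, map_sub, _root_.add_apply, _root_.sub_apply]
  linarith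

/-- The connection is torsion-free: `chr` is symmetric in its two arguments on the whole open set,
so its derivative is too, and the cyclic sum cancels in pairs. -/
theorem IsMetricOn.curvE_bianchi {z : Euc d} (hz : z ∈ V) (u v w : Euc d) :
    curvE ℋ z u v w + curvE ℋ z v w u + curvE ℋ z w u v = 0 := by
  have hs : ∀ u v w : Euc d, fderiv ℝ (chr ℋ) z u v w = fderiv ℝ (chr ℋ) z u w v := by
    have hΓ := (hH.differentiableAt_chr hz).hasFDerivAt
    have h0 : ∀ u v w : Euc d, fderiv ℝ (fun x => chr ℋ x v w) z u = fderiv ℝ (chr ℋ) z u v w := by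
      intro u v w
      rw [((hΓ.clm_apply (hasFDerivAt_const v z)).clm_apply (hasFDerivAt_const w z)).fderiv]
      simp
    intro u v w
    rw [← h0, ← h0]
    refine congrArg (fun L : Euc d →L[ℝ] Euc d => L u) (Filter.EventuallyEq.fderiv_eq ?_)
    filter_upwards [hH.isOpen.mem_nhds hz] with y hy using hH.chr_symm hy v w
  simp only [curvE, hH.chr_symm hz u w, hH.chr_symm hz v w, hH.chr_symm hz v u, hs u v w, hs v w u,
    hs w u v]
  abel

/-- The pair symmetry of the curvature tensor. -/
theorem IsMetricOn.curvE_pair {z : Euc d} (hz : z ∈ V) (u v w y : Euc d) :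
    ℋ z (curvE ℋ z u v w) y = ℋ z (curvE ℋ z w y u) v := by
  have hanti : ∀ u v w, curvE ℋ z u v w = - curvE ℋ z v u w := by
    intro u v w; simp only [curvE]; abel
  have hA : ∀ u v w y, ℋ z (curvE ℋ z u v w) y = - ℋ z (curvE ℋ z v u w) y := by
    intro u v w y; rw [hanti]; simp
  have hB : ∀ u v w y, ℋ z (curvE ℋ z u v w) y = - ℋ z (curvE ℋ z u v y) w := by
    intro u v w y; rw [hH.curvE_inner_skew hz, (hH.inner z hz).symm]
  have hC : ∀ u v w y, ℋ z (curvE ℋ z u v w) y + ℋ z (curvE ℋ z v w u) y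
      + ℋ z (curvE ℋ z w u v) y = 0 := by
    intro u v w y
    have := congrArg (fun x => ℋ z x y) (hH.curvE_bianchi hz u v w)
    simpa using this
  -- The octahedron argument: the four Bianchi identities for the cyclic rotations of `u, v, w, y`,
  -- combined by means of the two skew symmetries.
  linarith [hC u v w y, hC v w y u, hC w y u v, hC y u v w, hA u v w y, hB u v w y, hA v w u y,
    hB v w u y, hA w u v y, hB w u v y, hA v w y u, hB v w y u, hA w y v u, hB w y v u,
    hA y v w u, hB y v w u, hA w y u v, hB w y u v, hA y u w v, hB y u w v, hA u w y v,
    hB u w y v, hA y u v w, hB y u v w, hA u v y w, hB u v y w, hA v y u w, hB v y u w]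

end Covariant

end

/-! ### Divergence of bundle-valued one-forms, and independence of coordinates. -/

section
variable {m n : ℕ}

/-- The divergence of a one-form with values in the pull-back of the tangent bundle. -/
def divE (𝒢 : Euc m → Form m) (ℋ : Euc n → Form n) (f : Euc m → Euc n)
    (S : Euc m → Euc m →L[ℝ] Euc n) (z : Euc m) : Euc n :=
  formTrace (𝒢 z) fun u w => covE ℋ f (fun y => S y w) z u - S z (chr 𝒢 z u w)

/-- The inner product of two linear maps. -/
def innE (B : Form m) (C : Form n) (S T : Euc m → Euc n) : ℝ :=
  formTrace B fun u w => C (S u) (T w)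

theorem clm_formTrace {F F' : Type*} [NormedAddCommGroup F] [NormedSpace ℝ F]
    [NormedAddCommGroup F'] [NormedSpace ℝ F'] (B : Form m) (L : F →L[ℝ] F')
    (β : Euc m → Euc m → F) :
    L (formTrace B β) = formTrace B (fun u w => L (β u w)) :=
  map_formTrace B (L : F →ₗ[ℝ] F') β

section Natural

variable {𝒢 𝒢' : Euc m → Form m} {ℋ ℋ' : Euc n → Form n} {a α : Euc m → Euc m}
  {β : Euc n → Euc n} {f f' : Euc m → Euc n} {z : Euc m} {V V' : Set (Euc n)}

theorem differentiableAt_of_comp {F : Type*} [NormedAddCommGroup F] [NormedSpace ℝ F]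
    {X X' : Euc m → F} (hα : ContDiffAt ℝ ∞ α (a z)) (hαz : α (a z) = z)
    (haα : ∀ᶠ y in 𝓝 (a z), a (α y) = y)
    (hX : DifferentiableAt ℝ X z) (h : ∀ᶠ y in 𝓝 z, X' (a y) = X y) :
    DifferentiableAt ℝ X' (a z) := by
  have hα1 : DifferentiableAt ℝ α (a z) := hα.differentiableAt (by simp)
  have h1 : DifferentiableAt ℝ (X ∘ α) (a z) := by
    refine DifferentiableAt.comp (a z) ?_ hα1
    rwa [hαz]
  refine h1.congr_of_eventuallyEq ?_
  have h2 : Filter.Tendsto α (𝓝 (a z)) (𝓝 z) := by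
    have := hα1.continuousAt.tendsto
    rwa [hαz] at this
  filter_upwards [h2.eventually h, haα] with y hy hy'
  rw [Function.comp_apply, ← hy, hy']

/-- The chain rule for `X = X' ∘ a`. Smoothness is assumed only of `X`; that of `X'` is recovered
from `X' = X ∘ α` by `differentiableAt_of_comp`. -/
theorem fderiv_comp_eq {F : Type*} [NormedAddCommGroup F] [NormedSpace ℝ F]
    {X X' : Euc m → F} (ha : ContDiffAt ℝ ∞ a z)
    (hα : ContDiffAt ℝ ∞ α (a z)) (hαz : α (a z) = z)
    (haα : ∀ᶠ y in 𝓝 (a z), a (α y) = y)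
    (hX : DifferentiableAt ℝ X z) (h : ∀ᶠ y in 𝓝 z, X' (a y) = X y) (u : Euc m) :
    fderiv ℝ X' (a z) (fderiv ℝ a z u) = fderiv ℝ X z u := by
  have h1 := differentiableAt_of_comp hα hαz haα hX h
  have h2 : fderiv ℝ (X' ∘ a) z = fderiv ℝ X z := Filter.EventuallyEq.fderiv_eq h
  rw [← h2, fderiv_comp z h1 (ha.differentiableAt (by simp))]
  rfl

variable (hH : IsMetricOn ℋ V) (hH' : IsMetricOn ℋ' V')
  (ha : ContDiffAt ℝ ∞ a z) (hα : ContDiffAt ℝ ∞ α (a z))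
  (hαa : ∀ᶠ y in 𝓝 z, α (a y) = y) (haα : ∀ᶠ y in 𝓝 (a z), a (α y) = y)
  (hfz : f z ∈ V) (hβfz : β (f z) ∈ V')
  (hβ : ContDiffAt ℝ ∞ β (f z)) (hsurj : Function.Surjective (fderiv ℝ β (f z)))
  (hpull : ∀ᶠ y in 𝓝 (f z), ∀ u w, ℋ y u w = ℋ' (β y) (fderiv ℝ β y u) (fderiv ℝ β y w))
  (hf : ContDiffAt ℝ ∞ f z) (hf' : ∀ᶠ y in 𝓝 z, f' (a y) = β (f y))
include hH hH' ha hα hαa haα hfz hβfz hβ hsurj hpull hf hf'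

/-- Covariant derivatives along maps do not depend on the coordinates. -/
theorem covE_natural {X X' : Euc m → Euc n} (hX : DifferentiableAt ℝ X z)
    (hX' : ∀ᶠ y in 𝓝 z, X' (a y) = fderiv ℝ β (f y) (X y)) (u : Euc m) :
    covE ℋ' f' X' (a z) (fderiv ℝ a z u) = fderiv ℝ β (f z) (covE ℋ f X z u) := by
  have hf1 : HasFDerivAt f (fderiv ℝ f z) z := (hf.differentiableAt (by simp)).hasFDerivAt
  have hβ1 : HasFDerivAt β (fderiv ℝ β (f z)) (f z) :=
    (hβ.differentiableAt (by simp)).hasFDerivAt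
  have hβ2 : HasFDerivAt (fderiv ℝ β) (fderiv ℝ (fderiv ℝ β) (f z)) (f z) :=
    ((hβ.fderiv_right (m := ∞) (by simp)).differentiableAt (by simp)).hasFDerivAt
  have h1 := (hβ2.comp z hf1).clm_apply hX.hasFDerivAt
  have h2 := hβ1.comp z hf1
  have e1 := fderiv_comp_eq ha hα hαa.self_of_nhds haα h1.differentiableAt hX' u
  have e2 := fderiv_comp_eq ha hα hαa.self_of_nhds haα h2.differentiableAt hf' u
  rw [h1.fderiv] at e1
  rw [h2.fderiv] at e2
  rw [covE, e1, e2, hf'.self_of_nhds, hX'.self_of_nhds]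
  -- Differentiating `Dβ(f) X` leaves the term `D²β(Df u, X)`, which is exactly the inhomogeneous
  -- term of the transformation law of the Christoffel symbols.
  have h3 := chr_transform hH hH' hfz hβfz hβ hsurj hpull (fderiv ℝ f z u) (X z)
  rw [covE, map_add, ← h3]
  simp
  abel

variable {U U' : Set (Euc m)} (hG : IsMetricOn 𝒢 U) (hG' : IsMetricOn 𝒢' U')
  (hz : z ∈ U) (haz : a z ∈ U')
  (hpullG : ∀ᶠ y in 𝓝 (a z), ∀ u w, 𝒢' y u w = 𝒢 (α y) (fderiv ℝ α y u) (fderiv ℝ α y w))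
include hG hG' hz haz hpullG

/-- The divergence does not depend on the coordinates. -/
theorem divE_natural {S S' : Euc m → Euc m →L[ℝ] Euc n} (hS : DifferentiableAt ℝ S z)
    (hS' : ∀ᶠ y in 𝓝 z, ∀ w, S' (a y) (fderiv ℝ a y w) = fderiv ℝ β (f y) (S y w)) :
    divE 𝒢' ℋ' f' S' (a z) = fderiv ℝ β (f z) (divE 𝒢 ℋ f S z) := by
  have hαz : α (a z) = z := hαa.self_of_nhds
  have haDiff : ∀ᶠ y in 𝓝 z, DifferentiableAt ℝ a y :=
    ((ha.of_le (m := 1) (by simp)).eventually (by simp)).mono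
      fun y hy => hy.differentiableAt (by simp)
  have hαDiff : ∀ᶠ y in 𝓝 (a z), DifferentiableAt ℝ α y :=
    ((hα.of_le (m := 1) (by simp)).eventually (by simp)).mono
      fun y hy => hy.differentiableAt (by simp)
  have haC : ContinuousAt a z := ha.continuousAt
  have haz' : ∀ᶠ y in 𝓝 z, ∀ u, fderiv ℝ a y (fderiv ℝ α (a y) u) = u := by
    filter_upwards [haDiff, haC.eventually hαDiff, haC.eventually haα.eventually_nhds, hαa]
      with y h1 h2 h3 h4 u
    have h5 : fderiv ℝ (a ∘ α) (a y) = fderiv ℝ id (a y) := Filter.EventuallyEq.fderiv_eq h3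
    have h1' : DifferentiableAt ℝ a (α (a y)) := by rwa [h4]
    rw [fderiv_comp _ h1' h2, fderiv_id, h4] at h5
    simpa using congrArg (fun L : Euc m →L[ℝ] Euc m => L u) h5
  have hαz' : ∀ u, fderiv ℝ α (a z) (fderiv ℝ a z u) = u := by
    intro u
    have h5 : fderiv ℝ (α ∘ a) z = fderiv ℝ id z := Filter.EventuallyEq.fderiv_eq hαa
    rw [fderiv_comp _ hαDiff.self_of_nhds haDiff.self_of_nhds, fderiv_id] at h5
    simpa using congrArg (fun L : Euc m →L[ℝ] Euc m => L u) h5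
  have ha1 : HasFDerivAt a (fderiv ℝ a z) z := haDiff.self_of_nhds.hasFDerivAt
  have hα2 : HasFDerivAt (fderiv ℝ α) (fderiv ℝ (fderiv ℝ α) (a z)) (a z) :=
    ((hα.fderiv_right (m := ∞) (by simp)).differentiableAt (by simp)).hasFDerivAt
  -- The covariant derivative of `S`, as a bilinear map, so that the invariance of the trace applies
  -- to it.
  let b : Euc m →ₗ[ℝ] Euc m →ₗ[ℝ] Euc n := LinearMap.mk₂ ℝ
    (fun u w => fderiv ℝ β (f z) (fderiv ℝ S z u w + chr ℋ (f z) (fderiv ℝ f z u) (S z w)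
      - S z (chr 𝒢 z u w)))
    (by intro u u' w; simp only [map_add, map_sub, _root_.add_apply]; abel)
    (by intro c u w; simp only [map_smul, _root_.smul_apply, smul_add, smul_sub, map_add, map_sub])
    (by intro u w w'; simp only [map_add, map_sub]; abel)
    (by intro c u w; simp only [map_smul, smul_add, smul_sub, map_add, map_sub])
  have hb : ∀ u w, b u w = fderiv ℝ β (f z) (fderiv ℝ S z u w
      + chr ℋ (f z) (fderiv ℝ f z u) (S z w) - S z (chr 𝒢 z u w)) := fun _ _ => rfl
  have hcov : ∀ u w, covE ℋ f (fun y => S y w) z u =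
      fderiv ℝ S z u w + chr ℋ (f z) (fderiv ℝ f z u) (S z w) := by
    intro u w
    rw [covE, (hS.hasFDerivAt.clm_apply (hasFDerivAt_const w z)).fderiv]
    simp
  have key : ∀ u w, covE ℋ' f' (fun y => S' y w) (a z) u - S' (a z) (chr 𝒢' (a z) u w) =
      b (fderiv ℝ α (a z) u) (fderiv ℝ α (a z) w) := by
    intro u w
    -- The field with constant components `w` in the new coordinates has variable components `Dα(a
    -- y) w` in the old ones. The term with `D²α` that arises is cancelled by the transformation law
    -- `h4` of the Christoffel symbols of the domain.
    have hX : HasFDerivAt (fun y => S y (fderiv ℝ α (a y) w)) _ z :=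
      hS.hasFDerivAt.clm_apply ((hα2.comp z ha1).clm_apply (hasFDerivAt_const w z))
    have hX' : ∀ᶠ y in 𝓝 z, (fun y => S' y w) (a y) =
        fderiv ℝ β (f y) (S y (fderiv ℝ α (a y) w)) := by
      filter_upwards [hS', haz'] with y h1 h2
      rw [← h1, h2]
    have h3 := covE_natural hH hH' ha hα hαa haα hfz hβfz hβ hsurj hpull hf hf'
      (X' := fun y => S' y w) hX.differentiableAt hX' (fderiv ℝ α (a z) u)
    have h4 := chr_transform hG' hG haz (by rwa [hαz]) hα
      (fun u => ⟨fderiv ℝ a z u, hαz' u⟩) hpullG u w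
    rw [haz'.self_of_nhds] at h3
    rw [h3, covE, hX.fderiv, hb]
    have h5 : S' (a z) (chr 𝒢' (a z) u w) =
        fderiv ℝ β (f z) (S z (fderiv ℝ α (a z) (chr 𝒢' (a z) u w))) := by
      rw [← hS'.self_of_nhds, haz'.self_of_nhds]
    rw [h5, ← h4, ← map_sub, hαz]
    congr 1
    simp [haz'.self_of_nhds]
    abel
  rw [divE, divE, clm_formTrace]
  have h6 := (hG.inner z hz).formTrace_comp (fderiv ℝ α (a z)) (fderiv ℝ a z) hαz'
    (B' := 𝒢' (a z)) (by
      intro u w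
      have := hpullG.self_of_nhds u w
      rwa [hαz] at this) b
  simp only [key, hcov]
  rw [h6]
  rfl

end Natural

end

/-! ### The volume density, and the Riemannian divergence as a Euclidean one. -/

section
/-- Jacobi's formula. -/
theorem hasFDerivAt_det {P ι : Type*} [NormedAddCommGroup P] [NormedSpace ℝ P] [Fintype ι]
    [DecidableEq ι] {A : P → Matrix ι ι ℝ} {A' : ι → ι → P →L[ℝ] ℝ} {a : P}
    (hA : ∀ i j, HasFDerivAt (fun x => A x i j) (A' i j) a) :
    HasFDerivAt (fun x => (A x).det) (∑ i, ∑ j, (A a).adjugate i j • A' j i) a := by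
  have h1 : HasFDerivAt (fun x => (A x).det) (∑ σ : Equiv.Perm ι, ((Equiv.Perm.sign σ : ℤ) : ℝ) •
      ∑ i, (∏ j ∈ Finset.univ.erase i, A a (σ j) j) • A' (σ i) i) a := by
    simp only [Matrix.det_apply']
    refine HasFDerivAt.fun_sum fun σ _ => ?_
    exact (HasFDerivAt.finsetProd (u := Finset.univ) (fun i _ => hA (σ i) i)).const_mul
      ((Equiv.Perm.sign σ : ℤ) : ℝ)
  convert h1 using 1
  ext ξ
  simp only [_root_.sum_apply, _root_.smul_apply, smul_eq_mul]
  -- By Cramer's rule a row of the adjugate, paired with the differentiated column, is the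
  -- determinant with that column replaced. Summing over columns is the Leibniz rule for the
  -- permutation expansion.
  have h2 : ∀ i, ∑ j, (A a).adjugate i j * A' j i ξ =
      ((A a).updateCol i (fun j => A' j i ξ)).det := by
    intro i
    rw [← Matrix.cramer_apply, Matrix.cramer_eq_adjugate_mulVec]
    rfl
  simp only [h2, Matrix.det_apply']
  rw [Finset.sum_comm]
  refine Finset.sum_congr rfl fun σ _ => ?_
  rw [Finset.mul_sum]
  refine Finset.sum_congr rfl fun i _ => ?_
  rw [← Finset.mul_prod_erase _ _ (Finset.mem_univ i), Matrix.updateCol_self]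
  rw [Finset.prod_congr rfl fun j hj => Matrix.updateCol_ne (Finset.ne_of_mem_erase hj)]
  ring

theorem sum_comm_four {ι : Type*} [Fintype ι] (F : ι → ι → ι → ι → ℝ) :
    ∑ a, ∑ b, ∑ c, ∑ e, F a b c e = ∑ c, ∑ e, ∑ b, ∑ a, F a b c e := by
  calc ∑ a, ∑ b, ∑ c, ∑ e, F a b c e = ∑ b, ∑ c, ∑ e, ∑ a, F a b c e := by
        rw [Finset.sum_comm]
        refine Finset.sum_congr rfl fun b _ => ?_
        rw [Finset.sum_comm]
        exact Finset.sum_congr rfl fun c _ => Finset.sum_comm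
    _ = _ := by
        rw [Finset.sum_comm]
        exact Finset.sum_congr rfl fun c _ => Finset.sum_comm

/-- The index computation behind `√g div θ = ∂ᵢ(√g gⁱʲ θⱼ)`, with `γ = gⁱʲ`, `δ k a b = ∂ₖ g_{ab}`,
`o = θⱼ`, `e = ∂ᵢ θⱼ` and `s = √g`. Since `γ` is symmetric, the first two Koszul terms contribute
equally and match the derivative of `gⁱʲ` (`hB`); the third matches the derivative of `√g` (`hC`).
-/
theorem contraction_identity {ι : Type*} [Fintype ι] (γ : ι → ι → ℝ) (δ : ι → ι → ι → ℝ)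
    (o : ι → ℝ) (e : ι → ι → ℝ) (s : ℝ) (hγs : ∀ i j, γ i j = γ j i) :
    s * (∑ i, ∑ j, γ i j * e i j -
      ∑ i, ∑ j, γ i j * ∑ k, ∑ l, γ k l * ((1 / 2 : ℝ) * (δ i j l + δ j i l - δ l i j)) * o k) =
    ∑ i, (s * ∑ j, (γ i j * e i j + o j * -∑ a, ∑ b, γ i a * δ i a b * γ b j) +
      (∑ j, γ i j * o j) * (s * ((1 / 2 : ℝ) * ∑ a, ∑ b, γ a b * δ i a b))) := by
  have hA : ∑ i, ∑ j, γ i j *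
      ∑ k, ∑ l, γ k l * ((1 / 2 : ℝ) * (δ i j l + δ j i l - δ l i j)) * o k =
      ∑ i, ∑ j, ∑ k, ∑ l, γ i j * γ k l * δ i j l * o k -
      (1 / 2 : ℝ) * ∑ i, ∑ j, ∑ k, ∑ l, γ i j * γ k l * δ l i j * o k := by
    have h1 : ∑ i, ∑ j, ∑ k, ∑ l, γ i j * γ k l * δ j i l * o k =
        ∑ i, ∑ j, ∑ k, ∑ l, γ i j * γ k l * δ i j l * o k := by
      rw [Finset.sum_comm]
      refine Finset.sum_congr rfl fun i _ => Finset.sum_congr rfl fun j _ => ?_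
      rw [hγs]
    have h2 : ∑ i, ∑ j, γ i j *
        ∑ k, ∑ l, γ k l * ((1 / 2 : ℝ) * (δ i j l + δ j i l - δ l i j)) * o k =
        (1 / 2 : ℝ) * (∑ i, ∑ j, ∑ k, ∑ l, γ i j * γ k l * δ i j l * o k +
          ∑ i, ∑ j, ∑ k, ∑ l, γ i j * γ k l * δ j i l * o k -
          ∑ i, ∑ j, ∑ k, ∑ l, γ i j * γ k l * δ l i j * o k) := by
      simp only [← Finset.sum_add_distrib, ← Finset.sum_sub_distrib, Finset.mul_sum]
      refine Finset.sum_congr rfl fun i _ => Finset.sum_congr rfl fun j _ =>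
        Finset.sum_congr rfl fun k _ => Finset.sum_congr rfl fun l _ => ?_
      ring
    rw [h2, h1]; ring
  have hB : ∑ i, ∑ j, o j * -∑ a, ∑ b, γ i a * δ i a b * γ b j =
      - ∑ i, ∑ j, ∑ k, ∑ l, γ i j * γ k l * δ i j l * o k := by
    simp only [mul_neg, Finset.sum_neg_distrib, Finset.mul_sum]
    congr 1
    refine Finset.sum_congr rfl fun i _ => ?_
    rw [Finset.sum_comm]
    refine Finset.sum_congr rfl fun a _ => Finset.sum_congr rfl fun j _ =>
      Finset.sum_congr rfl fun b _ => ?_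
    rw [hγs b j]; ring
  have hC : ∑ l, (∑ k, γ l k * o k) * ∑ i, ∑ j, γ i j * δ l i j =
      ∑ i, ∑ j, ∑ k, ∑ l, γ i j * γ k l * δ l i j * o k := by
    rw [← sum_comm_four fun l k i j => γ i j * γ k l * δ l i j * o k]
    refine Finset.sum_congr rfl fun l _ => ?_
    rw [Finset.sum_mul]
    refine Finset.sum_congr rfl fun k _ => ?_
    simp only [Finset.mul_sum]
    refine Finset.sum_congr rfl fun i _ => Finset.sum_congr rfl fun j _ => ?_
    rw [hγs l k]; ring
  rw [hA]
  have hE : ∀ i, s * ∑ j, (γ i j * e i j + o j * -∑ a, ∑ b, γ i a * δ i a b * γ b j) +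
      (∑ j, γ i j * o j) * (s * ((1 / 2 : ℝ) * ∑ a, ∑ b, γ a b * δ i a b)) =
      s * ∑ j, γ i j * e i j + s * ∑ j, o j * -∑ a, ∑ b, γ i a * δ i a b * γ b j +
      s * (1 / 2 : ℝ) * ((∑ j, γ i j * o j) * ∑ a, ∑ b, γ a b * δ i a b) := by
    intro i
    rw [Finset.sum_add_distrib]; ring
  rw [Finset.sum_congr rfl fun i _ => hE i]
  rw [Finset.sum_add_distrib, Finset.sum_add_distrib, ← Finset.mul_sum, ← Finset.mul_sum,
    ← Finset.mul_sum, hB, hC]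
  ring

variable {d : ℕ}

/-- The density of the Riemannian measure. -/
def volDens (B : Form d) : ℝ := Real.sqrt (gram fun u w => B u w).det

/-- The divergence of a scalar one-form. -/
def divForm (𝒢 : Euc d → Form d) (θ : Euc d → Euc d →L[ℝ] ℝ) (z : Euc d) : ℝ :=
  formTrace (𝒢 z) fun u w => fderiv ℝ θ z u w - θ z (chr 𝒢 z u w)

theorem hasFDerivAt_gram {𝒢 : Euc d → Form d} {z : Euc d} (h : DifferentiableAt ℝ 𝒢 z)
    (i j : Fin d) :
    HasFDerivAt (fun x => gram (fun u w => 𝒢 x u w) i j)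
      (((fderiv ℝ 𝒢 z).flip (stdVec i)).flip (stdVec j)) z := by
  have := (h.hasFDerivAt.clm_apply (hasFDerivAt_const (stdVec i) z)).clm_apply
    (hasFDerivAt_const (stdVec j) z)
  convert! this using 1
  ext; simp

namespace IsMetricOn

variable {𝒢 : Euc d → Form d} {U : Set (Euc d)} (hG : IsMetricOn 𝒢 U) {z : Euc d} (hz : z ∈ U)
include hG hz

theorem contDiffAt_ginv (i j : Fin d) : ContDiffAt ℝ ∞ (fun x => ginv (𝒢 x) i j) z :=
  PQHarmonic.contDiffAt_ginv (hG.contDiffAt hz) (hG.inner z hz) i j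

theorem volDens_pos : 0 < volDens (𝒢 z) := Real.sqrt_pos.2 (hG.inner z hz).det_pos

theorem contDiffAt_volDens : ContDiffAt ℝ ∞ (fun x => volDens (𝒢 x)) z :=
  (contDiffAt_det fun i j => contDiffAt_gram (hG.contDiffAt hz) i j).sqrt
    (hG.inner z hz).det_pos.ne'

/-- Jacobi's formula for the square root of the determinant: the adjugate is `det · g⁻¹`, and one
factor `√det` cancels against the derivative of the root. -/
theorem fderiv_volDens (v : Euc d) :
    fderiv ℝ (fun x => volDens (𝒢 x)) z v =
      volDens (𝒢 z) * ((1 / 2 : ℝ) *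
        ∑ i, ∑ j, ginv (𝒢 z) i j * fderiv ℝ 𝒢 z v (stdVec i) (stdVec j)) := by
  have h1 := (hasFDerivAt_det fun i j => hasFDerivAt_gram (hG.differentiableAt hz) i j).sqrt
    (hG.inner z hz).det_pos.ne'
  have h2 : fderiv ℝ (fun x => volDens (𝒢 x)) z = _ := h1.fderiv
  rw [h2]
  have hdet := (hG.inner z hz).det_pos
  set Δ := (gram fun u w => 𝒢 z u w).det with hΔ
  have hs : volDens (𝒢 z) = Real.sqrt Δ := rfl
  have hs0 : Real.sqrt Δ ≠ 0 := (Real.sqrt_pos.2 hdet).ne'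
  have hadj : ∀ i j, (gram fun u w => 𝒢 z u w).adjugate i j = Δ * ginv (𝒢 z) i j := by
    intro i j
    rw [ginv, Matrix.inv_def, Matrix.smul_apply, Ring.inverse_eq_inv', smul_eq_mul, ← hΔ,
      mul_inv_cancel_left₀ hdet.ne']
  rw [hs]
  simp only [hadj, _root_.smul_apply, _root_.sum_apply, smul_eq_mul,
    ContinuousLinearMap.flip_apply, mul_assoc, ← Finset.mul_sum]
  have hsw : ∀ i j, fderiv ℝ 𝒢 z v (stdVec j) (stdVec i) = fderiv ℝ 𝒢 z v (stdVec i) (stdVec j) :=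
    fun i j => hG.fderiv_symm hz _ _ _
  simp only [hsw]
  nth_rewrite 2 [← Real.mul_self_sqrt hdet.le]
  field_simp

/-- Differentiate `g⁻¹ g = 1`, which holds on an open set, and multiply by `g⁻¹` on the right. -/
theorem fderiv_ginv (v : Euc d) (i j : Fin d) :
    fderiv ℝ (fun x => ginv (𝒢 x) i j) z v =
      - ∑ a, ∑ b, ginv (𝒢 z) i a * fderiv ℝ 𝒢 z v (stdVec a) (stdVec b) * ginv (𝒢 z) b j := by
  have hγ : ∀ i j, HasFDerivAt (fun x => ginv (𝒢 x) i j)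
      (fderiv ℝ (fun x => ginv (𝒢 x) i j) z) z := fun i j =>
    ((hG.contDiffAt_ginv hz i j).differentiableAt (by simp)).hasFDerivAt
  have hg := fun i j => hasFDerivAt_gram (hG.differentiableAt hz) (𝒢 := 𝒢) i j
  have h1 : ∀ i k, ∑ a, (ginv (𝒢 z) i a * fderiv ℝ 𝒢 z v (stdVec a) (stdVec k) +
      𝒢 z (stdVec a) (stdVec k) * fderiv ℝ (fun x => ginv (𝒢 x) i a) z v) = 0 := by
    intro i k
    have h2 : HasFDerivAt (fun x => ∑ a, ginv (𝒢 x) i a * gram (fun u w => 𝒢 x u w) a k) _ z :=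
      HasFDerivAt.fun_sum fun a _ => (hγ i a).mul (hg a k)
    have h3 : (fun x => ∑ a, ginv (𝒢 x) i a * gram (fun u w => 𝒢 x u w) a k) =ᶠ[𝓝 z]
        fun _ => if i = k then 1 else 0 := by
      filter_upwards [hG.isOpen.mem_nhds hz] with y hy using (hG.inner y hy).ginv_mul_gram i k
    have h4 := h3.fderiv_eq (𝕜 := ℝ)
    rw [h2.fderiv, fderiv_fun_const] at h4
    have h5 := congrArg (fun L : Euc d →L[ℝ] ℝ => L v) h4
    simpa [gram_apply] using h5
  have h6 : fderiv ℝ (fun x => ginv (𝒢 x) i j) z v =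
      ∑ k, (∑ a, 𝒢 z (stdVec a) (stdVec k) * fderiv ℝ (fun x => ginv (𝒢 x) i a) z v) *
        ginv (𝒢 z) k j := by
    simp only [Finset.sum_mul]
    rw [Finset.sum_comm]
    have : ∀ a, ∑ k, 𝒢 z (stdVec a) (stdVec k) * fderiv ℝ (fun x => ginv (𝒢 x) i a) z v *
        ginv (𝒢 z) k j = fderiv ℝ (fun x => ginv (𝒢 x) i a) z v * if a = j then 1 else 0 := by
      intro a
      rw [← (hG.inner z hz).gram_mul_ginv a j, Finset.mul_sum]
      exact Finset.sum_congr rfl fun k _ => by ring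
    simp [this]
  rw [h6, Finset.sum_comm, ← Finset.sum_neg_distrib]
  refine Finset.sum_congr rfl fun k _ => ?_
  have h7 := h1 i k
  rw [Finset.sum_add_distrib] at h7
  rw [eq_neg_of_add_eq_zero_right h7, neg_mul, Finset.sum_mul]

/-- The divergence of a one-form as a divergence with respect to Lebesgue measure. -/
theorem volDens_mul_divForm {θ : Euc d → Euc d →L[ℝ] ℝ} (hθ : DifferentiableAt ℝ θ z) :
    volDens (𝒢 z) * divForm 𝒢 θ z =
      ∑ i, fderiv ℝ (fun y => volDens (𝒢 y) * ∑ j, ginv (𝒢 y) i j * θ y (stdVec j)) z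
        (stdVec i) := by
  have hI := hG.inner z hz
  have hv : HasFDerivAt (fun x => volDens (𝒢 x)) (fderiv ℝ (fun x => volDens (𝒢 x)) z) z :=
    ((hG.contDiffAt_volDens hz).differentiableAt (by simp)).hasFDerivAt
  have hγ : ∀ i j, HasFDerivAt (fun x => ginv (𝒢 x) i j)
      (fderiv ℝ (fun x => ginv (𝒢 x) i j) z) z := fun i j =>
    ((hG.contDiffAt_ginv hz i j).differentiableAt (by simp)).hasFDerivAt
  have hθ' : ∀ j, HasFDerivAt (fun y => θ y (stdVec j)) _ z := fun j =>
    hθ.hasFDerivAt.clm_apply (hasFDerivAt_const (stdVec j) z)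
  have hR : ∀ i, fderiv ℝ (fun y => volDens (𝒢 y) * ∑ j, ginv (𝒢 y) i j * θ y (stdVec j)) z
      (stdVec i) = volDens (𝒢 z) * ∑ j, (ginv (𝒢 z) i j * fderiv ℝ θ z (stdVec i) (stdVec j) +
        θ z (stdVec j) * fderiv ℝ (fun x => ginv (𝒢 x) i j) z (stdVec i)) +
        (∑ j, ginv (𝒢 z) i j * θ z (stdVec j)) *
          fderiv ℝ (fun x => volDens (𝒢 x)) z (stdVec i) := by
    intro i
    have h1 : HasFDerivAt (fun y => volDens (𝒢 y) * ∑ j, ginv (𝒢 y) i j * θ y (stdVec j)) _ z :=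
      hv.mul (HasFDerivAt.fun_sum (u := Finset.univ) fun j _ => (hγ i j).mul (hθ' j))
    rw [h1.fderiv]
    simp
  simp only [hR, hG.fderiv_volDens hz, hG.fderiv_ginv hz]
  generalize volDens (𝒢 z) = s
  rw [divForm, formTrace_sub]
  simp only [formTrace, smul_eq_mul, chr_apply, sharp_apply, koszul_apply, map_sum, map_smul]
  exact contraction_identity (fun i j => ginv (𝒢 z) i j)
    (fun k a b => fderiv ℝ 𝒢 z (stdVec k) (stdVec a) (stdVec b)) (fun j => θ z (stdVec j))
    (fun i j => fderiv ℝ θ z (stdVec i) (stdVec j)) s hI.ginv_symm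

end IsMetricOn

end

/-! ### Regularity of powers of a quadratic weight at its zeros. -/

section
section Weights

variable {P : Type*} [NormedAddCommGroup P] [NormedSpace ℝ P]
  {F : Type*} [NormedAddCommGroup F] [NormedSpace ℝ F]

omit [NormedSpace ℝ P] [NormedSpace ℝ F] in
theorem exists_eventually_norm_le {g : P → F} {a : P} (hg : ContinuousAt g a) :
    ∃ C, 0 < C ∧ ∀ᶠ x in 𝓝 a, ‖g x‖ ≤ C :=
  ⟨‖g a‖ + 1, by positivity,
    (hg.norm.eventually (gt_mem_nhds (lt_add_one _))).mono fun _ h => le_of_lt h⟩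

theorem ContDiffAt.continuousAt_fderiv {g : P → F} {a : P} (hg : ContDiffAt ℝ 1 g a) :
    ContinuousAt (fderiv ℝ g) a :=
  (hg.fderiv_right (m := 0) (by simp)).continuousAt

theorem ContDiffAt.eventually_one {g : P → F} {a : P} (hg : ContDiffAt ℝ 1 g a) :
    ∀ᶠ x in 𝓝 a, ContDiffAt ℝ 1 g x := hg.eventually (by simp)

theorem hasFDerivAt_rpow_smul_of_ne {Q : P → ℝ} {b : P → F} {a : P} (s : ℝ)
    (hQ : DifferentiableAt ℝ Q a) (hb : DifferentiableAt ℝ b a) (h : Q a ≠ 0 ∨ s = 0) :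
    HasFDerivAt (fun x => Q x ^ s • b x)
      (Q a ^ s • fderiv ℝ b a + (s * Q a ^ (s - 1)) • (fderiv ℝ Q a).smulRight (b a)) a := by
  rcases h with h | rfl
  · have h1 := (hQ.hasFDerivAt.rpow_const (p := s) (Or.inl h)).smul hb.hasFDerivAt
    convert! h1 using 1
    ext; simp [mul_smul]
  · simpa using hb.hasFDerivAt

/-- The weighted field `Q^s • b` is of class `C¹` also at the zeros of `Q`, where `b` vanishes to
order `κ` in terms of `√Q`. -/
theorem contDiffAt_rpow_smul {Q : P → ℝ} {b : P → F} {a₀ : P} {s κ C K : ℝ}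
    (hQ : ContDiffAt ℝ 1 Q a₀) (hb : ContDiffAt ℝ 1 b a₀)
    (h : 0 < Q a₀ ∨ s = 0 ∨ (1 < 2 * s + κ ∧
      (∀ᶠ a in 𝓝 a₀, 0 ≤ Q a ∧ ‖fderiv ℝ Q a‖ ≤ C * √(Q a) ∧ ‖b a‖ ≤ C * √(Q a) ^ κ ∧
        ‖fderiv ℝ b a‖ ≤ C * √(Q a) ^ (κ - 1)) ∧
      ∀ᶠ a in 𝓝 a₀, Q a = 0 → ∀ᶠ x in 𝓝 a, √(Q x) ≤ K * ‖x - a‖)) :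
    ContDiffAt ℝ 1 (fun x => Q x ^ s • b x) a₀ ∧
    ∀ᶠ a in 𝓝 a₀, HasFDerivAt (fun x => Q x ^ s • b x)
      (Q a ^ s • fderiv ℝ b a + (s * Q a ^ (s - 1)) • (fderiv ℝ Q a).smulRight (b a)) a := by
  have hQd := (ContDiffAt.eventually_one hQ)
  have hbd := (ContDiffAt.eventually_one hb)
  have hcont : ∀ a, ContDiffAt ℝ 1 Q a → ContDiffAt ℝ 1 b a → Q a ≠ 0 ∨ s = 0 →
      ContinuousAt (fun a => Q a ^ s • fderiv ℝ b a +
        (s * Q a ^ (s - 1)) • (fderiv ℝ Q a).smulRight (b a)) a := by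
    intro a h1 h2 h3
    have c1 := ContDiffAt.continuousAt_fderiv h1
    have c2 := ContDiffAt.continuousAt_fderiv h2
    rcases h3 with h3 | rfl
    · have e1 : ∀ r : ℝ, ContinuousAt (fun a => Q a ^ r) a := fun r =>
        h1.continuousAt.rpow_const (Or.inl h3)
      refine ((e1 s).smul c2).add ((continuousAt_const.mul (e1 _)).smul ?_)
      exact ((ContinuousLinearMap.smulRightL ℝ P F).continuous.continuousAt.comp c1).clm_apply
        h2.continuousAt
    · simpa using c2
  have main : ∀ᶠ a in 𝓝 a₀, ContinuousAt (fun a => Q a ^ s • fderiv ℝ b a +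
        (s * Q a ^ (s - 1)) • (fderiv ℝ Q a).smulRight (b a)) a ∧
      HasFDerivAt (fun x => Q x ^ s • b x)
      (Q a ^ s • fderiv ℝ b a + (s * Q a ^ (s - 1)) • (fderiv ℝ Q a).smulRight (b a)) a := by
    have easy : ∀ a, ContDiffAt ℝ 1 Q a → ContDiffAt ℝ 1 b a → Q a ≠ 0 ∨ s = 0 →
        ContinuousAt (fun a => Q a ^ s • fderiv ℝ b a +
        (s * Q a ^ (s - 1)) • (fderiv ℝ Q a).smulRight (b a)) a ∧
      HasFDerivAt (fun x => Q x ^ s • b x)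
      (Q a ^ s • fderiv ℝ b a + (s * Q a ^ (s - 1)) • (fderiv ℝ Q a).smulRight (b a)) a :=
      fun a h1 h2 h3 => ⟨hcont a h1 h2 h3, hasFDerivAt_rpow_smul_of_ne s
        (h1.differentiableAt (by simp)) (h2.differentiableAt (by simp)) h3⟩
    rcases h with h | h | ⟨hκ, hbd2, hlip⟩
    · filter_upwards [hQd, hbd, hQ.continuousAt.eventually (lt_mem_nhds h)] with a h1 h2 h3
      exact easy a h1 h2 (Or.inl h3.ne')
    · filter_upwards [hQd, hbd] with a h1 h2
      exact easy a h1 h2 (Or.inr h)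
    -- The exponent may be negative below. For `s ≠ 0` the convention `0 ^ s = 0` makes the weighted
    -- field vanish at the zeros of `Q`, whatever the sign of `s`.
    by_cases hs : s = 0
    · filter_upwards [hQd, hbd] with a h1 h2
      exact easy a h1 h2 (Or.inr hs)
    filter_upwards [hQd, hbd, hbd2.eventually_nhds, hlip] with a h1 h2 h3 h4
    by_cases hQa : Q a = 0
    swap
    · exact easy a h1 h2 (Or.inl hQa)
    -- In powers of `√Q` the field is of order `θ + 1` and its formal derivative of order `θ`,
    -- because both `DQ` and the passage from `b` to `Db` account for one order. The hypothesis says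
    -- that `θ > 0`.
    set θ := 2 * s + κ - 1 with hθ
    have hθ0 : 0 < θ := by rw [hθ]; linarith
    have hpow : ∀ x, 0 < Q x → ∀ r : ℝ, Q x ^ r = √(Q x) ^ (2 * r) := by
      intro x hx r
      rw [Real.sqrt_eq_rpow, ← Real.rpow_mul hx.le]; congr 1; ring
    have bd1 : ∀ᶠ x in 𝓝 a, ‖Q x ^ s • b x‖ ≤ C * (√(Q x) ^ θ * √(Q x)) := by
      filter_upwards [h3] with x hx
      rcases hx.1.eq_or_lt with h0 | h0
      · rw [← h0]; simp [Real.zero_rpow hs]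
      · have hN : 0 < √(Q x) := Real.sqrt_pos.2 h0
        rw [norm_smul, Real.norm_of_nonneg (Real.rpow_nonneg hx.1 _)]
        refine (mul_le_mul_of_nonneg_left hx.2.2.1 (Real.rpow_nonneg hx.1 _)).trans_eq ?_
        rw [hpow x h0, ← Real.rpow_add_one hN.ne', ← mul_assoc, mul_comm _ C, mul_assoc,
          ← Real.rpow_add hN]
        congr 2; rw [hθ]; ring
    have bd2 : ∀ᶠ x in 𝓝 a, ‖Q x ^ s • fderiv ℝ b x +
        (s * Q x ^ (s - 1)) • (fderiv ℝ Q x).smulRight (b x)‖ ≤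
        (C + |s| * (C * C)) * √(Q x) ^ θ := by
      filter_upwards [h3] with x hx
      rcases hx.1.eq_or_lt with h0 | h0
      · have hz : fderiv ℝ Q x = 0 := by
          have := hx.2.1
          rw [← h0] at this
          simpa using this
        rw [hz, ← h0]; simp [Real.zero_rpow hs, Real.zero_rpow hθ0.ne']
      · have hN : 0 < √(Q x) := Real.sqrt_pos.2 h0
        refine (norm_add_le _ _).trans ?_
        rw [add_mul]
        refine add_le_add ?_ ?_
        · rw [norm_smul, Real.norm_of_nonneg (Real.rpow_nonneg hx.1 _)]
          refine (mul_le_mul_of_nonneg_left hx.2.2.2 (Real.rpow_nonneg hx.1 _)).trans_eq ?_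
          rw [hpow x h0, ← mul_assoc, mul_comm _ C, mul_assoc, ← Real.rpow_add hN]
          congr 2; rw [hθ]; ring
        · rw [norm_smul, norm_mul, Real.norm_of_nonneg (Real.rpow_nonneg hx.1 _),
            Real.norm_eq_abs, ContinuousLinearMap.norm_smulRight_apply]
          have : ‖fderiv ℝ Q x‖ * ‖b x‖ ≤ (C * √(Q x)) * (C * √(Q x) ^ κ) :=
            mul_le_mul hx.2.1 hx.2.2.1 (norm_nonneg _) ((norm_nonneg _).trans hx.2.1)
          refine (mul_le_mul_of_nonneg_left this (mul_nonneg (abs_nonneg _)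
            (Real.rpow_nonneg hx.1 _))).trans_eq ?_
          have e1 : √(Q x) ^ θ = √(Q x) ^ (2 * (s - 1)) * (√(Q x) * √(Q x) ^ κ) := by
            rw [mul_comm (√(Q x)), ← Real.rpow_add_one hN.ne', ← Real.rpow_add hN]
            congr 1; rw [hθ]; ring
          rw [hpow x h0, e1]; ring
    have hz : fderiv ℝ Q a = 0 := by
      have := h3.self_of_nhds.2.1
      rw [hQa] at this
      simpa using this
    have hval : Q a ^ s • fderiv ℝ b a + (s * Q a ^ (s - 1)) • (fderiv ℝ Q a).smulRight (b a)
        = 0 := by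
      rw [hz, hQa]; simp [Real.zero_rpow hs]
    have hNt : Filter.Tendsto (fun x => √(Q x) ^ θ) (𝓝 a) (𝓝 0) := by
      have := (h1.continuousAt.sqrt).rpow_const (p := θ) (Or.inr hθ0.le)
      have h5 := this.tendsto
      simpa [hQa, Real.zero_rpow hθ0.ne'] using h5
    refine ⟨?_, ?_⟩
    · rw [ContinuousAt, hval]
      refine squeeze_zero_norm' bd2 ?_
      simpa using hNt.const_mul (C + |s| * (C * C))
    · rw [hval]
      refine HasFDerivAt.of_isLittleO ?_
      have hfa : Q a ^ s • b a = 0 := by rw [hQa]; simp [Real.zero_rpow hs]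
      simp only [hfa, _root_.zero_apply, sub_zero]
      -- Near a zero `a` of `Q` one factor `√Q` is at most a multiple of `‖x - a‖`, and the
      -- remaining `√Q ^ θ` tends to zero. So the derivative at `a` exists and is zero.
      have hO : (fun x => Q x ^ s • b x) =O[𝓝 a] fun x => √(Q x) ^ θ * ‖x - a‖ := by
        refine Asymptotics.IsBigO.of_bound (|C| * |K|) ?_
        filter_upwards [bd1, h4 hQa] with x hx1 hx2
        have hθx := Real.rpow_nonneg (Real.sqrt_nonneg (Q x)) θ
        rw [norm_mul, norm_norm, Real.norm_of_nonneg hθx]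
        calc ‖Q x ^ s • b x‖ ≤ C * (√(Q x) ^ θ * √(Q x)) := hx1
          _ ≤ |C| * (√(Q x) ^ θ * √(Q x)) :=
            mul_le_mul_of_nonneg_right (le_abs_self C) (mul_nonneg hθx (Real.sqrt_nonneg _))
          _ ≤ |C| * (√(Q x) ^ θ * (|K| * ‖x - a‖)) := by
            gcongr
            exact hx2.trans (mul_le_mul_of_nonneg_right (le_abs_self K) (norm_nonneg _))
          _ = _ := by ring
      refine hO.trans_isLittleO ?_
      have h6 : (fun x => √(Q x) ^ θ * ‖x - a‖) =o[𝓝 a] fun x => (1 : ℝ) * ‖x - a‖ :=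
        ((Asymptotics.isLittleO_one_iff ℝ).2 hNt).mul_isBigO (Asymptotics.isBigO_refl _ _)
      simpa using h6
  refine ⟨contDiffAt_one_iff.2 ⟨_, _, main, fun a ha => ha.1.continuousWithinAt,
    fun a ha => ha.2⟩, main.mono fun a ha => ha.2⟩

end Weights

section QuadraticWeight

variable {P : Type*} [NormedAddCommGroup P] [NormedSpace ℝ P]
  {V : Type*} [NormedAddCommGroup V] [NormedSpace ℝ V]
  {F : Type*} [NormedAddCommGroup F] [NormedSpace ℝ F]

omit [NormedSpace ℝ P] in
/-- A continuous family of bilinear forms that is positive definite at `a₀` is bounded below near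
`a₀`. -/
theorem exists_eventually_le_form [FiniteDimensional ℝ V] {𝓑 : P → V →L[ℝ] V →L[ℝ] ℝ} {a₀ : P}
    (h𝓑 : ContinuousAt 𝓑 a₀) (hpos : ∀ A, A ≠ 0 → 0 < 𝓑 a₀ A A) :
    ∃ c, 0 < c ∧ ∀ᶠ a in 𝓝 a₀, ∀ A, c * ‖A‖ ^ 2 ≤ 𝓑 a A A := by
  obtain ⟨c, hc, hc'⟩ : ∃ c, 0 < c ∧ ∀ A, c * ‖A‖ ^ 2 ≤ 𝓑 a₀ A A := by
    have hq : Continuous fun A => 𝓑 a₀ A A :=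
      ((𝓑 a₀).continuous).clm_apply continuous_id
    rcases (Metric.sphere (0 : V) 1).eq_empty_or_nonempty with he | hne
    · refine ⟨1, one_pos, fun A => ?_⟩
      have : A = 0 := by
        by_contra hA
        have : ‖A‖⁻¹ • A ∈ Metric.sphere (0 : V) 1 := by simp [norm_smul, hA]
        simp [he] at this
      simp [this]
    · obtain ⟨A₀, hA₀, hmin⟩ := (isCompact_sphere (0 : V) 1).exists_isMinOn hne hq.continuousOn
      have hA₀' : A₀ ≠ 0 := by
        rintro rfl; simp at hA₀
      refine ⟨𝓑 a₀ A₀ A₀, hpos _ hA₀', fun A => ?_⟩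
      by_cases hA : A = 0
      · simp [hA]
      have hn : ‖A‖ ≠ 0 := norm_ne_zero_iff.2 hA
      have : ‖A‖⁻¹ • A ∈ Metric.sphere (0 : V) 1 := by simp [norm_smul, hA]
      have h1 := hmin this
      simp only [mem_ofPred_eq, map_smul, _root_.smul_apply, smul_eq_mul] at h1
      calc 𝓑 a₀ A₀ A₀ * ‖A‖ ^ 2 ≤ (‖A‖⁻¹ * (‖A‖⁻¹ * 𝓑 a₀ A A)) * ‖A‖ ^ 2 :=
            mul_le_mul_of_nonneg_right h1 (by positivity)
        _ = 𝓑 a₀ A A := by field_simp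
  -- Half of the lower bound at `a₀` is given up to absorb the variation of `𝓑` near `a₀`.
  refine ⟨c / 2, half_pos hc, ?_⟩
  have h1 : ∀ᶠ a in 𝓝 a₀, ‖𝓑 a - 𝓑 a₀‖ < c / 2 := by
    have : Filter.Tendsto (fun x => ‖𝓑 x - 𝓑 a₀‖) (𝓝 a₀) (𝓝 ‖𝓑 a₀ - 𝓑 a₀‖) :=
      (h𝓑.sub_const (𝓑 a₀)).norm
    simp only [sub_self, norm_zero] at this
    exact this.eventually (gt_mem_nhds (half_pos hc))
  filter_upwards [h1] with a ha A
  have h2 : |𝓑 a A A - 𝓑 a₀ A A| ≤ c / 2 * ‖A‖ ^ 2 := by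
    have := (𝓑 a - 𝓑 a₀).le_opNorm₂ A A
    simp only [_root_.sub_apply, Real.norm_eq_abs] at this
    refine this.trans ?_
    rw [pow_two, ← mul_assoc]
    gcongr
  have h3 := hc' A
  have h4 := (abs_le.1 h2).1
  linarith

/-- The data of the weight `Q = 𝓑(A, A)` near `a₀`. -/
structure IsWeight (𝓑 : P → V →L[ℝ] V →L[ℝ] ℝ) (A : P → V) (a₀ : P) : Prop where
  smooth_form : ContDiffAt ℝ ∞ 𝓑 a₀
  smooth : ContDiffAt ℝ ∞ A a₀
  symm : ∀ᶠ a in 𝓝 a₀, ∀ u w, 𝓑 a u w = 𝓑 a w u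
  pos : ∀ u, u ≠ 0 → 0 < 𝓑 a₀ u u

namespace IsWeight

variable [FiniteDimensional ℝ V] {𝓑 : P → V →L[ℝ] V →L[ℝ] ℝ} {A : P → V} {a₀ : P}
  (hw : IsWeight 𝓑 A a₀)
include hw

omit [FiniteDimensional ℝ V] in
theorem contDiffAt : ContDiffAt ℝ ∞ (fun a => 𝓑 a (A a) (A a)) a₀ :=
  (hw.smooth_form.clm_apply hw.smooth).clm_apply hw.smooth

-- In each term of the derivative of `𝓑(A, A)` at least one factor `A` is left undifferentiated.
omit [FiniteDimensional ℝ V] in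
theorem exists_fderiv_le : ∃ D : ℝ, 0 < D ∧
    ∀ᶠ a in 𝓝 a₀, ‖fderiv ℝ (fun a => 𝓑 a (A a) (A a)) a‖ ≤ D * ‖A a‖ := by
  have hA1 : ContDiffAt ℝ 1 A a₀ := hw.smooth.of_le (by simp)
  have h𝓑1 : ContDiffAt ℝ 1 𝓑 a₀ := hw.smooth_form.of_le (by simp)
  obtain ⟨C₁, hC₁, hb₁⟩ := exists_eventually_norm_le h𝓑1.continuousAt
  obtain ⟨C₂, hC₂, hb₂⟩ := exists_eventually_norm_le (ContDiffAt.continuousAt_fderiv h𝓑1)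
  obtain ⟨C₃, hC₃, hb₃⟩ := exists_eventually_norm_le (ContDiffAt.continuousAt_fderiv hA1)
  obtain ⟨C₄, hC₄, hb₄⟩ := exists_eventually_norm_le hA1.continuousAt
  set D := C₂ * C₄ + 2 * (C₁ * C₃) with hD
  refine ⟨D, by positivity, ?_⟩
  filter_upwards [hb₁, hb₂, hb₃, hb₄, ContDiffAt.eventually_one hA1,
    ContDiffAt.eventually_one h𝓑1] with a h1 h2 h3 h4 h5 h6
  have hA' := (h5.differentiableAt (by simp)).hasFDerivAt
  have h𝓑' := (h6.differentiableAt (by simp)).hasFDerivAt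
  rw [((h𝓑'.clm_apply hA').clm_apply hA').fderiv]
  refine ContinuousLinearMap.opNorm_le_bound _ (by positivity) fun ξ => ?_
  simp only [_root_.add_apply, ContinuousLinearMap.comp_apply, ContinuousLinearMap.flip_apply]
  have e1 : ‖fderiv ℝ 𝓑 a ξ (A a) (A a)‖ ≤ C₂ * ‖ξ‖ * ‖A a‖ * C₄ := by
    refine ((fderiv ℝ 𝓑 a ξ).le_opNorm₂ _ _).trans ?_
    gcongr
    exact (fderiv ℝ 𝓑 a).le_of_opNorm_le h2 ξ
  have e2 : ‖𝓑 a (A a) (fderiv ℝ A a ξ)‖ ≤ C₁ * ‖A a‖ * (C₃ * ‖ξ‖) := by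
    refine ((𝓑 a).le_opNorm₂ _ _).trans ?_
    gcongr
    exact (fderiv ℝ A a).le_of_opNorm_le h3 ξ
  have e3 : ‖𝓑 a (fderiv ℝ A a ξ) (A a)‖ ≤ C₁ * (C₃ * ‖ξ‖) * ‖A a‖ := by
    refine ((𝓑 a).le_opNorm₂ _ _).trans ?_
    gcongr
    exact (fderiv ℝ A a).le_of_opNorm_le h3 ξ
  refine (norm_add_le _ _).trans ?_
  refine (add_le_add e2 ((norm_add_le _ _).trans (add_le_add e3 e1))).trans_eq ?_
  rw [hD]; ring

/-- The bounds on the weight that control its powers. -/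
theorem bounds : ∃ C K : ℝ, 0 < C ∧
    (∀ᶠ a in 𝓝 a₀, 0 ≤ 𝓑 a (A a) (A a) ∧
      ‖fderiv ℝ (fun a => 𝓑 a (A a) (A a)) a‖ ≤ C * √(𝓑 a (A a) (A a)) ∧
      ‖A a‖ ≤ C * √(𝓑 a (A a) (A a)) ∧ ‖fderiv ℝ A a‖ ≤ C) ∧
    ∀ᶠ a in 𝓝 a₀, 𝓑 a (A a) (A a) = 0 →
      ∀ᶠ x in 𝓝 a, √(𝓑 x (A x) (A x)) ≤ K * ‖x - a‖ := by
  obtain ⟨c, hc, hlow⟩ := exists_eventually_le_form hw.smooth_form.continuousAt hw.pos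
  have hA1 : ContDiffAt ℝ 1 A a₀ := hw.smooth.of_le (by simp)
  have h𝓑1 : ContDiffAt ℝ 1 𝓑 a₀ := hw.smooth_form.of_le (by simp)
  obtain ⟨C₁, hC₁, hb₁⟩ := exists_eventually_norm_le h𝓑1.continuousAt
  obtain ⟨C₃, hC₃, hb₃⟩ := exists_eventually_norm_le (ContDiffAt.continuousAt_fderiv hA1)
  have hsc : 0 < √c := Real.sqrt_pos.2 hc
  have hAle : ∀ᶠ a in 𝓝 a₀, ‖A a‖ ≤ (√c)⁻¹ * √(𝓑 a (A a) (A a)) := by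
    filter_upwards [hlow] with a ha
    have h1 := Real.sqrt_le_sqrt (ha (A a))
    rw [Real.sqrt_mul hc.le, Real.sqrt_sq (norm_nonneg _)] at h1
    rwa [inv_mul_eq_div, le_div_iff₀' hsc]
  obtain ⟨D, hD0, hdQ⟩ := hw.exists_fderiv_le
  -- A zero of the weight is a zero of `A`, so a Lipschitz bound for `A` yields the linear bound for
  -- `√Q` around it.
  obtain ⟨L, t, ht, hL⟩ := hA1.exists_lipschitzOnWith
  refine ⟨max (D * (√c)⁻¹) (max (√c)⁻¹ C₃), √C₁ * L, by positivity, ?_, ?_⟩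
  · filter_upwards [hlow, hdQ, hAle, hb₃] with a h1 h2 h3 h4
    have hs := Real.sqrt_nonneg (𝓑 a (A a) (A a))
    refine ⟨le_trans (by positivity) (h1 _), ?_, ?_, h4.trans ?_⟩
    · calc _ ≤ D * ((√c)⁻¹ * √(𝓑 a (A a) (A a))) := h2.trans (by gcongr)
        _ = (D * (√c)⁻¹) * √(𝓑 a (A a) (A a)) := by ring
        _ ≤ _ := by gcongr; exact le_max_left _ _
    · exact h3.trans (by gcongr; exact (le_max_left _ _).trans (le_max_right _ _))
    · exact (le_max_right _ _).trans (le_max_right _ _)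
  · filter_upwards [hAle, eventually_eventually_nhds.2 hb₁,
      eventually_mem_nhds_iff.2 ht] with a h1 h2 h3 h4
    have hAa : A a = 0 := by
      rw [h4] at h1
      simpa using h1
    filter_upwards [h2, h3] with x h5 h6
    have h7 := hL.dist_le_mul x h6 a (mem_of_mem_nhds h3)
    rw [dist_eq_norm, dist_eq_norm, hAa, sub_zero] at h7
    have h8 : 𝓑 x (A x) (A x) ≤ C₁ * ‖A x‖ ^ 2 := by
      have := (le_abs_self _).trans ((𝓑 x).le_opNorm₂ (A x) (A x))
      refine this.trans ?_
      rw [pow_two, ← mul_assoc]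
      gcongr
    calc √(𝓑 x (A x) (A x)) ≤ √(C₁ * ‖A x‖ ^ 2) := Real.sqrt_le_sqrt h8
      _ = √C₁ * ‖A x‖ := by rw [Real.sqrt_mul hC₁.le, Real.sqrt_sq (norm_nonneg _)]
      _ ≤ √C₁ * (L * ‖x - a‖) := by gcongr
      _ = _ := by ring

/-- `Q^s A` is of class `C¹` for `s ≥ 0`. -/
theorem contDiffAt_one_smul {s : ℝ} (hs : 0 ≤ s) :
    ContDiffAt ℝ 1 (fun a => 𝓑 a (A a) (A a) ^ s • A a) a₀ ∧
    ∀ᶠ a in 𝓝 a₀, HasFDerivAt (fun a => 𝓑 a (A a) (A a) ^ s • A a)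
      (𝓑 a (A a) (A a) ^ s • fderiv ℝ A a + (s * 𝓑 a (A a) (A a) ^ (s - 1)) •
        (fderiv ℝ (fun a => 𝓑 a (A a) (A a)) a).smulRight (A a)) a := by
  obtain ⟨C, K, hC, h1, h2⟩ := hw.bounds
  -- The field `A` itself vanishes to order one, and `1 < 2 s + 1` holds for every `s > 0`: no gap
  -- in the exponents occurs at this level.
  refine contDiffAt_rpow_smul (κ := 1) (C := C) (K := K) (hw.contDiffAt.of_le (by simp))
    (hw.smooth.of_le (by simp)) ?_
  rcases hs.eq_or_lt with h | h
  · exact Or.inr (Or.inl h.symm)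
  · refine Or.inr (Or.inr ⟨by linarith, ?_, h2⟩)
    filter_upwards [h1] with a ha
    simpa using ha

/-- `Q^s` is of class `C¹` for `s > 1/2`. -/
theorem contDiffAt_rpow {s : ℝ} (h : 0 < 𝓑 a₀ (A a₀) (A a₀) ∨ s = 0 ∨ 1 < 2 * s) :
    ContDiffAt ℝ 1 (fun a => 𝓑 a (A a) (A a) ^ s) a₀ := by
  obtain ⟨C, K, hC, h1, h2⟩ := hw.bounds
  -- A constant has order `κ = 0`, so the criterion becomes `1 < 2 s`, the origin of the condition
  -- `p > 3`.
  have := (contDiffAt_rpow_smul (b := fun _ => (1 : ℝ)) (s := s) (κ := 0) (C := max C 1) (K := K)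
    (hw.contDiffAt.of_le (by simp)) contDiffAt_const (by
      refine h.imp_right (Or.imp_right fun h => ⟨by linarith, ?_, h2⟩)
      filter_upwards [h1] with a ha
      refine ⟨ha.1, ha.2.1.trans ?_, by simp, ?_⟩
      · gcongr; exact le_max_left _ _
      · simp only [fderiv_fun_const, Pi.zero_apply, norm_zero]
        positivity)).1
  simpa using this

/-- `Q^{s-1} b` is of class `C¹` for `s > 1/2` if `b` is quadratic in `A`. -/
theorem contDiffAt_rpow_sub_one_smul {s : ℝ} {b : P → F} (hb : ContDiffAt ℝ 1 b a₀) {C' : ℝ}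
    (hb' : ∀ᶠ a in 𝓝 a₀, ‖b a‖ ≤ C' * ‖A a‖ ^ 2 ∧ ‖fderiv ℝ b a‖ ≤ C' * ‖A a‖)
    (h : 0 < 𝓑 a₀ (A a₀) (A a₀) ∨ s = 0 ∨ 1 < 2 * s) :
    ContDiffAt ℝ 1 (fun a => (s * 𝓑 a (A a) (A a) ^ (s - 1)) • b a) a₀ := by
  by_cases hs : s = 0
  · simpa [hs] using contDiffAt_const
  obtain ⟨C, K, hC, h1, h2⟩ := hw.bounds
  -- The quadratic vanishing of `b` makes up for the exponent `s - 1`: the criterion `1 < 2 (s - 1)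
  -- + 2` is again `1 < 2 s`.
  have := (contDiffAt_rpow_smul (b := b) (s := s - 1) (κ := 2)
    (C := max C (max (|C'| * C ^ 2) (|C'| * C))) (K := K)
    (hw.contDiffAt.of_le (by simp)) hb (by
      refine h.imp_right fun h => Or.inr ⟨by linarith [h.resolve_left hs], ?_, h2⟩
      filter_upwards [h1, hb'] with a ha hba
      refine ⟨ha.1, ha.2.1.trans ?_, ?_, ?_⟩
      · gcongr; exact le_max_left _ _
      · calc ‖b a‖ ≤ |C'| * ‖A a‖ ^ 2 := hba.1.trans (by gcongr; exact le_abs_self _)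
          _ ≤ |C'| * (C * √(𝓑 a (A a) (A a))) ^ 2 := by gcongr; exact ha.2.2.1
          _ = (|C'| * C ^ 2) * √(𝓑 a (A a) (A a)) ^ (2 : ℝ) := by
            rw [Real.rpow_ofNat]; ring
          _ ≤ _ := by gcongr; exact (le_max_left _ _).trans (le_max_right _ _)
      · calc ‖fderiv ℝ b a‖ ≤ |C'| * ‖A a‖ := hba.2.trans (by gcongr; exact le_abs_self _)
          _ ≤ |C'| * (C * √(𝓑 a (A a) (A a))) := by gcongr; exact ha.2.2.1
          _ = (|C'| * C) * √(𝓑 a (A a) (A a)) ^ ((2 : ℝ) - 1) := by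
            rw [show (2 : ℝ) - 1 = 1 by norm_num, Real.rpow_one]; ring
          _ ≤ _ := by gcongr; exact (le_max_right _ _).trans (le_max_right _ _))).1
  have h3 := this.const_smul s
  simpa only [smul_smul] using! h3

/-- `Q^s A` is of class `C²` for `s > 1/2`. -/
theorem contDiffAt_two_smul {s : ℝ} (hs : 0 ≤ s)
    (h : 0 < 𝓑 a₀ (A a₀) (A a₀) ∨ s = 0 ∨ 1 < 2 * s) :
    ContDiffAt ℝ 2 (fun a => 𝓑 a (A a) (A a) ^ s • A a) a₀ := by
  have h2 : (2 : WithTop ℕ∞) = ((1 : ℕ) : WithTop ℕ∞) + 1 := by norm_num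
  rw [h2, contDiffAt_succ_iff_hasFDerivAt]
  refine ⟨_, ⟨_, (hw.contDiffAt_one_smul hs).2, fun a ha => ha⟩, ?_⟩
  have h2' : (1 : WithTop ℕ∞) + 1 ≤ ∞ := by
    have := two_le_infty
    rw [minSmoothness_of_isRCLikeNormedField] at this
    exact (by norm_num : (1 : WithTop ℕ∞) + 1 = 2).trans_le this
  have hA' : ContDiffAt ℝ 1 (fderiv ℝ A) a₀ := hw.smooth.fderiv_right h2'
  have hQ' : ContDiffAt ℝ ∞ (fderiv ℝ (fun a => 𝓑 a (A a) (A a))) a₀ :=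
    hw.contDiffAt.fderiv_right (by simp)
  have hb : ContDiffAt ℝ ∞
      (fun a => (fderiv ℝ (fun a => 𝓑 a (A a) (A a)) a).smulRight (A a)) a₀ :=
    (((ContinuousLinearMap.smulRightL ℝ P V).contDiff.contDiffAt.comp a₀ hQ').clm_apply hw.smooth)
  -- The derivative is `Q^s DA + s Q^{s-1} DQ ⊗ A`. The first summand is `C¹` because `Q^s` is; in
  -- the second, `DQ ⊗ A` is quadratic in `A`.
  refine ((hw.contDiffAt_rpow h).smul hA').add ?_
  obtain ⟨D, hD, hDA⟩ := hw.exists_fderiv_le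
  have hA1 : ContDiffAt ℝ 1 A a₀ := hw.smooth.of_le (by simp)
  have hQ1 : ContDiffAt ℝ 1 (fderiv ℝ (fun a => 𝓑 a (A a) (A a))) a₀ := hQ'.of_le (by simp)
  obtain ⟨C₁, hC₁, hb₁⟩ := exists_eventually_norm_le (ContDiffAt.continuousAt_fderiv hA1)
  obtain ⟨C₂, hC₂, hb₂⟩ := exists_eventually_norm_le (ContDiffAt.continuousAt_fderiv hQ1)
  refine hw.contDiffAt_rpow_sub_one_smul (C' := max D (C₂ + D * C₁)) (hb.of_le (by simp)) ?_ h
  filter_upwards [hDA, hb₁, hb₂, ContDiffAt.eventually_one hA1, ContDiffAt.eventually_one hQ1]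
    with a h3 h4 h5 h6 h7
  refine ⟨?_, ?_⟩
  · rw [ContinuousLinearMap.norm_smulRight_apply]
    calc _ ≤ (D * ‖A a‖) * ‖A a‖ := by gcongr
      _ = D * ‖A a‖ ^ 2 := by ring
      _ ≤ _ := by gcongr; exact le_max_left _ _
  · have e1 := ((ContinuousLinearMap.smulRightL ℝ P V).hasFDerivAt.comp a
      (h7.differentiableAt (by simp)).hasFDerivAt).clm_apply
      (h6.differentiableAt (by simp)).hasFDerivAt
    have e2 : fderiv ℝ (fun a => (fderiv ℝ (fun a => 𝓑 a (A a) (A a)) a).smulRight (A a)) a = _ :=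
      e1.fderiv
    rw [e2]
    refine ContinuousLinearMap.opNorm_le_bound _ (by positivity) fun ξ => ?_
    have e3 : ‖fderiv ℝ (fderiv ℝ (fun a => 𝓑 a (A a) (A a))) a ξ‖ ≤ C₂ * ‖ξ‖ :=
      ContinuousLinearMap.le_of_opNorm_le _ h5 ξ
    have e4 : ‖fderiv ℝ A a ξ‖ ≤ C₁ * ‖ξ‖ := ContinuousLinearMap.le_of_opNorm_le _ h4 ξ
    calc _ = ‖(fderiv ℝ (fun a => 𝓑 a (A a) (A a)) a).smulRight (fderiv ℝ A a ξ) +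
          (fderiv ℝ (fderiv ℝ (fun a => 𝓑 a (A a) (A a))) a ξ).smulRight (A a)‖ := rfl
      _ ≤ (D * ‖A a‖) * (C₁ * ‖ξ‖) + (C₂ * ‖ξ‖) * ‖A a‖ := by
        refine (norm_add_le _ _).trans (add_le_add ?_ ?_)
        · rw [ContinuousLinearMap.norm_smulRight_apply]; gcongr
        · rw [ContinuousLinearMap.norm_smulRight_apply]; gcongr
      _ = (C₂ + D * C₁) * ‖A a‖ * ‖ξ‖ := by ring
      _ ≤ _ := by gcongr; exact le_max_right _ _

end IsWeight

end QuadraticWeight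

end

/-! ### Charts of a manifold: changes of coordinates, tangent frames, the metric in a chart. -/

section
section Charts

variable {d : ℕ} {X : Type*} [TopologicalSpace X] [ChartedSpace (EuclideanSpace ℝ (Fin d)) X]

/-- The preferred chart at `x₀`. -/
abbrev ch (d : ℕ) {X : Type*} [TopologicalSpace X] [ChartedSpace (EuclideanSpace ℝ (Fin d)) X]
    (x₀ : X) : PartialEquiv X (Euc d) := extChartAt (𝓡 d) x₀

/-- The change of coordinates from the chart at `x₀` to the chart at `x₁`. -/
def trans (d : ℕ) {X : Type*} [TopologicalSpace X] [ChartedSpace (EuclideanSpace ℝ (Fin d)) X]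
    (x₀ x₁ : X) (z : Euc d) : Euc d := ch d x₁ ((ch d x₀).symm z)

/-- The points of the chart at `x₀` that are also in the chart at `x₁`. -/
def overlap (d : ℕ) {X : Type*} [TopologicalSpace X] [ChartedSpace (EuclideanSpace ℝ (Fin d)) X]
    (x₀ x₁ : X) : Set (Euc d) := (ch d x₀).target ∩ (ch d x₀).symm ⁻¹' (ch d x₁).source

theorem isOpen_overlap (x₀ x₁ : X) : IsOpen (overlap d x₀ x₁) :=
  (continuousOn_extChartAt_symm x₀).isOpen_inter_preimage (isOpen_extChartAt_target x₀)
    (isOpen_extChartAt_source x₁)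

theorem mem_overlap {x₀ x₁ x : X} (h₀ : x ∈ (ch d x₀).source) (h₁ : x ∈ (ch d x₁).source) :
    ch d x₀ x ∈ overlap d x₀ x₁ :=
  ⟨(ch d x₀).map_source h₀, by rwa [mem_preimage, (ch d x₀).left_inv h₀]⟩

theorem trans_ch {x₀ x₁ x : X} (h₀ : x ∈ (ch d x₀).source) :
    trans d x₀ x₁ (ch d x₀ x) = ch d x₁ x := by
  rw [trans, (ch d x₀).left_inv h₀]

theorem trans_mem_overlap {x₀ x₁ : X} {z : Euc d} (hz : z ∈ overlap d x₀ x₁) :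
    trans d x₀ x₁ z ∈ overlap d x₁ x₀ :=
  mem_overlap hz.2 ((ch d x₀).map_target hz.1)

theorem symm_trans {x₀ x₁ : X} {z : Euc d} (hz : z ∈ overlap d x₀ x₁) :
    (ch d x₁).symm (trans d x₀ x₁ z) = (ch d x₀).symm z :=
  (ch d x₁).left_inv hz.2

theorem trans_trans {x₀ x₁ : X} {z : Euc d} (hz : z ∈ overlap d x₀ x₁) :
    trans d x₁ x₀ (trans d x₀ x₁ z) = z := by
  rw [trans, symm_trans hz, (ch d x₀).right_inv hz.1]

theorem eventually_mem_source {x₀ : X} {x : X} (hx : x ∈ (ch d x₀).source) :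
    ∀ᶠ z in 𝓝 (ch d x₀ x), z ∈ (ch d x₀).target :=
  (isOpen_extChartAt_target x₀).mem_nhds ((ch d x₀).map_source hx)

variable [IsManifold (𝓡 d) ∞ X]

theorem contDiffAt_trans {x₀ x₁ : X} {z : Euc d} (hz : z ∈ overlap d x₀ x₁) :
    ContDiffAt ℝ ∞ (trans d x₀ x₁) z := by
  have h1 : ContDiffOn ℝ ∞ (trans d x₀ x₁) (overlap d x₀ x₁) := by
    have := contDiffOn_ext_coord_change (n := ∞) (I := 𝓡 d) x₁ x₀
    rwa [PartialEquiv.trans_source, PartialEquiv.symm_source] at this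
  exact h1.contDiffAt ((isOpen_overlap x₀ x₁).mem_nhds hz)

theorem fderiv_trans_trans {x₀ x₁ x₂ : X} {z : Euc d} (h₁ : z ∈ overlap d x₀ x₁)
    (h₂ : z ∈ overlap d x₀ x₂) (u : Euc d) :
    fderiv ℝ (trans d x₁ x₂) (trans d x₀ x₁ z) (fderiv ℝ (trans d x₀ x₁) z u) =
      fderiv ℝ (trans d x₀ x₂) z u := by
  have h3 : trans d x₀ x₁ z ∈ overlap d x₁ x₂ := mem_overlap h₁.2 h₂.2
  have h4 : trans d x₁ x₂ ∘ trans d x₀ x₁ =ᶠ[𝓝 z] trans d x₀ x₂ := by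
    filter_upwards [(isOpen_overlap x₀ x₁).mem_nhds h₁] with y hy
    rw [Function.comp_apply, trans, symm_trans hy, trans]
  rw [← h4.fderiv_eq, fderiv_comp z ((contDiffAt_trans h3).differentiableAt (by simp))
    ((contDiffAt_trans h₁).differentiableAt (by simp))]
  rfl

theorem fderiv_trans_inverse {x₀ x₁ : X} {z : Euc d} (h₁ : z ∈ overlap d x₀ x₁) (u : Euc d) :
    fderiv ℝ (trans d x₁ x₀) (trans d x₀ x₁ z) (fderiv ℝ (trans d x₀ x₁) z u) = u := by
  have h0 : z ∈ overlap d x₀ x₀ := ⟨h₁.1, (ch d x₀).map_target h₁.1⟩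
  rw [fderiv_trans_trans h₁ h0]
  have : trans d x₀ x₀ =ᶠ[𝓝 z] id := by
    filter_upwards [(isOpen_overlap x₀ x₀).mem_nhds h0] with y hy
    exact (ch d x₀).right_inv hy.1
  rw [this.fderiv_eq, fderiv_id]
  rfl

/-- `coordField` as a continuous linear map. -/
def coordL (d : ℕ) {X : Type*} [TopologicalSpace X] [ChartedSpace (EuclideanSpace ℝ (Fin d)) X]
    [IsManifold (𝓡 d) ∞ X] (x₀ y : X) : Euc d →L[ℝ] Euc d :=
  (trivializationAt (EuclideanSpace ℝ (Fin d)) (fun x : X => TangentSpace (𝓡 d) x) x₀).symmL ℝ y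

theorem coordField_eq_coordL (x₀ y : X) (u : Euc d) : coordField x₀ u y = coordL d x₀ y u := rfl

theorem tangentCoordChange_eq (x₀ x₁ y : X) :
    tangentCoordChange (𝓡 d) x₀ x₁ y = fderiv ℝ (trans d x₀ x₁) (ch d x₀ y) := by
  rw [tangentCoordChange_def]
  simp only [modelWithCornersSelf_coe, range_id, fderivWithin_univ]
  rfl

/-- The tangent space at `y` is the model space by way of the preferred chart at `y`. Hence the
frame of the chart at `x₀` is seen there through the derivative of the change of coordinates to that
chart. -/
theorem coordL_eq {x₀ y : X} (hy : y ∈ (ch d x₀).source) :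
    coordL d x₀ y = fderiv ℝ (trans d x₀ y) (ch d x₀ y) := by
  rw [← tangentCoordChange_eq]
  exact TangentBundle.symmL_trivializationAt_eq_core (by rwa [extChartAt_source] at hy)

theorem coordL_trans {x₀ x₁ y : X} (h₀ : y ∈ (ch d x₀).source) (h₁ : y ∈ (ch d x₁).source)
    (u : Euc d) : coordL d x₁ y (fderiv ℝ (trans d x₀ x₁) (ch d x₀ y) u) = coordL d x₀ y u := by
  rw [coordL_eq h₁, coordL_eq h₀, ← trans_ch h₀,
    fderiv_trans_trans (mem_overlap h₀ h₁) (mem_overlap h₀ (mem_extChartAt_source y))]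

theorem coordL_self (y : X) (u : Euc d) : coordL d y y u = u := by
  rw [coordL_eq (mem_extChartAt_source y)]
  have := fderiv_trans_inverse (mem_overlap (mem_extChartAt_source (I := 𝓡 d) y)
    (mem_extChartAt_source (I := 𝓡 d) y)) u
  rwa [fderiv_trans_trans (mem_overlap (mem_extChartAt_source (I := 𝓡 d) y)
    (mem_extChartAt_source (I := 𝓡 d) y)) (mem_overlap (mem_extChartAt_source (I := 𝓡 d) y)
    (mem_extChartAt_source (I := 𝓡 d) y))] at this

/-- The components of a tangent vector at `y` in the chart at `x₀`. -/
def coordInv (d : ℕ) {X : Type*} [TopologicalSpace X] [ChartedSpace (EuclideanSpace ℝ (Fin d)) X]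
    (x₀ y : X) : Euc d →L[ℝ] Euc d := fderiv ℝ (trans d y x₀) (ch d y y)

theorem coordL_coordInv {x₀ y : X} (hy : y ∈ (ch d x₀).source) (u : Euc d) :
    coordL d x₀ y (coordInv d x₀ y u) = u := by
  rw [coordInv, coordL_trans (mem_extChartAt_source y) hy, coordL_self]

theorem coordInv_coordL {x₀ y : X} (hy : y ∈ (ch d x₀).source) (u : Euc d) :
    coordInv d x₀ y (coordL d x₀ y u) = u := by
  have h := fderiv_trans_inverse (mem_overlap hy (mem_extChartAt_source (I := 𝓡 d) y)) u
  rwa [trans_ch hy, ← coordL_eq hy] at h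

theorem trivializationAt_snd (x₀ y : X) (v : TangentSpace (𝓡 d) y) :
    (trivializationAt (EuclideanSpace ℝ (Fin d)) (fun x : X => TangentSpace (𝓡 d) x) x₀
      ⟨y, v⟩).2 = coordInv d x₀ y v := by
  rw [TangentBundle.trivializationAt_apply]
  have := tangentCoordChange_eq (d := d) y x₀ y
  rw [tangentCoordChange_def] at this
  exact congrArg (fun L : Euc d →L[ℝ] Euc d => L v) this

/-- The metric at a point, as a form on the model space. -/
def innerForm (g : Metric d X) (y : X) : Form d := g.inner y

theorem isInner_innerForm (g : Metric d X) (y : X) : IsInner (innerForm g y) :=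
  ⟨fun u w => g.symm y u w, fun u hu => g.pos y u hu⟩

/-- The metric in the chart at `x₀`, as a field of bilinear forms. -/
def metE (g : Metric d X) (x₀ : X) (z : Euc d) : Form d :=
  (innerForm g ((ch d x₀).symm z)).bilinearComp (coordL d x₀ ((ch d x₀).symm z))
    (coordL d x₀ ((ch d x₀).symm z))

theorem metricInChart_eq (g : Metric d X) (x₀ : X) :
    metricInChart g x₀ = fun z u w => metE g x₀ z u w := rfl

theorem metE_apply (g : Metric d X) (x₀ : X) (z u w : Euc d) :
    metE g x₀ z u w = innerForm g ((ch d x₀).symm z) (coordL d x₀ ((ch d x₀).symm z) u)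
      (coordL d x₀ ((ch d x₀).symm z) w) := rfl

theorem inner_coordL (g : Metric d X) {x₀ y : X} (hy : y ∈ (ch d x₀).source) (u w : Euc d) :
    innerForm g y (coordL d x₀ y u) (coordL d x₀ y w) = metE g x₀ (ch d x₀ y) u w := by
  rw [metE_apply, (ch d x₀).left_inv hy]

/-- In the trivialisation at `x₀` the field is constant. -/
theorem contMDiffOn_coordField (x₀ : X) (u : Euc d) :
    ContMDiffOn (𝓡 d) ((𝓡 d).prod 𝓘(ℝ, Euc d)) ∞
      (fun y => TotalSpace.mk' (Euc d) (E := fun x : X => TangentSpace (𝓡 d) x) y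
        (coordField x₀ u y)) (ch d x₀).source := by
  intro y hy
  have hb : (ch d x₀).source =
      (trivializationAt (EuclideanSpace ℝ (Fin d)) (fun x : X => TangentSpace (𝓡 d) x) x₀).baseSet :=
    extChartAt_source (𝓡 d) x₀
  rw [(trivializationAt (EuclideanSpace ℝ (Fin d))
    (fun x : X => TangentSpace (𝓡 d) x) x₀).contMDiffWithinAt_section _ (by rwa [hb] at hy)]
  refine (contMDiffWithinAt_const (c := u)).congr (fun y hy => ?_) ?_
  · rw [trivializationAt_snd, coordField_eq_coordL, coordInv_coordL hy]
  · rw [trivializationAt_snd, coordField_eq_coordL, coordInv_coordL hy]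

theorem contMDiffOn_inner_coordField (g : Metric d X) (x₀ : X) (u w : Euc d) :
    ContMDiffOn (𝓡 d) 𝓘(ℝ, ℝ) ∞
      (fun y => g.inner y (coordField x₀ u y) (coordField x₀ w y)) (ch d x₀).source := by
  intro y hy
  have : ContMDiffWithinAt (𝓡 d) ((𝓡 d).prod 𝓘(ℝ)) ∞
      (fun m ↦ TotalSpace.mk' ℝ (E := Bundle.Trivial X ℝ) m
        (g.inner m (coordField x₀ u m) (coordField x₀ w m))) (ch d x₀).source y := by
    apply ContMDiffWithinAt.clm_bundle_apply₂ (F₁ := Euc d) (F₂ := Euc d)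
    · exact g.contMDiff.contMDiffAt.contMDiffWithinAt
    · exact contMDiffOn_coordField x₀ u y hy
    · exact contMDiffOn_coordField x₀ w y hy
  simp only [contMDiffWithinAt_totalSpace] at this
  exact this.2

theorem contDiffOn_metricInChart (g : Metric d X) (x₀ : X) (u w : Euc d) :
    ContDiffOn ℝ ∞ (fun z => metricInChart g x₀ z u w) (ch d x₀).target := by
  rw [← contMDiffOn_iff_contDiffOn]
  exact (contMDiffOn_inner_coordField g x₀ u w).comp (contMDiffOn_extChartAt_symm x₀)
    fun z hz => (ch d x₀).map_target hz

theorem isInner_metE (g : Metric d X) {x₀ : X} {z : Euc d} (hz : z ∈ (ch d x₀).target) :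
    IsInner (metE g x₀ z) := by
  have hy := (ch d x₀).map_target hz
  refine ⟨fun u w => (isInner_innerForm g _).symm _ _, fun u hu => ?_⟩
  refine (isInner_innerForm g _).pos _ fun h => hu ?_
  exact (coordInv_coordL hy u).symm.trans
    ((congrArg (coordInv d x₀ ((ch d x₀).symm z)) h).trans (map_zero _))

theorem isMetricOn_metE (g : Metric d X) (x₀ : X) : IsMetricOn (metE g x₀) (ch d x₀).target where
  isOpen := isOpen_extChartAt_target x₀
  smooth := contDiffOn_clm_apply.2 fun u => contDiffOn_clm_apply.2 fun w =>
    contDiffOn_metricInChart g x₀ u w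
  inner _ hz := isInner_metE g hz

theorem metE_trans (g : Metric d X) {x₀ x₁ : X} {z : Euc d} (hz : z ∈ overlap d x₀ x₁)
    (u w : Euc d) :
    metE g x₀ z u w = metE g x₁ (trans d x₀ x₁ z) (fderiv ℝ (trans d x₀ x₁) z u)
      (fderiv ℝ (trans d x₀ x₁) z w) := by
  have h₀ : (ch d x₀).symm z ∈ (ch d x₀).source := (ch d x₀).map_target hz.1
  have h1 := coordL_trans h₀ hz.2
  rw [(ch d x₀).right_inv hz.1] at h1
  rw [metE_apply, metE_apply, symm_trans hz, h1, h1]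

/-- The trace in the chart at `x₀`. -/
theorem trace_eq {F : Type*} [AddCommGroup F] [Module ℝ F] (g : Metric d X) {x₀ y : X}
    (hy : y ∈ (ch d x₀).source) (B : Euc d →ₗ[ℝ] Euc d →ₗ[ℝ] F) :
    trace g y (fun u w => B u w) =
      formTrace (metE g x₀ (ch d x₀ y)) fun u w => B (coordL d x₀ y u) (coordL d x₀ y w) := by
  rw [(isInner_innerForm g y).formTrace_comp (coordL d x₀ y) (coordInv d x₀ y)
    (coordL_coordInv hy) (fun u w => (inner_coordL g hy u w).symm) B]
  rfl

theorem gamma_eq (g : Metric d X) (x : X) (u w : TangentSpace (𝓡 d) x) :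
    gamma g x u w = chr (metE g x) (ch d x x) u w := by
  rw [gamma, metricInChart_eq]
  exact (isMetricOn_metE g x).christoffel_eq (mem_extChartAt_target x) u w

theorem curvature_eq (g : Metric d X) (x : X) (u v w : TangentSpace (𝓡 d) x) :
    curvature g x u v w = curvE (metE g x) (ch d x x) u v w := by
  rw [curvature, metricInChart_eq]
  exact (isMetricOn_metE g x).coordCurvature_eq (mem_extChartAt_target x) u v w

end Charts

end

/-! ### The operators of the statement in arbitrary charts. -/

section
variable {m n : ℕ}
  {M : Type*} [TopologicalSpace M] [ChartedSpace (EuclideanSpace ℝ (Fin m)) M]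
  {N : Type*} [TopologicalSpace N] [ChartedSpace (EuclideanSpace ℝ (Fin n)) N]

/-- A map in the charts at `x₀` and `y₀`. -/
def repMap (m n : ℕ) {M : Type*} [TopologicalSpace M] [ChartedSpace (EuclideanSpace ℝ (Fin m)) M]
    {N : Type*} [TopologicalSpace N] [ChartedSpace (EuclideanSpace ℝ (Fin n)) N]
    (x₀ : M) (y₀ : N) (φ : M → N) (z : Euc m) : Euc n := ch n y₀ (φ ((ch m x₀).symm z))

theorem repMap_ch {x₀ : M} (y₀ : N) (φ : M → N) {x : M} (hx : x ∈ (ch m x₀).source) :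
    repMap m n x₀ y₀ φ (ch m x₀ x) = ch n y₀ (φ x) := by
  rw [repMap, (ch m x₀).left_inv hx]

theorem tendsto_symm {x₀ : M} {x : M} (hx : x ∈ (ch m x₀).source) :
    Filter.Tendsto (ch m x₀).symm (𝓝 (ch m x₀ x)) (𝓝 x) := by
  have := continuousAt_extChartAt_symm'' (I := 𝓡 m) ((ch m x₀).map_source hx)
  rwa [ContinuousAt, (ch m x₀).left_inv hx] at this

variable [IsManifold (𝓡 m) ∞ M] [IsManifold (𝓡 n) ∞ N]

theorem coordInv_coordL' {y₀ y₁ y : N} (h₀ : y ∈ (ch n y₀).source) (h₁ : y ∈ (ch n y₁).source)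
    (u : Euc n) :
    coordInv n y₁ y (coordL n y₀ y u) = fderiv ℝ (trans n y₀ y₁) (ch n y₀ y) u := by
  rw [← coordL_trans h₀ h₁, coordInv_coordL h₁]

theorem coordL_injective {y₀ y : N} (h₀ : y ∈ (ch n y₀).source) {u w : Euc n}
    (h : coordL n y₀ y u = coordL n y₀ y w) : u = w := by
  rw [← coordInv_coordL h₀ u, h, coordInv_coordL h₀]

theorem coordInv_self (y : N) (u : Euc n) : coordInv n y y u = u := by
  conv_lhs => rw [← coordL_self y u]
  exact coordInv_coordL (mem_extChartAt_source y) u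

section Rep

variable {x₀ x : M} {y₀ : N} {φ : M → N}

theorem contDiffAt_repMap (hx : x ∈ (ch m x₀).source) (hy : φ x ∈ (ch n y₀).source)
    (hφ : ContMDiffAt (𝓡 m) (𝓡 n) ∞ φ x) :
    ContDiffAt ℝ ∞ (repMap m n x₀ y₀ φ) (ch m x₀ x) := by
  rw [extChartAt_source] at hx hy
  have := ((contMDiffAt_iff_of_mem_source hx hy).1 hφ).2
  rwa [modelWithCornersSelf_coe, range_id, contDiffWithinAt_univ] at this

omit [IsManifold (𝓡 m) ∞ M] in
theorem eventually_mem_overlap {x₀ x₁ x : M} (h₀ : x ∈ (ch m x₀).source)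
    (h₁ : x ∈ (ch m x₁).source) : ∀ᶠ z in 𝓝 (ch m x₀ x), z ∈ overlap m x₀ x₁ :=
  (isOpen_overlap x₀ x₁).mem_nhds (mem_overlap h₀ h₁)

omit [IsManifold (𝓡 m) ∞ M] [IsManifold (𝓡 n) ∞ N] in
theorem eventually_map_mem {y₁ : N} (hx : x ∈ (ch m x₀).source) (hφ : ContinuousAt φ x)
    (hy : φ x ∈ (ch n y₁).source) :
    ∀ᶠ z in 𝓝 (ch m x₀ x), φ ((ch m x₀).symm z) ∈ (ch n y₁).source :=
  (hφ.tendsto.comp (tendsto_symm hx)).eventually ((isOpen_extChartAt_source y₁).mem_nhds hy)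

omit [IsManifold (𝓡 m) ∞ M] [IsManifold (𝓡 n) ∞ N] in
theorem eventually_repMap_trans {x₁ : M} {y₁ : N} (hx : x ∈ (ch m x₀).source)
    (hx₁ : x ∈ (ch m x₁).source) (hφ : ContinuousAt φ x) (hy : φ x ∈ (ch n y₀).source) :
    ∀ᶠ z in 𝓝 (ch m x₀ x), repMap m n x₁ y₁ φ (trans m x₀ x₁ z) =
      trans n y₀ y₁ (repMap m n x₀ y₀ φ z) := by
  filter_upwards [eventually_mem_overlap hx hx₁, eventually_map_mem hx hφ hy] with z h1 h2
  rw [repMap, symm_trans h1, repMap, trans_ch h2]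

omit [IsManifold (𝓡 m) ∞ M] [IsManifold (𝓡 n) ∞ N] in
theorem mfderiv_eq_fderiv (hφ : MDifferentiableAt (𝓡 m) (𝓡 n) φ x) :
    mfderiv (𝓡 m) (𝓡 n) φ x = fderiv ℝ (repMap m n x (φ x) φ) (ch m x x) := by
  rw [hφ.mfderiv, modelWithCornersSelf_coe, range_id, fderivWithin_univ]
  rfl

/-- `mfderiv` is read in the preferred charts at `x` and `φ x`; the chain rule with a change of
coordinates on either side leads to the charts at `x₀` and `y₀`. -/
theorem mfderiv_coordL (hx : x ∈ (ch m x₀).source) (hy : φ x ∈ (ch n y₀).source)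
    (hφ : ContMDiffAt (𝓡 m) (𝓡 n) ∞ φ x) (w : Euc m) :
    mfderiv (𝓡 m) (𝓡 n) φ x (coordL m x₀ x w) =
      coordL n y₀ (φ x) (fderiv ℝ (repMap m n x₀ y₀ φ) (ch m x₀ x) w) := by
  have hxx := mem_extChartAt_source (I := 𝓡 m) x
  have hyy := mem_extChartAt_source (I := 𝓡 n) (φ x)
  have ho := mem_overlap hx hxx
  have hf := contDiffAt_repMap hx hy hφ
  have hz := repMap_ch (n := n) y₀ φ hx
  have hβ : ContDiffAt ℝ ∞ (trans n y₀ (φ x)) (repMap m n x₀ y₀ φ (ch m x₀ x)) := by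
    rw [hz]; exact contDiffAt_trans (mem_overlap hy hyy)
  have h1 := (hβ.differentiableAt (by simp)).hasFDerivAt.comp _
    (hf.differentiableAt (by simp)).hasFDerivAt
  have h2 := fderiv_comp_eq (X := trans n y₀ (φ x) ∘ repMap m n x₀ y₀ φ)
    (X' := repMap m n x (φ x) φ) (contDiffAt_trans ho)
    (contDiffAt_trans (trans_mem_overlap ho)) (trans_trans ho)
    (by
      filter_upwards [(isOpen_overlap x x₀).mem_nhds (trans_mem_overlap ho)] with y h
      exact trans_trans h)
    h1.differentiableAt (eventually_repMap_trans hx hxx hφ.continuousAt hy) w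
  rw [h1.fderiv, trans_ch hx, ← coordL_eq hx] at h2
  rw [mfderiv_eq_fderiv (hφ.mdifferentiableAt (by simp))]
  refine h2.trans ?_
  rw [coordL_eq hy, hz]
  rfl

theorem trace_eq_formTrace {F : Type*} [AddCommGroup F] [Module ℝ F] (g : Metric m M) (x : M)
    (B : Euc m → Euc m → F) : trace g x B = formTrace (innerForm g x) B := rfl

/-- The covariant derivative in arbitrary charts. -/
theorem covDeriv_eq (h : Metric n N) (hx : x ∈ (ch m x₀).source) (hy : φ x ∈ (ch n y₀).source)
    (hφ : ContMDiffAt (𝓡 m) (𝓡 n) ∞ φ x) {V : ∀ x, TangentSpace (𝓡 n) (φ x)}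
    {X : Euc m → Euc n} (hX : DifferentiableAt ℝ X (ch m x₀ x))
    (hV : ∀ᶠ z in 𝓝 (ch m x₀ x),
      V ((ch m x₀).symm z) = coordL n y₀ (φ ((ch m x₀).symm z)) (X z)) (u : Euc m) :
    covDeriv h φ V x (coordL m x₀ x u) =
      coordL n y₀ (φ x) (covE (metE h y₀) (repMap m n x₀ y₀ φ) X (ch m x₀ x) u) := by
  have hxx := mem_extChartAt_source (I := 𝓡 m) x
  have hyy := mem_extChartAt_source (I := 𝓡 n) (φ x)
  have ho := mem_overlap hx hxx
  have ho' := mem_overlap hy hyy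
  have hz := repMap_ch (n := n) y₀ φ hx
  have hX' : ∀ᶠ z in 𝓝 (ch m x₀ x), alongInChart φ V x (trans m x₀ x z) =
      fderiv ℝ (trans n y₀ (φ x)) (repMap m n x₀ y₀ φ z) (X z) := by
    filter_upwards [eventually_mem_overlap hx hxx, eventually_map_mem hx hφ.continuousAt hy,
      eventually_map_mem hx hφ.continuousAt hyy, hV] with z h1 h2 h3 h4
    rw [alongInChart, trivializationAt_snd, symm_trans h1]
    refine (congrArg _ h4).trans ?_
    rw [coordInv_coordL' h2 h3, repMap]
  -- The covariant derivative is defined in the preferred charts at `x` and `φ x`, so naturality is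
  -- applied to the changes of coordinates from the charts at `x₀` and `y₀` to those.
  have key := covE_natural (isMetricOn_metE h y₀) (isMetricOn_metE h (φ x)) (contDiffAt_trans ho)
    (contDiffAt_trans (trans_mem_overlap ho))
    ((eventually_mem_overlap hx hxx).mono fun z h => trans_trans h)
    (by
      filter_upwards [(isOpen_overlap x x₀).mem_nhds (trans_mem_overlap ho)] with y h
      exact trans_trans h)
    (β := trans n y₀ (φ x)) (f := repMap m n x₀ y₀ φ) (f' := repMap m n x (φ x) φ)
    (by rw [hz]; exact ho'.1) (by rw [hz]; exact (trans_mem_overlap ho').1)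
    (by rw [hz]; exact contDiffAt_trans ho')
    (by
      rw [hz]
      intro w
      refine ⟨fderiv ℝ (trans n (φ x) y₀) (trans n y₀ (φ x) (ch n y₀ (φ x))) w, ?_⟩
      have := fderiv_trans_inverse (trans_mem_overlap ho') w
      rwa [trans_trans ho'] at this)
    (by
      rw [hz]
      filter_upwards [(isOpen_overlap y₀ (φ x)).mem_nhds ho'] with y hy u w
      exact metE_trans h hy u w)
    (contDiffAt_repMap hx hy hφ) (eventually_repMap_trans hx hxx hφ.continuousAt hy) hX hX' u
  rw [trans_ch hx, ← coordL_eq hx, hz, ← coordL_eq hy] at key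
  have h0 : alongInChart φ V x (ch m x x) = V x := by
    rw [alongInChart, trivializationAt_snd, (ch m x).left_inv hxx]
    exact coordInv_self (φ x) (V x)
  rw [← key, covE, repMap_ch _ _ hxx, h0]
  change alongDeriv φ V x _ + gamma h (φ x) _ _ = _
  rw [gamma_eq, mfderiv_eq_fderiv (hφ.mdifferentiableAt (by simp))]
  rfl

/-- The divergence in arbitrary charts. -/
theorem divergence_eq (g : Metric m M) (h : Metric n N) (hx : x ∈ (ch m x₀).source)
    (hy : φ x ∈ (ch n y₀).source) (hφ : ContMDiffAt (𝓡 m) (𝓡 n) ∞ φ x)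
    {S : ∀ x, TangentSpace (𝓡 m) x → TangentSpace (𝓡 n) (φ x)}
    {T : Euc m → Euc m →L[ℝ] Euc n} (hT : DifferentiableAt ℝ T (ch m x₀ x))
    (hS : ∀ᶠ z in 𝓝 (ch m x₀ x), ∀ w, S ((ch m x₀).symm z) (coordL m x₀ ((ch m x₀).symm z) w) =
      coordL n y₀ (φ ((ch m x₀).symm z)) (T z w)) :
    divergence g h φ S x =
      coordL n y₀ (φ x)
        (divE (metE g x₀) (metE h y₀) (repMap m n x₀ y₀ φ) T (ch m x₀ x)) := by
  have hxx := mem_extChartAt_source (I := 𝓡 m) x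
  have hyy := mem_extChartAt_source (I := 𝓡 n) (φ x)
  have ho := mem_overlap hx hxx
  have ho' := mem_overlap hy hyy
  have hz := repMap_ch (n := n) y₀ φ hx
  have hf := contDiffAt_repMap hx hy hφ
  -- The one-form `T` transported to the preferred charts at `x` and `φ x`, where the divergence is
  -- defined.
  let T' : Euc m → Euc m →L[ℝ] Euc n := fun z =>
    (fderiv ℝ (trans n y₀ (φ x)) (repMap m n x₀ y₀ φ (trans m x x₀ z))) ∘L
      (T (trans m x x₀ z) ∘L fderiv ℝ (trans m x x₀) z)
  have key := divE_natural (isMetricOn_metE h y₀) (isMetricOn_metE h (φ x)) (contDiffAt_trans ho)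
    (contDiffAt_trans (trans_mem_overlap ho))
    ((eventually_mem_overlap hx hxx).mono fun z h => trans_trans h)
    (by
      filter_upwards [(isOpen_overlap x x₀).mem_nhds (trans_mem_overlap ho)] with y h
      exact trans_trans h)
    (β := trans n y₀ (φ x)) (f := repMap m n x₀ y₀ φ) (f' := repMap m n x (φ x) φ)
    (by rw [hz]; exact ho'.1) (by rw [hz]; exact (trans_mem_overlap ho').1)
    (by rw [hz]; exact contDiffAt_trans ho')
    (by
      rw [hz]
      intro w
      refine ⟨fderiv ℝ (trans n (φ x) y₀) (trans n y₀ (φ x) (ch n y₀ (φ x))) w, ?_⟩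
      have := fderiv_trans_inverse (trans_mem_overlap ho') w
      rwa [trans_trans ho'] at this)
    (by
      rw [hz]
      filter_upwards [(isOpen_overlap y₀ (φ x)).mem_nhds ho'] with y hy u w
      exact metE_trans h hy u w)
    hf (eventually_repMap_trans hx hxx hφ.continuousAt hy)
    (isMetricOn_metE g x₀) (isMetricOn_metE g x) ho.1 (trans_mem_overlap ho).1
    (by
      filter_upwards [(isOpen_overlap x x₀).mem_nhds (trans_mem_overlap ho)] with y hy u w
      exact metE_trans g hy u w) (S' := T') hT
    (by
      filter_upwards [eventually_mem_overlap hx hxx] with z h1 w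
      simp only [T', ContinuousLinearMap.comp_apply]
      rw [fderiv_trans_inverse h1, trans_trans h1])
  rw [trans_ch hx, hz, ← coordL_eq hy] at key
  rw [← key, divergence, divE]
  have hT' : DifferentiableAt ℝ T' (ch m x x) := by
    have h1 : DifferentiableAt ℝ (trans m x x₀) (ch m x x) :=
      (contDiffAt_trans (mem_overlap hxx hx)).differentiableAt (by simp)
    have h2 : DifferentiableAt ℝ (fderiv ℝ (trans m x x₀)) (ch m x x) :=
      ((contDiffAt_trans (mem_overlap hxx hx)).fderiv_right (m := ∞)
        (by simp)).differentiableAt (by simp)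
    have hc := trans_ch (d := m) (x₁ := x₀) hxx
    have h3 : DifferentiableAt ℝ (fun z => T (trans m x x₀ z)) (ch m x x) := by
      refine DifferentiableAt.comp _ ?_ h1
      rwa [hc]
    have h4 : DifferentiableAt ℝ (fun z => repMap m n x₀ y₀ φ (trans m x x₀ z)) (ch m x x) := by
      refine DifferentiableAt.comp (g := repMap m n x₀ y₀ φ) _ ?_ h1
      rw [hc]
      exact hf.differentiableAt (by simp)
    have h5 : DifferentiableAt ℝ (fun z => fderiv ℝ (trans n y₀ (φ x))
        (repMap m n x₀ y₀ φ (trans m x x₀ z))) (ch m x x) := by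
      refine DifferentiableAt.comp (g := fderiv ℝ (trans n y₀ (φ x))) _ ?_ h4
      rw [hc, hz]
      exact ((contDiffAt_trans ho').fderiv_right (m := ∞) (by simp)).differentiableAt (by simp)
    exact h5.clm_comp (h3.clm_comp h2)
  have hST : ∀ᶠ z in 𝓝 (ch m x x), ∀ w, S ((ch m x).symm z) (coordL m x ((ch m x).symm z) w) =
      coordL n (φ x) (φ ((ch m x).symm z)) (T' z w) := by
    have h0 : Filter.Tendsto (trans m x x₀) (𝓝 (ch m x x)) (𝓝 (ch m x₀ x)) := by
      have := (contDiffAt_trans (mem_overlap hxx hx)).continuousAt.tendsto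
      rwa [trans_ch hxx] at this
    filter_upwards [h0.eventually hS, eventually_mem_overlap hxx hx,
      eventually_map_mem hxx hφ.continuousAt hy, eventually_map_mem hxx hφ.continuousAt hyy]
      with z h1 h2 h3 h4 w
    have h5 := h1 (fderiv ℝ (trans m x x₀) z w)
    rw [symm_trans h2] at h5
    have h6 := coordL_trans ((ch m x).map_target h2.1) h2.2 w
    rw [(ch m x).right_inv h2.1] at h6
    rw [h6] at h5
    rw [h5]
    simp only [T', ContinuousLinearMap.comp_apply]
    rw [repMap, symm_trans h2, coordL_trans h3 h4]
  have hSx : ∀ w, S x w = T' (ch m x x) w := by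
    intro w
    have := hST.self_of_nhds w
    rw [(ch m x).left_inv hxx] at this
    exact (congrArg (S x) (coordL_self x w).symm).trans (this.trans (coordL_self (φ x) _))
  have hB : ∀ u w, covDeriv h φ (fun y => S y (coordField x w y)) x u - S x (gamma g x u w) =
      covE (metE h (φ x)) (repMap m n x (φ x) φ) (fun y => T' y w) (ch m x x) u -
        T' (ch m x x) (chr (metE g x) (ch m x x) u w) := by
    intro u w
    have h1 := covDeriv_eq h hxx hyy hφ (V := fun y => S y (coordField x w y))
      (X := fun y => T' y w) (hT'.clm_apply (differentiableAt_const w))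
      (hST.mono fun z hz => hz w) u
    have h2 : covDeriv h φ (fun y => S y (coordField x w y)) x u =
        covE (metE h (φ x)) (repMap m n x (φ x) φ) (fun y => T' y w) (ch m x x) u :=
      (congrArg _ (coordL_self x u).symm).trans (h1.trans (coordL_self (φ x) _))
    exact congrArg₂ (fun a b : Euc n => a - b) h2 ((congrArg (S x) (gamma_eq g x u w)).trans (hSx _))
  -- At the centre of its own chart the metric in coordinates is the metric itself, so the trace of
  -- the definition is the one in `divE`.
  have hg : metE g x (ch m x x) = innerForm g x := by
    ext a b
    have := inner_coordL g hxx a b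
    rw [coordL_self, coordL_self] at this
    rw [this]
  rw [hg]
  refine (trace_eq_formTrace g x _).trans ?_
  congr 1
  funext u w
  exact hB u w

theorem vnorm_coordL (h : Metric n N) {y : N} (hy : y ∈ (ch n y₀).source) (u : Euc n) :
    vnorm h y (coordL n y₀ y u) = √(metE h y₀ (ch n y₀ y) u u) := by
  rw [← inner_coordL h hy]
  rfl

/-- The inner product of linear maps in arbitrary charts. -/
theorem innerHom_eq (g : Metric m M) (h : Metric n N) (hx : x ∈ (ch m x₀).source) {y : N}
    (hy : y ∈ (ch n y₀).source) {S T : TangentSpace (𝓡 m) x → TangentSpace (𝓡 n) y}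
    {S' T' : Euc m →L[ℝ] Euc n} (hS : ∀ w, S (coordL m x₀ x w) = coordL n y₀ y (S' w))
    (hT : ∀ w, T (coordL m x₀ x w) = coordL n y₀ y (T' w)) :
    innerHom g h x y S T = innE (metE g x₀ (ch m x₀ x)) (metE h y₀ (ch n y₀ y)) S' T' := by
  have h1 : ∀ w, S w = coordL n y₀ y (S' (coordInv m x₀ x w)) := fun w =>
    (congrArg S (coordL_coordInv hx w).symm).trans (hS _)
  have h2 : ∀ w, T w = coordL n y₀ y (T' (coordInv m x₀ x w)) := fun w =>
    (congrArg T (coordL_coordInv hx w).symm).trans (hT _)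
  let b : Form m := (metE h y₀ (ch n y₀ y)).bilinearComp (S' ∘L coordInv m x₀ x)
    (T' ∘L coordInv m x₀ x)
  have h3 := trace_eq (F := ℝ) g hx (ContinuousLinearMap.toLinearMap₁₂ b)
  refine Eq.trans ?_ (h3.trans ?_)
  · refine congrArg (trace g x) ?_
    funext u w
    exact (congrArg₂ (fun a b => h.inner y a b) (h1 u) (h2 w)).trans (inner_coordL h hy _ _)
  · refine formTrace_congr _ fun i j => ?_
    change metE h y₀ (ch n y₀ y) (S' (coordInv m x₀ x (coordL m x₀ x (stdVec i))))
      (T' (coordInv m x₀ x (coordL m x₀ x (stdVec j)))) = _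
    rw [coordInv_coordL hx, coordInv_coordL hx]

end Rep

end

/-! ### The Riemannian volume measure. -/

section
variable {d : ℕ}

/-- The volume density transforms with the absolute value of the Jacobian determinant. -/
theorem volDens_comp {B B' : Form d} (A : Euc d →L[ℝ] Euc d)
    (h : ∀ u w, B' u w = B (A u) (A w)) : volDens B' = |A.det| * volDens B := by
  set b := (EuclideanSpace.basisFun (Fin d) ℝ).toBasis
  set J : Matrix (Fin d) (Fin d) ℝ := LinearMap.toMatrix b b (A : Euc d →ₗ[ℝ] Euc d) with hJ
  have hJA : ∀ i j, J i j = A (stdVec j) i := by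
    intro i j
    rw [hJ, LinearMap.toMatrix_apply]
    simp [b, stdVec]
  have h1 : (gram fun u w => B' u w) = J.transpose * (gram fun u w => B u w) * J := by
    ext i j
    rw [gram_apply, h, form_eq_sum]
    simp only [Matrix.mul_apply, Matrix.transpose_apply, gram_apply, Finset.sum_mul, hJA]
    rw [Finset.sum_comm]
    refine Finset.sum_congr rfl fun k _ => Finset.sum_congr rfl fun l _ => ?_
    ring
  have h2 : J.det = A.det := by
    rw [hJ, LinearMap.det_toMatrix]
  rw [volDens, volDens, h1, Matrix.det_mul, Matrix.det_mul, Matrix.det_transpose, h2,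
    show A.det * (gram fun u w => B u w).det * A.det = A.det ^ 2 * (gram fun u w => B u w).det by
      ring, Real.sqrt_mul (sq_nonneg _), Real.sqrt_sq_eq_abs]

variable {X : Type*} [TopologicalSpace X] [ChartedSpace (EuclideanSpace ℝ (Fin d)) X]
  [IsManifold (𝓡 d) ∞ X] (g : Metric d X)

/-- The volume density in the chart at `x₀`. -/
def dens (x₀ : X) (z : Euc d) : ℝ := volDens (metE g x₀ z)

theorem dens_pos {x₀ : X} {z : Euc d} (hz : z ∈ (ch d x₀).target) : 0 < dens g x₀ z :=
  (isMetricOn_metE g x₀).volDens_pos hz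

theorem continuousOn_dens (x₀ : X) : ContinuousOn (dens g x₀) (ch d x₀).target := fun _ hz =>
  ((isMetricOn_metE g x₀).contDiffAt_volDens hz).continuousAt.continuousWithinAt

theorem dens_trans {x₀ x₁ : X} {z : Euc d} (hz : z ∈ overlap d x₀ x₁) :
    dens g x₀ z = |(fderiv ℝ (trans d x₀ x₁) z).det| * dens g x₁ (trans d x₀ x₁ z) :=
  volDens_comp _ (metE_trans g hz)

variable [MeasurableSpace X] [BorelSpace X]

omit [IsManifold (𝓡 d) ∞ X] [MeasurableSpace X] [BorelSpace X] in
theorem measurableSet_target (x₀ : X) : MeasurableSet (ch d x₀).target :=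
  (isOpen_extChartAt_target x₀).measurableSet

omit [IsManifold (𝓡 d) ∞ X] in
theorem measurableSet_source (x₀ : X) : MeasurableSet (ch d x₀).source :=
  (isOpen_extChartAt_source x₀).measurableSet

omit [MeasurableSpace X] [BorelSpace X] in
theorem aemeasurable_dens (x₀ : X) : AEMeasurable (fun z => ENNReal.ofReal (dens g x₀ z))
    (volume.restrict (ch d x₀).target) :=
  ((continuousOn_dens g x₀).aemeasurable (measurableSet_target x₀)).ennreal_ofReal

/-- The measure in the chart at `x₀`. -/
def densMeasure (x₀ : X) : Measure (Euc d) :=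
  (volume.restrict (ch d x₀).target).withDensity fun z => ENNReal.ofReal (dens g x₀ z)

omit [BorelSpace X] in
theorem chartVolume_eq (x₀ : X) :
    chartVolume g x₀ = Measure.map (ch d x₀).symm (densMeasure g x₀) := rfl

theorem aemeasurable_symm (x₀ : X) : AEMeasurable (ch d x₀).symm (densMeasure g x₀) :=
  ((continuousOn_extChartAt_symm x₀).aemeasurable (measurableSet_target x₀)).mono_ac
    (withDensity_absolutelyContinuous _ _)

omit [IsManifold (𝓡 d) ∞ X] in
theorem measurableSet_inter_preimage  (x₀ : X) {A : Set X} (hA : MeasurableSet A) :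
    MeasurableSet ((ch d x₀).target ∩ (ch d x₀).symm ⁻¹' A) := by
  have h := (continuousOn_extChartAt_symm (I := 𝓡 d) x₀).domRestrict.measurable hA
  have := (measurableSet_target (d := d) x₀).subtype_image h
  convert this using 1
  ext z
  simp only [mem_inter_iff, mem_preimage, mem_image, Set.domRestrict_apply, Subtype.exists]
  constructor
  · rintro ⟨h1, h2⟩
    exact ⟨z, h1, h2, rfl⟩
  · rintro ⟨a, h1, h2, rfl⟩
    exact ⟨h1, h2⟩

theorem chartVolume_apply (x₀ : X) {A : Set X} (hA : MeasurableSet A) :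
    chartVolume g x₀ A = ∫⁻ z in (ch d x₀).target ∩ (ch d x₀).symm ⁻¹' A,
      ENNReal.ofReal (dens g x₀ z) := by
  have hm := measurableSet_inter_preimage (d := d) x₀ hA
  have h0 : densMeasure g x₀ (ch d x₀).targetᶜ = 0 := by
    rw [densMeasure, withDensity_apply _ (measurableSet_target x₀).compl,
      Measure.restrict_restrict (measurableSet_target x₀).compl]
    simp
  rw [chartVolume_eq, Measure.map_apply_of_aemeasurable (aemeasurable_symm g x₀) hA]
  -- Off the target the inverse chart takes irrelevant values; that part carries no mass.
  have h1 : densMeasure g x₀ ((ch d x₀).symm ⁻¹' A) =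
      densMeasure g x₀ ((ch d x₀).target ∩ (ch d x₀).symm ⁻¹' A) := by
    refine le_antisymm ?_ (measure_mono inter_subset_right)
    refine (measure_mono (t := ((ch d x₀).target ∩ (ch d x₀).symm ⁻¹' A) ∪ (ch d x₀).targetᶜ)
      ?_).trans ((measure_union_le _ _).trans (by rw [h0, add_zero]))
    intro z hz
    by_cases h : z ∈ (ch d x₀).target
    · exact Or.inl ⟨h, hz⟩
    · exact Or.inr h
  rw [h1, densMeasure, withDensity_apply _ hm, Measure.restrict_restrict hm]
  congr 2
  ext z
  exact ⟨fun h => h.1, fun h => ⟨h, h.1⟩⟩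

theorem chartVolume_compl_source (x₀ : X) : chartVolume g x₀ (ch d x₀).sourceᶜ = 0 := by
  rw [chartVolume_apply g x₀ (measurableSet_source x₀).compl]
  have : (ch d x₀).target ∩ (ch d x₀).symm ⁻¹' (ch d x₀).sourceᶜ = ∅ :=
    eq_empty_of_forall_notMem fun z hz => hz.2 ((ch d x₀).map_target hz.1)
  rw [this, setLIntegral_empty]

theorem chartVolume_restrict_self (x₀ : X) :
    (chartVolume g x₀).restrict (ch d x₀).source = chartVolume g x₀ := by
  rw [Measure.restrict_eq_self_of_ae_mem]
  rw [ae_iff]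
  exact chartVolume_compl_source g x₀

/-- The volume measures of two charts agree where both are defined. -/
theorem chartVolume_restrict_le (x x₀ : X) :
    (chartVolume g x).restrict (ch d x₀).source ≤ chartVolume g x₀ := by
  rw [Measure.le_iff]
  intro A hA
  rw [Measure.restrict_apply hA, chartVolume_apply g x (hA.inter (measurableSet_source x₀)),
    chartVolume_apply g x₀ hA]
  set B := (ch d x).target ∩ (ch d x).symm ⁻¹' (A ∩ (ch d x₀).source) with hB
  have hBm : MeasurableSet B := measurableSet_inter_preimage x (hA.inter (measurableSet_source x₀))
  have hBo : ∀ z ∈ B, z ∈ overlap d x x₀ := fun z hz => ⟨hz.1, hz.2.2⟩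
  -- The change of variables formula for the change of coordinates; its Jacobian is the ratio of the
  -- two densities by `dens_trans`.
  have h1 := lintegral_image_eq_lintegral_abs_det_fderiv_mul volume hBm
    (f := trans d x x₀) (f' := fderiv ℝ (trans d x x₀))
    (fun z hz => (((contDiffAt_trans (hBo z hz)).differentiableAt
      (by simp)).hasFDerivAt).hasFDerivWithinAt)
    (fun a ha b hb hab => by rw [← trans_trans (hBo a ha), hab, trans_trans (hBo b hb)])
    (fun z => ENNReal.ofReal (dens g x₀ z))
  have h2 : ∫⁻ z in B, ENNReal.ofReal (dens g x z) = ∫⁻ z in B,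
      ENNReal.ofReal |(fderiv ℝ (trans d x x₀) z).det| *
        ENNReal.ofReal (dens g x₀ (trans d x x₀ z)) := by
    refine setLIntegral_congr_fun hBm fun z hz => ?_
    rw [dens_trans g (hBo z hz), ENNReal.ofReal_mul (abs_nonneg _)]
  rw [h2, ← h1]
  refine lintegral_mono_set ?_
  rintro _ ⟨z, hz, rfl⟩
  have := trans_mem_overlap (hBo z hz)
  refine ⟨this.1, ?_⟩
  rw [mem_preimage, symm_trans (hBo z hz)]
  exact hz.2.1

omit [BorelSpace X] in
theorem chartVolume_le (x₀ : X) : chartVolume g x₀ ≤ riemannianVolume g :=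
  le_iSup (fun x => chartVolume g x) x₀

/-- On the domain of a chart, the Riemannian volume is the volume of the chart. -/
theorem riemannianVolume_restrict (x₀ : X) :
    (riemannianVolume g).restrict (ch d x₀).source = chartVolume g x₀ := by
  set s := (ch d x₀).source
  have hs : MeasurableSet s := measurableSet_source x₀
  refine le_antisymm ?_ ?_
  -- Each chart measure splits over `s` and its complement. The first part is bounded by the measure
  -- of the chart at `x₀`, the second by a term that disappears on restriction to `s`. One-sided
  -- comparison of charts thus suffices for the supremum.
  · have h1 : riemannianVolume g ≤ chartVolume g x₀ + (riemannianVolume g).restrict sᶜ := by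
      refine iSup_le fun x => ?_
      rw [← Measure.restrict_add_restrict_compl (μ := chartVolume g x) hs]
      exact add_le_add (chartVolume_restrict_le g x x₀)
        (Measure.restrict_mono le_rfl (chartVolume_le g x))
    refine (Measure.restrict_mono (s := s) le_rfl h1).trans ?_
    rw [Measure.restrict_add, Measure.restrict_restrict hs, inter_compl_self,
      Measure.restrict_empty, add_zero]
    exact Measure.restrict_le_self
  · rw [← chartVolume_restrict_self g x₀]
    exact Measure.restrict_mono le_rfl (chartVolume_le g x₀)

/-- The density is continuous, hence integrable over a closed ball inside the target of a chart. -/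
instance : IsLocallyFiniteMeasure (riemannianVolume g) where
  finiteAtNhds x := by
    have hx := mem_extChartAt_source (I := 𝓡 d) x
    obtain ⟨r, hr, hrs⟩ := Metric.nhds_basis_closedBall.mem_iff.1
      ((isOpen_extChartAt_target (I := 𝓡 d) x).mem_nhds (mem_extChartAt_target x))
    set U := (ch d x).source ∩ ch d x ⁻¹' (Metric.ball (ch d x x) r)
    have hU : IsOpen U := (continuousOn_extChartAt x).isOpen_inter_preimage
      (isOpen_extChartAt_source x) Metric.isOpen_ball
    refine ⟨U, hU.mem_nhds ⟨hx, Metric.mem_ball_self hr⟩, ?_⟩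
    have h1 : riemannianVolume g U = chartVolume g x U := by
      rw [← riemannianVolume_restrict g x, Measure.restrict_apply hU.measurableSet,
        inter_eq_left.2 inter_subset_left]
    rw [h1, chartVolume_apply g x hU.measurableSet]
    have hi : IntegrableOn (dens g x) (Metric.closedBall (ch d x x) r) :=
      ((continuousOn_dens g x).mono hrs).integrableOn_compact (isCompact_closedBall _ _)
    refine (lintegral_mono_set (t := Metric.closedBall (ch d x x) r) ?_).trans_lt
      hi.integrable.lintegral_lt_top
    rintro z ⟨h1, h2, h3⟩
    rw [mem_preimage, (ch d x).right_inv h1] at h3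
    exact Metric.ball_subset_closedBall h3

/-- The density is positive, so a null open set would have an image of Lebesgue measure zero in a
chart, although that image is open and nonempty. This serves the last step of the Euler–Lagrange
equation. -/
instance : (riemannianVolume g).IsOpenPosMeasure where
  open_pos U hU hne := by
    obtain ⟨x, hx⟩ := hne
    intro h0
    have h1 : chartVolume g x U = 0 := le_antisymm ((chartVolume_le g x U).trans h0.le) bot_le
    have hm := measurableSet_inter_preimage (d := d) x hU.measurableSet
    rw [chartVolume_apply g x hU.measurableSet, lintegral_eq_zero_iff' ?_] at h1
    · rw [Filter.EventuallyEq, ae_restrict_iff' hm] at h1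
      have hV : IsOpen ((ch d x).target ∩ (ch d x).symm ⁻¹' U) :=
        (continuousOn_extChartAt_symm x).isOpen_inter_preimage (isOpen_extChartAt_target x) hU
      have h2 : volume ((ch d x).target ∩ (ch d x).symm ⁻¹' U) = 0 := by
        refine measure_mono_null ?_ (ae_iff.1 h1)
        intro z hz hz'
        have := hz' hz
        simp only [Pi.zero_apply, ENNReal.ofReal_eq_zero] at this
        exact absurd (dens_pos g hz.1) (not_lt.2 this)
      refine hV.measure_ne_zero volume ⟨ch d x x, mem_extChartAt_target x, ?_⟩ h2
      rw [mem_preimage, (ch d x).left_inv (mem_extChartAt_source x)]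
      exact hx
    · exact (aemeasurable_dens g x).mono_measure (Measure.restrict_mono inter_subset_left le_rfl)

/-- Integration in a chart. -/
theorem integral_eq_chart (x₀ : X) {f : X → ℝ} (hf : ∀ x ∉ (ch d x₀).source, f x = 0)
    (hm : AEStronglyMeasurable f (riemannianVolume g)) :
    ∫ x, f x ∂(riemannianVolume g) =
      ∫ z in (ch d x₀).target, dens g x₀ z * f ((ch d x₀).symm z) := by
  rw [← setIntegral_eq_integral_of_forall_compl_eq_zero hf, riemannianVolume_restrict,
    chartVolume_eq, integral_map (aemeasurable_symm g x₀)]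
  · rw [densMeasure, integral_withDensity_eq_integral_toReal_smul₀ (aemeasurable_dens g x₀)
      (by simp)]
    refine setIntegral_congr_fun (measurableSet_target x₀) fun z hz => ?_
    simp only [smul_eq_mul]
    rw [ENNReal.toReal_ofReal (dens_pos g hz).le]
  · rw [← chartVolume_eq, ← riemannianVolume_restrict]
    exact hm.mono_measure Measure.restrict_le_self

end

/-! ### The divergence theorem on the manifold. -/

section
variable {d : ℕ}

theorem continuous_of_continuousAt_support {X F : Type*} [TopologicalSpace X] [TopologicalSpace F]
    [Zero F] {f : X → F} {K : Set X} (hK : IsClosed K) (hf : ∀ x ∈ K, ContinuousAt f x)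
    (h0 : ∀ x ∉ K, f x = 0) : Continuous f := by
  rw [continuous_iff_continuousAt]
  intro x
  by_cases hx : x ∈ K
  · exact hf x hx
  · refine (continuousAt_const (y := (0 : F))).congr ?_
    filter_upwards [hK.isOpen_compl.mem_nhds hx] with y hy
    exact (h0 y hy).symm

theorem integrable_of_continuousAt_support {X : Type*} [TopologicalSpace X] [T2Space X]
    [MeasurableSpace X] [BorelSpace X] {μ : Measure X} [IsFiniteMeasureOnCompacts μ]
    {f : X → ℝ} {K : Set X} (hK : IsCompact K) (hf : ∀ x ∈ K, ContinuousAt f x)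
    (h0 : ∀ x ∉ K, f x = 0) : Integrable f μ :=
  (continuous_of_continuousAt_support hK.isClosed hf h0).integrable_of_hasCompactSupport
    (HasCompactSupport.intro hK h0)

theorem IsMetricOn.continuousAt_divForm {𝒢 : Euc d → Form d} {U : Set (Euc d)} {z : Euc d}
    (hG : IsMetricOn 𝒢 U) (hz : z ∈ U) {θ : Euc d → Euc d →L[ℝ] ℝ} (hθ : ContDiffAt ℝ 1 θ z) :
    ContinuousAt (divForm 𝒢 θ) z := by
  have h1 : ContinuousAt (fderiv ℝ θ) z := ContDiffAt.continuousAt_fderiv hθ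
  have h2 : ContinuousAt (chr 𝒢) z := (hG.contDiffAt_chr hz).continuousAt
  unfold divForm formTrace
  refine tendsto_finsetSum _ fun i _ => tendsto_finsetSum _ fun j _ => ?_
  refine ((hG.contDiffAt_ginv hz i j).continuousAt).smul ?_
  exact ((h1.clm_apply continuousAt_const).clm_apply continuousAt_const).sub
    (hθ.continuousAt.clm_apply ((h2.clm_apply continuousAt_const).clm_apply continuousAt_const))

variable {X : Type*} [TopologicalSpace X] [ChartedSpace (EuclideanSpace ℝ (Fin d)) X]

/-- The differential of a real function, in the preferred chart. -/
def dReal (d : ℕ) {X : Type*} [TopologicalSpace X] [ChartedSpace (EuclideanSpace ℝ (Fin d)) X]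
    (η : X → ℝ) (x : X) : Euc d →L[ℝ] ℝ :=
  fderiv ℝ (fun z => η ((ch d x).symm z)) (ch d x x)

theorem contDiffAt_comp_symm {k : WithTop ℕ∞} [IsManifold (𝓡 d) k X] {η : X → ℝ} {x₀ x : X}
    (hx : x ∈ (ch d x₀).source)
    (hη : ContMDiffAt (𝓡 d) 𝓘(ℝ, ℝ) k η x) :
    ContDiffAt ℝ k (fun z => η ((ch d x₀).symm z)) (ch d x₀ x) := by
  rw [extChartAt_source] at hx
  have := ((contMDiffAt_iff_of_mem_source (y := η x) hx (by simp)).1 hη).2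
  rw [modelWithCornersSelf_coe, range_id, contDiffWithinAt_univ] at this
  exact this

variable [IsManifold (𝓡 d) ∞ X]

theorem dReal_coordL {η : X → ℝ} {x₀ x : X} (hx : x ∈ (ch d x₀).source)
    (hη : ContMDiffAt (𝓡 d) 𝓘(ℝ, ℝ) ∞ η x) (w : Euc d) :
    dReal d η x (coordL d x₀ x w) = fderiv ℝ (fun z => η ((ch d x₀).symm z)) (ch d x₀ x) w := by
  have hxx := mem_extChartAt_source (I := 𝓡 d) x
  have ho := mem_overlap hx hxx
  have h1 := fderiv_comp_eq (X' := fun z => η ((ch d x).symm z))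
    (X := fun z => η ((ch d x₀).symm z)) (contDiffAt_trans ho)
    (contDiffAt_trans (trans_mem_overlap ho)) (trans_trans ho)
    (by
      filter_upwards [(isOpen_overlap x x₀).mem_nhds (trans_mem_overlap ho)] with y h
      exact trans_trans h)
    ((contDiffAt_comp_symm hx hη).differentiableAt (by simp))
    (by
      filter_upwards [eventually_mem_overlap hx hxx] with z hz
      rw [symm_trans hz]) w
  rwa [trans_ch hx, ← coordL_eq hx] at h1

/-- A one-form in the chart at `x₀`. -/
def chartForm (θ : X → Euc d →L[ℝ] ℝ) (x₀ : X) (z : Euc d) : Euc d →L[ℝ] ℝ :=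
  θ ((ch d x₀).symm z) ∘L coordL d x₀ ((ch d x₀).symm z)

/-- The inner product of the differential of `η` with the one-form `θ`. -/
def pairing (g : Metric d X) (η : X → ℝ) (θ : X → Euc d →L[ℝ] ℝ) (x : X) : ℝ :=
  formTrace (innerForm g x) fun u w => dReal d η x u * θ x w

theorem pairing_eq (g : Metric d X) {η : X → ℝ} (θ : X → Euc d →L[ℝ] ℝ) {x₀ x : X}
    (hx : x ∈ (ch d x₀).source) (hη : ContMDiffAt (𝓡 d) 𝓘(ℝ, ℝ) ∞ η x) :
    pairing g η θ x = formTrace (metE g x₀ (ch d x₀ x)) fun u w =>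
      fderiv ℝ (fun z => η ((ch d x₀).symm z)) (ch d x₀ x) u *
        chartForm θ x₀ (ch d x₀ x) w := by
  let B : Euc d →ₗ[ℝ] Euc d →ₗ[ℝ] ℝ := LinearMap.mk₂ ℝ (fun u w => dReal d η x u * θ x w)
    (by intro a b c; rw [map_add, add_mul]) (by intro a b c; rw [map_smul, smul_mul_assoc])
    (by intro a b c; rw [map_add, mul_add]) (by intro a b c; rw [map_smul, mul_smul_comm])
  refine (trace_eq g hx B).trans (formTrace_congr _ fun i j => ?_)
  change dReal d η x (coordL d x₀ x (stdVec i)) * θ x (coordL d x₀ x (stdVec j)) = _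
  rw [dReal_coordL hx hη, chartForm, (ch d x₀).left_inv hx]
  rfl

omit [IsManifold (𝓡 d) ∞ X] in
theorem dReal_of_notMem_tsupport {η : X → ℝ} {x : X} (hx : x ∉ tsupport η) : dReal d η x = 0 := by
  have hxx := mem_extChartAt_source (I := 𝓡 d) x
  have h1 : (fun z => η ((ch d x).symm z)) =ᶠ[𝓝 (ch d x x)] fun _ => 0 := by
    filter_upwards [(tendsto_symm hxx).eventually
      ((isClosed_tsupport η).isOpen_compl.mem_nhds hx)] with z hz
    exact image_eq_zero_of_notMem_tsupport hz
  rw [dReal, h1.fderiv_eq, fderiv_fun_const]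
  rfl

variable [T2Space X] [MeasurableSpace X] [BorelSpace X] (g : Metric d X)

/-- The divergence theorem in the domain of a chart. -/
theorem integral_mul_divForm {x₀ : X} {η G : X → ℝ} {θ : X → Euc d →L[ℝ] ℝ}
    (hη : ContMDiff (𝓡 d) 𝓘(ℝ, ℝ) ∞ η) (hc : IsCompact (tsupport η))
    (hs : tsupport η ⊆ (ch d x₀).source)
    (hθ : ∀ x ∈ tsupport η, ContDiffAt ℝ 1 (chartForm θ x₀) (ch d x₀ x))
    (hG : ∀ x ∈ tsupport η, ∀ᶠ z in 𝓝 (ch d x₀ x), G ((ch d x₀).symm z) =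
      divForm (metE g x₀) (chartForm θ x₀) z) :
    ∫ x, η x * G x ∂(riemannianVolume g) = -∫ x, pairing g η θ x ∂(riemannianVolume g) ∧
      Integrable (fun x => η x * G x) (riemannianVolume g) ∧
      Integrable (pairing g η θ) (riemannianVolume g) := by
  set e := ch d x₀ with he
  set K : Set (Euc d) := e '' tsupport η with hK
  have hme := isMetricOn_metE g x₀
  have hKc : IsCompact K := hc.image_of_continuousOn ((continuousOn_extChartAt x₀).mono hs)
  have hKt : K ⊆ e.target := by
    rintro _ ⟨x, hx, rfl⟩
    exact e.map_source (hs hx)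
  have hKs : ∀ z ∈ e.target, e.symm z ∈ tsupport η → z ∈ K := fun z hz h =>
    ⟨e.symm z, h, e.right_inv hz⟩
  have hcont : ∀ x ∈ (ch d x₀).source, ContinuousAt (ch d x₀) x := fun x hx =>
    continuousAt_extChartAt' (by rwa [extChartAt_source] at hx ⊢)
  -- the cut-off function in the chart
  set a : Euc d → ℝ := e.target.indicator (fun z => η (e.symm z)) with ha
  have ha1 : ∀ z ∈ e.target, a =ᶠ[𝓝 z] fun z => η (e.symm z) := fun z hz => by
    filter_upwards [(isOpen_extChartAt_target x₀).mem_nhds hz] with y hy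
    exact indicator_of_mem hy _
  have ha0 : ∀ z ∉ K, a z = 0 := by
    intro z hz
    by_cases h : z ∈ e.target
    · rw [ha, indicator_of_mem h]
      exact image_eq_zero_of_notMem_tsupport fun h' => hz (hKs z h h')
    · exact indicator_of_notMem h _
  have ha2 : ∀ z ∈ K, ContDiffAt ℝ ∞ a z := by
    rintro _ ⟨x, hx, rfl⟩
    exact (contDiffAt_comp_symm (hs hx) hη.contMDiffAt).congr_of_eventuallyEq
      (ha1 _ (e.map_source (hs hx)))
  have ha0' : ∀ z ∉ K, a =ᶠ[𝓝 z] fun _ => 0 := fun z hz => by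
    filter_upwards [hKc.isClosed.isOpen_compl.mem_nhds hz] with y hy
    exact ha0 y hy
  have ha3 : ∀ z, DifferentiableAt ℝ a z := by
    intro z
    by_cases hz : z ∈ K
    · exact (ha2 z hz).differentiableAt (by simp)
    · exact (differentiableAt_const 0).congr_of_eventuallyEq (ha0' z hz)
  have hda0 : ∀ z ∉ K, fderiv ℝ a z = 0 := fun z hz => by
    rw [(ha0' z hz).fderiv_eq, fderiv_fun_const]; rfl
  set Θ := chartForm θ x₀ with hΘ
  -- The components `√g gⁱʲ θⱼ`, whose Euclidean divergence is `√g` times the divergence of `θ` by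
  -- `volDens_mul_divForm`.
  set b : Fin d → Euc d → ℝ := fun i y => dens g x₀ y * ∑ j, ginv (metE g x₀ y) i j *
    Θ y (stdVec j) with hb
  have hΘK : ∀ z ∈ K, ContDiffAt ℝ 1 Θ z := by
    rintro _ ⟨x, hx, rfl⟩
    exact hθ x hx
  have hGK : ∀ z ∈ K, ∀ᶠ y in 𝓝 z, G (e.symm y) = divForm (metE g x₀) Θ y := by
    rintro _ ⟨x, hx, rfl⟩
    exact hG x hx
  have hbK : ∀ i, ∀ z ∈ K, ContDiffAt ℝ 1 (b i) z := fun i z hz => by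
    refine ((hme.contDiffAt_volDens (hKt hz)).of_le (by simp)).mul
      (ContDiffAt.sum fun j _ => ?_)
    exact ((hme.contDiffAt_ginv (hKt hz) i j).of_le (by simp)).mul
      ((hΘK z hz).clm_apply contDiffAt_const)
  have hpair : ∀ x ∈ tsupport η, pairing g η θ x = formTrace (metE g x₀ (e x)) fun u w =>
      fderiv ℝ (fun z => η (e.symm z)) (e x) u * Θ (e x) w := fun x hx =>
    pairing_eq g θ (hs hx) hη.contMDiffAt
  have hpair0 : ∀ x ∉ tsupport η, pairing g η θ x = 0 := fun x hx => by
    simp [pairing, dReal_of_notMem_tsupport hx, formTrace]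
  have hηG0 : ∀ x ∉ tsupport η, η x * G x = 0 := fun x hx => by
    rw [image_eq_zero_of_notMem_tsupport hx, zero_mul]
  have hGc : ∀ x ∈ tsupport η, ContinuousAt G x := by
    intro x hx
    have h1 : ContinuousAt (divForm (metE g x₀) Θ ∘ e) x :=
      ContinuousAt.comp (hme.continuousAt_divForm (e.map_source (hs hx)) (hθ x hx)) (hcont x (hs hx))
    refine h1.congr ?_
    filter_upwards [(hcont x (hs hx)).tendsto.eventually (hG x hx),
      (isOpen_extChartAt_source x₀).mem_nhds (hs hx)] with y hy hy'
    rw [Function.comp_apply, ← hy, e.left_inv hy']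
  have i1 : Integrable (fun x => η x * G x) (riemannianVolume g) :=
    integrable_of_continuousAt_support hc
      (fun x hx => (hη.continuous.continuousAt).mul (hGc x hx)) hηG0
  have i2 : Integrable (pairing g η θ) (riemannianVolume g) := by
    refine integrable_of_continuousAt_support hc (fun x hx => ?_) hpair0
    have h1 : ContinuousAt ((fun z => formTrace (metE g x₀ z) fun u w =>
        fderiv ℝ (fun z => η (e.symm z)) z u * Θ z w) ∘ e) x := by
      refine ContinuousAt.comp ?_ (hcont x (hs hx))
      refine tendsto_finsetSum _ fun i _ => tendsto_finsetSum _ fun j _ => ?_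
      refine ((hme.contDiffAt_ginv (e.map_source (hs hx)) i j).continuousAt).smul ?_
      refine ContinuousAt.mul (ContinuousAt.clm_apply ?_ continuousAt_const)
        ((hθ x hx).continuousAt.clm_apply continuousAt_const)
      exact ContDiffAt.continuousAt_fderiv
        ((contDiffAt_comp_symm (hs hx) hη.contMDiffAt).of_le (by simp))
    refine h1.congr ?_
    filter_upwards [(isOpen_extChartAt_source x₀).mem_nhds (hs hx)] with y hy
    exact (pairing_eq g θ hy hη.contMDiffAt).symm
  refine ⟨?_, i1, i2⟩
  have hnot : ∀ x ∉ e.source, x ∉ tsupport η := fun x hx h => hx (hs h)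
  rw [integral_eq_chart g x₀ (fun x hx => hηG0 x (hnot x hx)) i1.aestronglyMeasurable,
    integral_eq_chart g x₀ (fun x hx => hpair0 x (hnot x hx)) i2.aestronglyMeasurable]
  have e1 : ∫ z in e.target, dens g x₀ z * (η (e.symm z) * G (e.symm z)) =
      ∫ z, ∑ i, a z * fderiv ℝ (b i) z (stdVec i) := by
    refine Eq.trans ?_ (setIntegral_eq_integral_of_forall_compl_eq_zero (s := e.target) ?_)
    · refine setIntegral_congr_fun (measurableSet_target x₀) fun z hz => ?_
      rw [← Finset.mul_sum]
      by_cases hzK : z ∈ K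
      · have h1 := hme.volDens_mul_divForm hz ((hΘK z hzK).differentiableAt (by simp))
        have h2 : a z = η (e.symm z) := (ha1 z hz).self_of_nhds
        change _ = a z * ∑ i, fderiv ℝ (b i) z (stdVec i)
        refine Eq.trans ?_ (congrArg (fun r => a z * r) h1)
        rw [h2, (hGK z hzK).self_of_nhds, dens]
        ring
      · have h2 : a z = η (e.symm z) := (ha1 z hz).self_of_nhds
        rw [← h2, ha0 z hzK]
        simp
    · intro z hz
      refine Finset.sum_eq_zero fun i _ => ?_
      rw [ha0 z fun h => hz (hKt h), zero_mul]
  have e2 : ∫ z in e.target, dens g x₀ z * pairing g η θ (e.symm z) =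
      ∫ z, ∑ i, fderiv ℝ a z (stdVec i) * b i z := by
    refine Eq.trans ?_ (setIntegral_eq_integral_of_forall_compl_eq_zero (s := e.target) ?_)
    · refine setIntegral_congr_fun (measurableSet_target x₀) fun z hz => ?_
      have h1 := pairing_eq g θ (e.map_target hz) hη.contMDiffAt
      rw [e.right_inv hz] at h1
      rw [h1, (ha1 z hz).fderiv_eq, formTrace, Finset.mul_sum]
      refine Finset.sum_congr rfl fun i _ => ?_
      rw [hb]
      simp only [Finset.mul_sum, smul_eq_mul]
      refine Finset.sum_congr rfl fun j _ => ?_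
      ring
    · intro z hz
      refine Finset.sum_eq_zero fun i _ => ?_
      rw [hda0 z fun h => hz (hKt h)]
      simp
  have hts : tsupport a ⊆ K := by
    refine closure_minimal (fun z hz => ?_) hKc.isClosed
    by_contra h
    exact hz (ha0 z h)
  have j1 : ∀ i, Integrable (fun z => a z * fderiv ℝ (b i) z (stdVec i)) := fun i =>
    integrable_of_continuousAt_support hKc
      (fun z hz => (ha3 z).continuousAt.mul
        ((ContDiffAt.continuousAt_fderiv (hbK i z hz)).clm_apply continuousAt_const))
      (fun z hz => by rw [ha0 z hz, zero_mul])
  have j2 : ∀ i, Integrable (fun z => fderiv ℝ a z (stdVec i) * b i z) := fun i =>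
    integrable_of_continuousAt_support hKc
      (fun z hz => ((ContDiffAt.continuousAt_fderiv ((ha2 z hz).of_le (by simp))).clm_apply
        continuousAt_const).mul (hbK i z hz).continuousAt)
      (fun z hz => by rw [hda0 z hz]; simp)
  have j3 : ∀ i, Integrable (fun z => a z * b i z) := fun i =>
    integrable_of_continuousAt_support hKc
      (fun z hz => (ha3 z).continuousAt.mul (hbK i z hz).continuousAt)
      (fun z hz => by rw [ha0 z hz, zero_mul])
  rw [e1, e2, integral_finsetSum _ fun i _ => j1 i, integral_finsetSum _ fun i _ => j2 i,
    ← Finset.sum_neg_distrib]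
  refine Finset.sum_congr rfl fun i _ => ?_
  -- Integration by parts in each coordinate direction; differentiability of `b i` is needed, and
  -- known, only on the support of the cut-off.
  exact integral_mul_fderiv_eq_neg_fderiv_mul_of_integrable (j2 i) (j1 i) (j3 i)
    (fun z _ => ha3 z) (fun z hz => (hbK i z (hts hz)).differentiableAt (by simp))

variable [SecondCountableTopology X]

/-- The divergence theorem for one-forms with compact support. -/
theorem integral_divForm_eq_zero {D : Set X} (hD : IsCompact D) {G : X → ℝ}
    {θ : X → Euc d →L[ℝ] ℝ} (hG0 : ∀ x ∉ D, G x = 0) (hθ0 : ∀ x ∉ D, θ x = 0)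
    (h : ∀ x ∈ D, ∀ᶠ z in 𝓝 (ch d x x), ContDiffAt ℝ 1 (chartForm θ x) z ∧
      G ((ch d x).symm z) = divForm (metE g x) (chartForm θ x) z) :
    ∫ x, G x ∂(riemannianVolume g) = 0 ∧ Continuous G := by
  have hlc : LocallyCompactSpace X := ChartedSpace.locallyCompactSpace (Euc d) X
  have hσ : SigmaCompactSpace X := sigmaCompactSpace_of_locallyCompact_secondCountable
  -- neighbourhoods where the local hypothesis holds
  have h' : ∀ x, ∀ᶠ z in 𝓝 (ch d x x), ContDiffAt ℝ 1 (chartForm θ x) z ∧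
      G ((ch d x).symm z) = divForm (metE g x) (chartForm θ x) z := by
    intro x
    -- Off the closed set `D` both `G` and `θ` vanish identically nearby, so the local hypothesis
    -- extends to the whole manifold.
    by_cases hx : x ∈ D
    · exact h x hx
    have h1 : ∀ᶠ z in 𝓝 (ch d x x), chartForm θ x z = 0 ∧ G ((ch d x).symm z) = 0 := by
      filter_upwards [(tendsto_symm (mem_extChartAt_source (I := 𝓡 d) x)).eventually
        (hD.isClosed.isOpen_compl.mem_nhds hx)] with z hz
      rw [chartForm, hθ0 _ hz]
      exact ⟨ContinuousLinearMap.zero_comp _, hG0 _ hz⟩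
    filter_upwards [h1.eventually_nhds] with z hz
    have h2 : chartForm θ x =ᶠ[𝓝 z] fun _ => 0 := hz.mono fun y hy => hy.1
    refine ⟨contDiffAt_const.congr_of_eventuallyEq h2, ?_⟩
    rw [hz.self_of_nhds.2, divForm, h2.fderiv_eq, h2.self_of_nhds]
    simp [formTrace]
  have hnb : ∀ x, ∃ K : Set X, IsCompact K ∧ K ∈ 𝓝 x ∧ ∀ y ∈ K, y ∈ (ch d x).source ∧
      ContDiffAt ℝ 1 (chartForm θ x) (ch d x y) ∧ ∀ᶠ z in 𝓝 (ch d x y),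
        G ((ch d x).symm z) = divForm (metE g x) (chartForm θ x) z := by
    intro x
    have h1 := (continuousAt_extChartAt (I := 𝓡 d) x).tendsto.eventually (h' x).eventually_nhds
    obtain ⟨K, hK, hKs, hKc⟩ := local_compact_nhds
      (Filter.inter_mem h1 ((isOpen_extChartAt_source x).mem_nhds
        (mem_extChartAt_source (I := 𝓡 d) x)))
    exact ⟨K, hKc, hK, fun y hy => ⟨(hKs hy).2, (hKs hy).1.self_of_nhds.1,
      (hKs hy).1.mono fun z hz => hz.2⟩⟩
  choose K hKc hKx hKp using hnb
  have hGcont : Continuous G := by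
    rw [continuous_iff_continuousAt]
    intro x
    have hx := hKp x x (mem_of_mem_nhds (hKx x))
    have h1 : ContinuousAt (divForm (metE g x) (chartForm θ x) ∘ ch d x) x :=
      ContinuousAt.comp ((isMetricOn_metE g x).continuousAt_divForm ((ch d x).map_source hx.1)
        hx.2.1) (continuousAt_extChartAt x)
    refine h1.congr ?_
    filter_upwards [(continuousAt_extChartAt (I := 𝓡 d) x).tendsto.eventually hx.2.2,
      (isOpen_extChartAt_source x).mem_nhds hx.1] with y hy hy'
    rw [Function.comp_apply, ← hy, (ch d x).left_inv hy']
  refine ⟨?_, hGcont⟩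
  -- The partition of unity is taken on a compact neighbourhood of `D`: its sum is then constant
  -- near every point of `D`, not only on `D`, and the differentials `dρᵢ` add up to zero there.
  obtain ⟨D', hD', hDD'⟩ := exists_compact_superset hD
  obtain ⟨ρ, hρ⟩ := SmoothPartitionOfUnity.exists_isSubordinate (𝓡 d) hD'.isClosed
    (fun x => interior (K x)) (fun x => isOpen_interior)
    (fun x _ => mem_iUnion.2 ⟨x, mem_interior_iff_mem_nhds.2 (hKx x)⟩)
  have hfin := ρ.locallyFinite.finite_nonempty_inter_compact hD'
  set S := hfin.toFinset with hS
  have hsum : ∀ x ∈ D', ∑ i ∈ S, ρ i x = 1 := by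
    intro x hx
    rw [← ρ.sum_eq_one hx, finsum_eq_sum_of_support_subset]
    intro i hi
    rw [hS, Finset.mem_coe, Set.Finite.mem_toFinset]
    exact ⟨x, hi, hx⟩
  have hsub : ∀ i, tsupport (ρ i) ⊆ K i := fun i => (hρ i).trans interior_subset
  have hmain := fun i => integral_mul_divForm g (x₀ := i) (η := ρ i) (G := G) (θ := θ)
    (ρ i).contMDiff ((hKc i).of_isClosed_subset (isClosed_tsupport _) (hsub i))
    (fun y hy => (hKp i y (hsub i hy)).1) (fun y hy => (hKp i y (hsub i hy)).2.1)
    (fun y hy => (hKp i y (hsub i hy)).2.2)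
  have e1 : ∀ x, G x = ∑ i ∈ S, ρ i x * G x := by
    intro x
    rw [← Finset.sum_mul]
    by_cases hx : x ∈ D
    · rw [hsum x (interior_subset (hDD' hx)), one_mul]
    · rw [hG0 x hx, mul_zero]
  -- The integrations by parts leave `-∑ ⟨dρᵢ, θ⟩`, which vanishes on `D` as `∑ dρᵢ = 0`, and
  -- elsewhere as `θ = 0`.
  have e2 : ∀ x, ∑ i ∈ S, pairing g (ρ i) θ x = 0 := by
    intro x
    by_cases hx : x ∈ D
    · have h1 : ∑ i ∈ S, dReal d (ρ i) x = 0 := by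
        have h2 : HasFDerivAt (fun z => ∑ i ∈ S, ρ i ((ch d x).symm z))
            (∑ i ∈ S, dReal d (ρ i) x) (ch d x x) :=
          HasFDerivAt.fun_sum fun i _ => ((contDiffAt_comp_symm (mem_extChartAt_source x)
            (ρ i).contMDiff.contMDiffAt).differentiableAt (by simp)).hasFDerivAt
        have h3 : (fun z => ∑ i ∈ S, ρ i ((ch d x).symm z)) =ᶠ[𝓝 (ch d x x)] fun _ => 1 := by
          filter_upwards [(tendsto_symm (mem_extChartAt_source (I := 𝓡 d) x)).eventually
            (mem_interior_iff_mem_nhds.1 (hDD' hx))] with z hz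
          exact hsum _ hz
        rw [← h2.fderiv, h3.fderiv_eq, fderiv_fun_const]
        rfl
      have h4 : ∑ i ∈ S, pairing g (ρ i) θ x = formTrace (innerForm g x) fun u w =>
          (∑ i ∈ S, dReal d (ρ i) x) u * θ x w := by
        simp only [pairing, formTrace, _root_.sum_apply, Finset.sum_mul, Finset.smul_sum]
        rw [Finset.sum_comm]
        refine Finset.sum_congr rfl fun i _ => ?_
        rw [Finset.sum_comm]
      rw [h4, h1]
      simp [formTrace]
    · refine Finset.sum_eq_zero fun i _ => ?_
      simp [pairing, hθ0 x hx, formTrace]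
  calc ∫ x, G x ∂(riemannianVolume g) = ∫ x, ∑ i ∈ S, ρ i x * G x ∂(riemannianVolume g) :=
        integral_congr_ae (Filter.Eventually.of_forall e1)
    _ = ∑ i ∈ S, -∫ x, pairing g (ρ i) θ x ∂(riemannianVolume g) := by
        rw [integral_finsetSum _ fun i _ => (hmain i).2.1]
        exact Finset.sum_congr rfl fun i _ => (hmain i).1
    _ = -∫ x, ∑ i ∈ S, pairing g (ρ i) θ x ∂(riemannianVolume g) := by
        rw [Finset.sum_neg_distrib, integral_finsetSum _ fun i _ => (hmain i).2.2]
    _ = 0 := by simp [e2]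

end

/-! ### The Hilbert–Schmidt product, covariant derivatives of one-forms, and time slices. -/

section
variable {m n : ℕ}

/-- The inner product of linear maps as a continuous bilinear form. -/
def hsForm (B : Form m) (C : Form n) :
    (Euc m →L[ℝ] Euc n) →L[ℝ] (Euc m →L[ℝ] Euc n) →L[ℝ] ℝ :=
  ∑ i, ∑ j, ginv B i j • C.bilinearComp (ContinuousLinearMap.apply ℝ (Euc n) (stdVec i))
    (ContinuousLinearMap.apply ℝ (Euc n) (stdVec j))

theorem hsForm_apply (B : Form m) (C : Form n) (S T : Euc m →L[ℝ] Euc n) :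
    hsForm B C S T = innE B C S T := by
  simp [hsForm, innE, formTrace]

theorem hsForm_symm {B : Form m} {C : Form n} (hB : IsInner B) (hC : IsInner C)
    (S T : Euc m →L[ℝ] Euc n) : hsForm B C S T = hsForm B C T S := by
  rw [hsForm_apply, hsForm_apply, innE, innE, hB.formTrace_swap]
  exact formTrace_congr B fun i j => hC.symm _ _

theorem hsForm_eq_sum {B : Form m} (hB : IsInner B) : ∃ A : Matrix (Fin m) (Fin m) ℝ,
    IsUnit A.det ∧ ∀ (C : Form n) (S : Euc m →L[ℝ] Euc n), hsForm B C S S =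
      ∑ k, C (S (∑ i, A k i • stdVec i)) (S (∑ i, A k i • stdVec i)) := by
  obtain ⟨A, hA, h⟩ := exists_formTrace_eq_sum hB
  refine ⟨A, hA, fun C S => ?_⟩
  rw [hsForm_apply]
  exact h (ContinuousLinearMap.toLinearMap₁₂ (C.bilinearComp S S))

theorem hsForm_nonneg {B : Form m} {C : Form n} (hB : IsInner B) (hC : IsInner C)
    (S : Euc m →L[ℝ] Euc n) : 0 ≤ hsForm B C S S := by
  obtain ⟨A, -, h⟩ := hsForm_eq_sum (n := n) hB
  rw [h]
  refine Finset.sum_nonneg fun k _ => ?_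
  by_cases h0 : S (∑ i, A k i • stdVec i) = 0
  · simp [h0]
  · exact (hC.pos _ h0).le

/-- As a sum of squares over a frame, the product vanishes only if `S` kills every vector of the
frame. The frame matrix is invertible, so `S` kills the standard basis as well. -/
theorem hsForm_pos {B : Form m} {C : Form n} (hB : IsInner B) (hC : IsInner C)
    {S : Euc m →L[ℝ] Euc n} (hS : S ≠ 0) : 0 < hsForm B C S S := by
  refine lt_of_le_of_ne (hsForm_nonneg hB hC S) fun h0 => hS ?_
  obtain ⟨A, hA, h⟩ := hsForm_eq_sum (n := n) hB
  rw [h] at h0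
  have h1 := (Finset.sum_eq_zero_iff_of_nonneg (fun k _ => by
    by_cases h0 : S (∑ i, A k i • stdVec i) = 0
    · simp [h0]
    · exact (hC.pos _ h0).le)).1 h0.symm
  have h2 : ∀ k, S (∑ i, A k i • stdVec i) = 0 := fun k => by
    by_contra h3
    exact (hC.pos _ h3).ne' (h1 k (Finset.mem_univ k))
  have h3 : ∀ l, S (stdVec l) = 0 := by
    intro l
    have h4 : (stdVec l : Euc m) = ∑ k, A⁻¹ l k • ∑ i, A k i • stdVec i := by
      simp only [Finset.smul_sum, smul_smul]
      rw [Finset.sum_comm]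
      simp only [← Finset.sum_smul, ← Matrix.mul_apply, Matrix.nonsing_inv_mul A hA,
        Matrix.one_apply]
      simp
    rw [h4, map_sum]
    exact Finset.sum_eq_zero fun k _ => by rw [map_smul, h2, smul_zero]
  ext1 u
  rw [← sum_smul_stdVec u]
  simp [h3]

section Weight

variable {P : Type*} [NormedAddCommGroup P] [NormedSpace ℝ P]

theorem contDiffAt_hsForm {k : WithTop ℕ∞} {G : P → Form m} {H : P → Form n} {a : P}
    (hG : ContDiffAt ℝ k G a) (hGi : IsInner (G a)) (hH : ContDiffAt ℝ k H a) :
    ContDiffAt ℝ k (fun b => hsForm (G b) (H b)) a := by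
  unfold hsForm
  refine ContDiffAt.sum fun i _ => ContDiffAt.sum fun j _ => (contDiffAt_ginv hG hGi i j).smul ?_
  have h1 : ContDiffAt ℝ k (fun b => (H b ∘L ContinuousLinearMap.apply ℝ (Euc n)
      (stdVec i : Euc m)).flip) a :=
    (ContinuousLinearMap.flipₗᵢ ℝ (Euc m →L[ℝ] Euc n) (Euc n) ℝ).contDiff.contDiffAt.comp a
      (hH.clm_comp contDiffAt_const)
  exact (ContinuousLinearMap.flipₗᵢ ℝ (Euc m →L[ℝ] Euc n) (Euc m →L[ℝ] Euc n)
    ℝ).contDiff.contDiffAt.comp a (h1.clm_comp (contDiffAt_const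
      (c := ContinuousLinearMap.apply ℝ (Euc n) (stdVec j : Euc m))))

/-- Makes the regularity results for `Q^s A` available for `|dφ|^{p-2} dφ`. -/
theorem isWeight_hsForm {G : P → Form m} {H : P → Form n} {A : P → Euc m →L[ℝ] Euc n} {a : P}
    (hG : ContDiffAt ℝ ∞ G a) (hGi : ∀ᶠ b in 𝓝 a, IsInner (G b)) (hH : ContDiffAt ℝ ∞ H a)
    (hHi : ∀ᶠ b in 𝓝 a, IsInner (H b)) (hA : ContDiffAt ℝ ∞ A a) :
    IsWeight (fun b => hsForm (G b) (H b)) A a where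
  smooth_form := contDiffAt_hsForm hG hGi.self_of_nhds hH
  smooth := hA
  symm := by
    filter_upwards [hGi, hHi] with b h1 h2 u w
    exact hsForm_symm h1 h2 u w
  pos _ hu := hsForm_pos hGi.self_of_nhds hHi.self_of_nhds hu

end Weight

section CovE

variable {P : Type*} [NormedAddCommGroup P] [NormedSpace ℝ P] {ℋ : Euc n → Form n}
  {f : P → Euc n} {a : P}

theorem covE_congr {X Y : P → Euc n} (h : X =ᶠ[𝓝 a] Y) (ξ : P) :
    covE ℋ f X a ξ = covE ℋ f Y a ξ := by
  rw [covE, covE, h.fderiv_eq, h.self_of_nhds]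

theorem covE_sub {X Y : P → Euc n} (hX : DifferentiableAt ℝ X a) (hY : DifferentiableAt ℝ Y a)
    (ξ : P) : covE ℋ f (fun b => X b - Y b) a ξ = covE ℋ f X a ξ - covE ℋ f Y a ξ := by
  simp only [covE]
  rw [fderiv_fun_sub hX hY, map_sub]
  simp only [_root_.sub_apply]
  abel

theorem covE_sum_smul {ι : Type*} (s : Finset ι) (c : ι → ℝ) {X : ι → P → Euc n}
    (hX : ∀ i ∈ s, DifferentiableAt ℝ (X i) a) (ξ : P) :
    covE ℋ f (fun b => ∑ i ∈ s, c i • X i b) a ξ = ∑ i ∈ s, c i • covE ℋ f (X i) a ξ := by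
  simp only [covE]
  have h : HasFDerivAt (fun b => ∑ i ∈ s, c i • X i b) (∑ i ∈ s, c i • fderiv ℝ (X i) a) a :=
    HasFDerivAt.fun_sum fun i hi => (hX i hi).hasFDerivAt.const_smul (c i)
  rw [h.fderiv]
  simp [Finset.sum_add_distrib, smul_add]

/-- The covariant derivative of `V` along `f`, as a continuous linear map. -/
def covL (ℋ : Euc n → Form n) (f V : P → Euc n) (a : P) : P →L[ℝ] Euc n :=
  fderiv ℝ V a + (chr ℋ (f a)).flip (V a) ∘L fderiv ℝ f a

theorem covL_apply (V : P → Euc n) (ξ : P) : covL ℋ f V a ξ = covE ℋ f V a ξ := by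
  simp [covL, covE]

/-- The covariant derivative in direction `ξ` of a one-form with values in the pull-back bundle,
evaluated on constant vectors. -/
def covForm (ℋ : Euc n → Form n) (f : P → Euc n) (S : P → Euc m →L[ℝ] Euc n) (ξ a : P) :
    Euc m →L[ℝ] Euc n :=
  fderiv ℝ S a ξ + chr ℋ (f a) (fderiv ℝ f a ξ) ∘L S a

theorem covForm_apply {S : P → Euc m →L[ℝ] Euc n} (hS : DifferentiableAt ℝ S a) (ξ : P)
    (w : Euc m) : covForm ℋ f S ξ a w = covE ℋ f (fun b => S b w) a ξ := by
  rw [covE, (hS.hasFDerivAt.clm_apply (hasFDerivAt_const w a)).fderiv]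
  simp [covForm]

variable {V : Set (Euc n)} (hH : IsMetricOn ℋ V) (ha : f a ∈ V) (hf : ContDiffAt ℝ ∞ f a)
include hH ha hf

theorem contDiffAt_covForm {S : P → Euc m →L[ℝ] Euc n} {k l : WithTop ℕ∞} (hl : l ≤ ∞)
    (hk : l + 1 ≤ k) (hS : ContDiffAt ℝ k S a) (ξ : P) :
    ContDiffAt ℝ l (covForm ℋ f S ξ) a := by
  have h1 : ContDiffAt ℝ l (fun b => fderiv ℝ S b ξ) a :=
    (hS.fderiv_right hk).clm_apply contDiffAt_const
  have h2 : ContDiffAt ℝ l (fun b => chr ℋ (f b)) a :=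
    ((hH.contDiffAt_chr ha).comp a hf).of_le hl
  have h3 : ContDiffAt ℝ l (fun b => fderiv ℝ f b ξ) a :=
    ((hf.fderiv_right (m := ∞) (by simp)).clm_apply contDiffAt_const).of_le hl
  exact h1.add ((h2.clm_apply h3).clm_comp (hS.of_le (le_self_add.trans hk)))

theorem contDiffAt_covL {X : P → Euc n} {k l : WithTop ℕ∞} (hl : l ≤ ∞)
    (hk : l + 1 ≤ k) (hX : ContDiffAt ℝ k X a) :
    ContDiffAt ℝ l (covL ℋ f X) a := by
  have h2 : ContDiffAt ℝ l (fun b => chr ℋ (f b)) a :=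
    ((hH.contDiffAt_chr ha).comp a hf).of_le hl
  have h3 : ContDiffAt ℝ l (fun b => (chr ℋ (f b)).flip) a :=
    (ContinuousLinearMap.flipₗᵢ ℝ (Euc n) (Euc n) (Euc n)).contDiff.contDiffAt.comp a h2
  exact (hX.fderiv_right hk).add ((h3.clm_apply (hX.of_le (le_self_add.trans hk))).clm_comp
    ((hf.fderiv_right (m := ∞) (by simp)).of_le hl))

end CovE

section Time

/-- The time direction. -/
def timeDir (m : ℕ) : ℝ × Euc m := (1, 0)

theorem hasFDerivAt_slice (t : ℝ) (z : Euc m) :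
    HasFDerivAt (fun y : Euc m => ((t, y) : ℝ × Euc m)) (ContinuousLinearMap.inr ℝ ℝ (Euc m)) z :=
  hasFDerivAt_prodMk_right t z

theorem contDiff_slice (t : ℝ) : ContDiff ℝ ∞ (fun y : Euc m => ((t, y) : ℝ × Euc m)) :=
  contDiff_prodMk_right t

theorem fderiv_slice {F : Type*} [NormedAddCommGroup F] [NormedSpace ℝ F] {Y : ℝ × Euc m → F}
    {t : ℝ} {z : Euc m} (hY : DifferentiableAt ℝ Y (t, z)) :
    fderiv ℝ (fun y => Y (t, y)) z = fderiv ℝ Y (t, z) ∘L ContinuousLinearMap.inr ℝ ℝ (Euc m) :=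
  (hY.hasFDerivAt.comp z (hasFDerivAt_slice t z)).fderiv

theorem hasDerivAt_time {F : Type*} [NormedAddCommGroup F] [NormedSpace ℝ F] {Y : ℝ × Euc m → F}
    {t : ℝ} {z : Euc m} (hY : DifferentiableAt ℝ Y (t, z)) :
    HasDerivAt (fun s => Y (s, z)) (fderiv ℝ Y (t, z) (timeDir m)) t :=
  hY.hasFDerivAt.comp_hasDerivAt t ((hasDerivAt_id t).prodMk (hasDerivAt_const t z))

/-- The metric of the domain does not depend on time. This lets its coefficients be frozen at `z`
before a time derivative is taken. -/
theorem fderiv_time_congr {F : Type*} [NormedAddCommGroup F] [NormedSpace ℝ F]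
    {Y Y' : ℝ × Euc m → F} {t : ℝ} {z : Euc m} (hY : DifferentiableAt ℝ Y (t, z))
    (hY' : DifferentiableAt ℝ Y' (t, z)) (h : ∀ s, Y (s, z) = Y' (s, z)) :
    fderiv ℝ Y (t, z) (timeDir m) = fderiv ℝ Y' (t, z) (timeDir m) := by
  have h1 := hasDerivAt_time hY
  rw [show (fun s => Y (s, z)) = fun s => Y' (s, z) from funext h] at h1
  exact h1.unique (hasDerivAt_time hY')

/-- The spatial derivative. -/
def spat (f : ℝ × Euc m → Euc n) (a : ℝ × Euc m) : Euc m →L[ℝ] Euc n :=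
  fderiv ℝ f a ∘L ContinuousLinearMap.inr ℝ ℝ (Euc m)

theorem spat_apply (f : ℝ × Euc m → Euc n) (a : ℝ × Euc m) (w : Euc m) :
    spat f a w = fderiv ℝ f a (0, w) := rfl

theorem contDiffAt_spat {f : ℝ × Euc m → Euc n} {a : ℝ × Euc m} (hf : ContDiffAt ℝ ∞ f a) :
    ContDiffAt ℝ ∞ (spat f) a :=
  (hf.fderiv_right (m := ∞) (by simp)).clm_comp contDiffAt_const

theorem covE_slice {ℋ : Euc n → Form n} {f X : ℝ × Euc m → Euc n} {t : ℝ} {z : Euc m}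
    (hf : DifferentiableAt ℝ f (t, z)) (hX : DifferentiableAt ℝ X (t, z)) (u : Euc m) :
    covE ℋ (fun y => f (t, y)) (fun y => X (t, y)) z u = covE ℋ f X (t, z) (0, u) := by
  rw [covE, covE, fderiv_slice hf, fderiv_slice hX]
  rfl

/-- The divergence on the slices `t = const`. -/
def divP (𝒢 : Euc m → Form m) (ℋ : Euc n → Form n) (f : ℝ × Euc m → Euc n)
    (S : ℝ × Euc m → Euc m →L[ℝ] Euc n) (a : ℝ × Euc m) : Euc n :=
  formTrace (𝒢 a.2) fun u w => covForm ℋ f S (0, u) a w - S a (chr 𝒢 a.2 u w)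

theorem divP_eq_divE {𝒢 : Euc m → Form m} {ℋ : Euc n → Form n} {f : ℝ × Euc m → Euc n}
    {S : ℝ × Euc m → Euc m →L[ℝ] Euc n} {t : ℝ} {z : Euc m}
    (hf : DifferentiableAt ℝ f (t, z)) (hS : DifferentiableAt ℝ S (t, z)) :
    divP 𝒢 ℋ f S (t, z) = divE 𝒢 ℋ (fun y => f (t, y)) (fun y => S (t, y)) z := by
  rw [divP, divE]
  refine formTrace_congr _ fun i j => ?_
  rw [covForm_apply hS, covE_slice hf (hS.clm_apply (differentiableAt_const _))]

end Time

end

/-! ### Time derivatives of `|df|^{2s} df` and of its divergence. -/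

section
variable {m n : ℕ}

/-- The derivative of `A ↦ |A|^{2s} A` in direction `X`. -/
def linMap (B : Form m) (C : Form n) (s : ℝ) (A X : Euc m →L[ℝ] Euc n) : Euc m →L[ℝ] Euc n :=
  hsForm B C A A ^ s • X + (2 * s * (hsForm B C A A ^ (s - 1) * hsForm B C X A)) • A

/-- Self-adjointness of the linearisation, the source of the Green identity: besides the multiple
`Q^s ⟨X, Y⟩` there is only a multiple of `⟨X, A⟩ ⟨Y, A⟩`. Away from zero `linMap` is the Hessian of
`|A|^{2s+2} / (2s+2)`. -/
theorem hsForm_linMap {B : Form m} {C : Form n} (hB : IsInner B) (hC : IsInner C) (s : ℝ)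
    (A X Y : Euc m →L[ℝ] Euc n) :
    hsForm B C Y (linMap B C s A X) = hsForm B C X (linMap B C s A Y) := by
  simp only [linMap, map_add, map_smul, smul_eq_mul]
  rw [hsForm_symm hB hC Y X]
  ring

section Slices

variable {𝒢 : Euc m → Form m} {ℋ : Euc n → Form n} {U : Set (Euc m)} {V : Set (Euc n)}
  {f : ℝ × Euc m → Euc n} {t : ℝ} {z : Euc m}

/-- The square of the norm of the spatial derivative. -/
def normSq (𝒢 : Euc m → Form m) (ℋ : Euc n → Form n) (f : ℝ × Euc m → Euc n)
    (a : ℝ × Euc m) : ℝ := hsForm (𝒢 a.2) (ℋ (f a)) (spat f a) (spat f a)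

/-- The one-form `|df|^{2s} df`. -/
def pForm (𝒢 : Euc m → Form m) (ℋ : Euc n → Form n) (f : ℝ × Euc m → Euc n) (s : ℝ)
    (a : ℝ × Euc m) : Euc m →L[ℝ] Euc n := normSq 𝒢 ℋ f a ^ s • spat f a

variable (hG : IsMetricOn 𝒢 U) (hH : IsMetricOn ℋ V) (hz : z ∈ U) (hfV : f (t, z) ∈ V)
  (hf : ContDiffAt ℝ ∞ f (t, z))

include hG hz in
theorem contDiffAt_metric_snd : ContDiffAt ℝ ∞ (fun a : ℝ × Euc m => 𝒢 a.2) (t, z) :=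
  ContDiffAt.comp (t, z) (f := Prod.snd) (hG.contDiffAt hz) contDiffAt_snd

include hH hfV hf in
theorem contDiffAt_metric_comp : ContDiffAt ℝ ∞ (fun a => ℋ (f a)) (t, z) :=
  (hH.contDiffAt hfV).comp _ hf

include hG hz in
theorem eventually_isInner_snd : ∀ᶠ a : ℝ × Euc m in 𝓝 (t, z), IsInner (𝒢 a.2) := by
  filter_upwards [(continuous_snd.tendsto (t, z)).eventually (hG.isOpen.mem_nhds hz)] with a ha
  exact hG.inner _ ha

include hH hfV hf in
theorem eventually_isInner_comp : ∀ᶠ a in 𝓝 (t, z), IsInner (ℋ (f a)) := by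
  filter_upwards [hf.continuousAt.tendsto.eventually (hH.isOpen.mem_nhds hfV)] with a ha
  exact hH.inner _ ha

include hG hH hz hfV hf

theorem isWeight_spat : IsWeight (fun a : ℝ × Euc m => hsForm (𝒢 a.2) (ℋ (f a))) (spat f) (t, z) :=
  isWeight_hsForm (contDiffAt_metric_snd hG hz) (eventually_isInner_snd hG hz)
    (contDiffAt_metric_comp hH hfV hf) (eventually_isInner_comp hH hfV hf) (contDiffAt_spat hf)

theorem contDiffAt_normSq : ContDiffAt ℝ ∞ (normSq 𝒢 ℋ f) (t, z) :=
  (isWeight_spat hG hH hz hfV hf).contDiffAt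

theorem fderiv_normSq_time : fderiv ℝ (normSq 𝒢 ℋ f) (t, z) (timeDir m) =
    2 * hsForm (𝒢 z) (ℋ (f (t, z))) (covForm ℋ f (spat f) (timeDir m) (t, z)) (spat f (t, z)) := by
  have hA : DifferentiableAt ℝ (spat f) (t, z) := (contDiffAt_spat hf).differentiableAt (by simp)
  have hfd := hf.differentiableAt (by simp)
  have hY : ∀ i j, HasFDerivAt (fun b => ℋ (f b) (spat f b (stdVec i)) (spat f b (stdVec j)))
      (fderiv ℝ (fun b => ℋ (f b) (spat f b (stdVec i)) (spat f b (stdVec j))) (t, z)) (t, z) :=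
    fun i j => ((((hH.differentiableAt hfV).comp _ hfd).clm_apply
      (hA.clm_apply (differentiableAt_const _))).clm_apply
      (hA.clm_apply (differentiableAt_const _))).hasFDerivAt
  have h1 : HasFDerivAt (fun b => ∑ i, ∑ j, ginv (𝒢 z) i j •
      ℋ (f b) (spat f b (stdVec i)) (spat f b (stdVec j))) _ (t, z) :=
    HasFDerivAt.fun_sum (u := Finset.univ) fun i _ =>
      HasFDerivAt.fun_sum (u := Finset.univ) fun j _ => (hY i j).const_smul (ginv (𝒢 z) i j)
  rw [fderiv_time_congr ((contDiffAt_normSq hG hH hz hfV hf).differentiableAt (by simp))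
    h1.differentiableAt (fun s => hsForm_apply _ _ _ _), h1.fderiv]
  simp only [_root_.sum_apply, _root_.smul_apply]
  have h2 : ∀ i j, fderiv ℝ (fun b => ℋ (f b) (spat f b (stdVec i)) (spat f b (stdVec j))) (t, z)
      (timeDir m) =
      ℋ (f (t, z)) (covForm ℋ f (spat f) (timeDir m) (t, z) (stdVec i)) (spat f (t, z) (stdVec j)) +
      ℋ (f (t, z)) (spat f (t, z) (stdVec i))
        (covForm ℋ f (spat f) (timeDir m) (t, z) (stdVec j)) := by
    intro i j
    rw [covForm_apply hA, covForm_apply hA]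
    exact hH.hasFDerivAt_inner hfV hfd (hA.clm_apply (differentiableAt_const _))
      (hA.clm_apply (differentiableAt_const _)) (timeDir m)
  simp only [h2]
  rw [two_mul]
  conv_rhs => enter [2]; rw [hsForm_symm (hG.inner z hz) (hH.inner _ hfV)]
  rw [hsForm_apply, hsForm_apply, innE, innE, ← formTrace_add]
  rfl

-- The connection is torsion-free, so the time derivative of `df` is the spatial covariant
-- derivative of the velocity.
omit hG hz in
theorem covForm_spat (w : Euc m) : covForm ℋ f (spat f) (timeDir m) (t, z) w =
    covE ℋ f (fun b => fderiv ℝ f b (timeDir m)) (t, z) (0, w) := by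
  rw [covForm_apply ((contDiffAt_spat hf).differentiableAt (by simp))]
  exact hH.covE_fderiv_comm hfV hf (timeDir m) (0, w)

/-- The derivative of `|df|^{2s} df` in the time direction. -/
theorem covForm_pForm {s : ℝ} (h : HasFDerivAt (pForm 𝒢 ℋ f s)
      (normSq 𝒢 ℋ f (t, z) ^ s • fderiv ℝ (spat f) (t, z) + (s * normSq 𝒢 ℋ f (t, z) ^ (s - 1)) •
        (fderiv ℝ (normSq 𝒢 ℋ f) (t, z)).smulRight (spat f (t, z))) (t, z)) :
    covForm ℋ f (pForm 𝒢 ℋ f s) (timeDir m) (t, z) =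
      linMap (𝒢 z) (ℋ (f (t, z))) s (spat f (t, z)) (covForm ℋ f (spat f) (timeDir m) (t, z)) := by
  have h1 := fderiv_normSq_time hG hH hz hfV hf
  rw [covForm, h.fderiv]
  simp only [_root_.add_apply, _root_.smul_apply, ContinuousLinearMap.smulRight_apply, h1]
  have h2 : normSq 𝒢 ℋ f (t, z) = hsForm (𝒢 z) (ℋ (f (t, z))) (spat f (t, z)) (spat f (t, z)) := rfl
  ext1 w
  simp only [linMap, pForm, h2, _root_.add_apply, _root_.smul_apply,
    ContinuousLinearMap.comp_apply, map_smul, covForm, smul_add, smul_smul]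
  rw [add_right_comm]
  congr 2
  ring

theorem contDiffAt_divP {S : ℝ × Euc m → Euc m →L[ℝ] Euc n} {k l : WithTop ℕ∞} (hl : l ≤ ∞)
    (hk : l + 1 ≤ k) (hS : ContDiffAt ℝ k S (t, z)) : ContDiffAt ℝ l (divP 𝒢 ℋ f S) (t, z) := by
  unfold divP formTrace
  have hg : ∀ i j, ContDiffAt ℝ l (fun a : ℝ × Euc m => ginv (𝒢 a.2) i j) (t, z) := fun i j =>
    ((hG.contDiffAt_ginv hz i j).comp (t, z) (f := Prod.snd) contDiffAt_snd).of_le hl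
  have hc : ContDiffAt ℝ l (fun a : ℝ × Euc m => chr 𝒢 a.2) (t, z) :=
    ((hG.contDiffAt_chr hz).comp (t, z) (f := Prod.snd) contDiffAt_snd).of_le hl
  refine ContDiffAt.sum fun i _ => ContDiffAt.sum fun j _ => (hg i j).smul ?_
  refine ((contDiffAt_covForm hH hfV hf hl hk hS _).clm_apply contDiffAt_const).sub ?_
  exact (hS.of_le (le_self_add.trans hk)).clm_apply
    ((hc.clm_apply contDiffAt_const).clm_apply contDiffAt_const)

/-- The derivative of the divergence in the time direction. -/
theorem covE_divP {S : ℝ × Euc m → Euc m →L[ℝ] Euc n} (hS : ContDiffAt ℝ 2 S (t, z)) :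
    covE ℋ f (divP 𝒢 ℋ f S) (t, z) (timeDir m) =
      divP 𝒢 ℋ f (covForm ℋ f S (timeDir m)) (t, z) + formTrace (𝒢 z) fun u w =>
        curvE ℋ (f (t, z)) (fderiv ℝ f (t, z) (timeDir m)) (spat f (t, z) u) (S (t, z) w) := by
  have hS1 : ∀ᶠ a in 𝓝 (t, z), DifferentiableAt ℝ S a :=
    (ContDiffAt.eventually_one (hS.of_le (by norm_num))).mono
      fun a ha => ha.differentiableAt (by simp)
  have hT : ∀ ξ, ContDiffAt ℝ 1 (covForm ℋ f S ξ) (t, z) := fun ξ =>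
    contDiffAt_covForm hH hfV hf (k := 2) (by simp) (by norm_num) hS ξ
  have hTd : ∀ ξ, DifferentiableAt ℝ (covForm ℋ f S ξ) (t, z) := fun ξ =>
    (hT ξ).differentiableAt (by simp)
  have hdiff : ∀ i j, DifferentiableAt ℝ (fun b => covForm ℋ f S (0, stdVec i) b (stdVec j) -
      S b (chr 𝒢 z (stdVec i) (stdVec j))) (t, z) := fun i j =>
    ((hTd _).clm_apply (differentiableAt_const _)).sub
      (hS1.self_of_nhds.clm_apply (differentiableAt_const _))
  have hft : ∀ β : Euc m → Euc m → Euc n, formTrace (𝒢 z) β =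
      ∑ k : Fin m × Fin m, ginv (𝒢 z) k.1 k.2 • β (stdVec k.1) (stdVec k.2) := fun β =>
    (Fintype.sum_prod_type (fun k : Fin m × Fin m =>
      ginv (𝒢 z) k.1 k.2 • β (stdVec k.1) (stdVec k.2))).symm
  let Y : Fin m × Fin m → ℝ × Euc m → Euc n := fun k b =>
    covForm ℋ f S (0, stdVec k.1) b (stdVec k.2) - S b (chr 𝒢 z (stdVec k.1) (stdVec k.2))
  have hY : ∀ k ∈ Finset.univ, DifferentiableAt ℝ (Y k) (t, z) := fun k _ => hdiff k.1 k.2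
  -- freeze the coefficients
  have h1 : covE ℋ f (divP 𝒢 ℋ f S) (t, z) (timeDir m) =
      covE ℋ f (fun b => ∑ k, ginv (𝒢 z) k.1 k.2 • Y k b) (t, z) (timeDir m) := by
    have h2 : ∀ s, divP 𝒢 ℋ f S (s, z) = ∑ k, ginv (𝒢 z) k.1 k.2 • Y k (s, z) := fun s =>
      hft _
    have h3 : DifferentiableAt ℝ (fun b => ∑ k, ginv (𝒢 z) k.1 k.2 • Y k b) (t, z) :=
      DifferentiableAt.fun_sum fun k hk => (hY k hk).const_smul (ginv (𝒢 z) k.1 k.2)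
    rw [covE, covE, fderiv_time_congr ((contDiffAt_divP hG hH hz hfV hf (l := 1) (by simp) (k := 2)
      (by norm_num) hS).differentiableAt (by simp)) h3 h2, h2]
  rw [h1, covE_sum_smul _ (fun k : Fin m × Fin m => ginv (𝒢 z) k.1 k.2) hY, divP, ← formTrace_add,
    hft]
  refine Finset.sum_congr rfl fun k _ => ?_
  obtain ⟨i, j⟩ := k
  congr 1
  simp only [Y]
  rw [covE_sub ((hTd _).clm_apply (differentiableAt_const _))
    (hS1.self_of_nhds.clm_apply (differentiableAt_const _)),
    ← covForm_apply hS1.self_of_nhds (timeDir m)]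
  have h3 : (fun b => covForm ℋ f S (0, stdVec i) b (stdVec j)) =ᶠ[𝓝 (t, z)]
      fun b => covE ℋ f (fun b => S b (stdVec j)) b (0, stdVec i) := by
    filter_upwards [hS1] with b hb
    exact covForm_apply hb _ _
  have h4 : (fun b => covForm ℋ f S (timeDir m) b (stdVec j)) =ᶠ[𝓝 (t, z)]
      fun b => covE ℋ f (fun b => S b (stdVec j)) b (timeDir m) := by
    filter_upwards [hS1] with b hb
    exact covForm_apply hb _ _
  -- Moving the time derivative past the spatial covariant derivative produces the curvature term,
  -- the only difference from the divergence of the time derivative.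
  rw [covE_congr h3, hH.covE_commutator hfV hf (hS.clm_apply contDiffAt_const),
    covForm_apply (hTd _), covE_congr h4, spat_apply]
  abel

end Slices

section Pairing

variable {𝒢 : Euc m → Form m} {ℋ : Euc n → Form n} {U : Set (Euc m)} {V : Set (Euc n)}
  {f : Euc m → Euc n} {z : Euc m}

/-- The one-form `u ↦ ⟨X, T u⟩`. -/
def pairForm (ℋ : Euc n → Form n) (f X : Euc m → Euc n) (T : Euc m → Euc m →L[ℝ] Euc n)
    (z : Euc m) : Euc m →L[ℝ] ℝ := ℋ (f z) (X z) ∘L T z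

variable (hH : IsMetricOn ℋ V) (hfV : f z ∈ V) (hf : ContDiffAt ℝ ∞ f z)
include hH hfV hf

theorem contDiffAt_pairForm {X : Euc m → Euc n} {T : Euc m → Euc m →L[ℝ] Euc n}
    (hX : ContDiffAt ℝ 1 X z) (hT : ContDiffAt ℝ 1 T z) :
    ContDiffAt ℝ 1 (pairForm ℋ f X T) z :=
  ((((hH.contDiffAt hfV).comp z hf).of_le (by simp)).clm_apply hX).clm_comp hT

/-- The product rule for a metric connection. The Christoffel terms of the domain are the same in
both divergences. -/
theorem divForm_pairForm {X : Euc m → Euc n} {T : Euc m → Euc m →L[ℝ] Euc n}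
    (hX : DifferentiableAt ℝ X z) (hT : DifferentiableAt ℝ T z) :
    divForm 𝒢 (pairForm ℋ f X T) z = ℋ (f z) (X z) (divE 𝒢 ℋ f T z) +
      hsForm (𝒢 z) (ℋ (f z)) (covL ℋ f X z) (T z) := by
  have hfd := hf.differentiableAt (by simp)
  have hTw : ∀ w, DifferentiableAt ℝ (fun y => T y w) z := fun w =>
    hT.clm_apply (differentiableAt_const w)
  have hP : DifferentiableAt ℝ (pairForm ℋ f X T) z :=
    (((hH.differentiableAt hfV).comp z hfd).clm_apply hX).clm_comp hT
  rw [hsForm_apply, innE, divE, clm_formTrace, ← formTrace_add, divForm]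
  refine formTrace_congr _ fun i j => ?_
  have h1 : fderiv ℝ (pairForm ℋ f X T) z (stdVec i) (stdVec j) =
      fderiv ℝ (fun y => ℋ (f y) (X y) (T y (stdVec j))) z (stdVec i) := by
    have : HasFDerivAt (fun y => pairForm ℋ f X T y (stdVec j)) _ z :=
      hP.hasFDerivAt.clm_apply (hasFDerivAt_const (stdVec j) z)
    change _ = fderiv ℝ (fun y => pairForm ℋ f X T y (stdVec j)) z (stdVec i)
    rw [this.fderiv]
    simp
  rw [h1, hH.hasFDerivAt_inner hfV hfd hX (hTw _), map_sub, covL_apply, pairForm,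
    ContinuousLinearMap.comp_apply]
  ring

end Pairing

end

/-! ### The linearised operator, Green's identity, and the integrand of the first variation. -/

section
variable {m n : ℕ}

theorem divE_congr {𝒢 : Euc m → Form m} {ℋ : Euc n → Form n} {f : Euc m → Euc n}
    {S T : Euc m → Euc m →L[ℝ] Euc n} {z : Euc m} (h : S =ᶠ[𝓝 z] T) :
    divE 𝒢 ℋ f S z = divE 𝒢 ℋ f T z := by
  rw [divE, divE]
  refine formTrace_congr _ fun i j => ?_
  rw [h.self_of_nhds, covE_congr (h.mono fun y hy => by rw [hy])]

theorem divE_add_smul {𝒢 : Euc m → Form m} {ℋ : Euc n → Form n} {f : Euc m → Euc n}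
    {S T : Euc m → Euc m →L[ℝ] Euc n} {z : Euc m} (hS : DifferentiableAt ℝ S z)
    (hT : DifferentiableAt ℝ T z) (c : ℝ) :
    divE 𝒢 ℋ f (fun y => S y + c • T y) z = divE 𝒢 ℋ f S z + c • divE 𝒢 ℋ f T z := by
  rw [divE, divE, divE, ← formTrace_smul, ← formTrace_add]
  refine formTrace_congr _ fun i j => ?_
  have hX : HasFDerivAt (fun y => S y (stdVec j) + c • T y (stdVec j)) _ z :=
    (hS.hasFDerivAt.clm_apply (hasFDerivAt_const (stdVec j) z)).add
      ((hT.hasFDerivAt.clm_apply (hasFDerivAt_const (stdVec j) z)).const_smul c)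
  have hS' : HasFDerivAt (fun y => S y (stdVec j)) _ z :=
    hS.hasFDerivAt.clm_apply (hasFDerivAt_const (stdVec j) z)
  have hT' : HasFDerivAt (fun y => T y (stdVec j)) _ z :=
    hT.hasFDerivAt.clm_apply (hasFDerivAt_const (stdVec j) z)
  simp only [covE, _root_.add_apply, _root_.smul_apply]
  rw [hX.fderiv, hS'.fderiv, hT'.fderiv]
  simp only [_root_.add_apply, _root_.smul_apply, map_add, map_smul, smul_add, smul_sub]
  abel

theorem divForm_sub {𝒢 : Euc m → Form m} {θ θ' : Euc m → Euc m →L[ℝ] ℝ} {z : Euc m}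
    (h : DifferentiableAt ℝ θ z) (h' : DifferentiableAt ℝ θ' z) :
    divForm 𝒢 (fun y => θ y - θ' y) z = divForm 𝒢 θ z - divForm 𝒢 θ' z := by
  rw [divForm, divForm, divForm, ← formTrace_sub, fderiv_fun_sub h h']
  refine formTrace_congr _ fun i j => ?_
  simp only [_root_.sub_apply]
  ring

theorem curvE_smul_left (ℋ : Euc n → Form n) (y : Euc n) (c : ℝ) (u v w : Euc n) :
    curvE ℋ y (c • u) v w = c • curvE ℋ y u v w := by
  simp only [curvE, map_smul, _root_.smul_apply, smul_sub, smul_add]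

theorem curvE_swap (ℋ : Euc n → Form n) (y u v w : Euc n) :
    curvE ℋ y u v w = -curvE ℋ y v u w := by
  simp only [curvE]
  abel

section LinForm

variable {𝒢 : Euc m → Form m} {ℋ : Euc n → Form n} {U : Set (Euc m)} {V : Set (Euc n)}
  {f : Euc m → Euc n} {z : Euc m}

/-- The derivative of the one-form `|df|^{2s} df` when `f` moves in direction `X`. -/
def linForm (𝒢 : Euc m → Form m) (ℋ : Euc n → Form n) (f : Euc m → Euc n) (s : ℝ)
    (X : Euc m → Euc n) (y : Euc m) : Euc m →L[ℝ] Euc n :=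
  linMap (𝒢 y) (ℋ (f y)) s (fderiv ℝ f y) (covL ℋ f X y)

/-- The square of the norm of the derivative. -/
def fnormSq (𝒢 : Euc m → Form m) (ℋ : Euc n → Form n) (f : Euc m → Euc n) (y : Euc m) : ℝ :=
  hsForm (𝒢 y) (ℋ (f y)) (fderiv ℝ f y) (fderiv ℝ f y)

variable (hG : IsMetricOn 𝒢 U) (hH : IsMetricOn ℋ V) (hz : z ∈ U) (hfV : f z ∈ V)
  (hf : ContDiffAt ℝ ∞ f z)
include hG hH hz hfV hf

theorem isWeight_fderiv :
    IsWeight (fun y => hsForm (𝒢 y) (ℋ (f y))) (fderiv ℝ f) z := by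
  refine isWeight_hsForm (hG.contDiffAt hz) ?_ ((hH.contDiffAt hfV).comp z hf) ?_
    (hf.fderiv_right (by simp))
  · filter_upwards [hG.isOpen.mem_nhds hz] with y hy
    exact hG.inner y hy
  · filter_upwards [hf.continuousAt.tendsto.eventually (hH.isOpen.mem_nhds hfV)] with y hy
    exact hH.inner _ hy

variable {s : ℝ} (hs : 0 < fnormSq 𝒢 ℋ f z ∨ s = 0 ∨ 1 < 2 * s) {X : Euc m → Euc n}
  (hX : ContDiffAt ℝ 2 X z)
include hs hX

theorem contDiffAt_rpow_smul_covL :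
    ContDiffAt ℝ 1 (fun y => fnormSq 𝒢 ℋ f y ^ s • covL ℋ f X y) z :=
  ((isWeight_fderiv hG hH hz hfV hf).contDiffAt_rpow hs).smul
    (contDiffAt_covL hH hfV hf (k := 2) (by simp) (by norm_num) hX)

/-- The expression `⟨∇X, df⟩ df` is quadratic in `df`, which pays for the exponent `s - 1`. The
factor `s` lets the case `s = 0` be covered as well. -/
theorem contDiffAt_rpow_sub_one_smul_fderiv :
    ContDiffAt ℝ 1 (fun y => (s * fnormSq 𝒢 ℋ f y ^ (s - 1)) •
      (hsForm (𝒢 y) (ℋ (f y)) (covL ℋ f X y) (fderiv ℝ f y) • fderiv ℝ f y)) z := by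
  have hw := isWeight_fderiv hG hH hz hfV hf
  have hA : ContDiffAt ℝ 1 (fderiv ℝ f) z := hw.smooth.of_le (by simp)
  have hL : ContDiffAt ℝ 1 (fun y => hsForm (𝒢 y) (ℋ (f y)) (covL ℋ f X y)) z :=
    (hw.smooth_form.of_le (by simp)).clm_apply
      (contDiffAt_covL hH hfV hf (k := 2) (by simp) (by norm_num) hX)
  have hLA := hL.clm_apply hA
  obtain ⟨C₁, hC₁, h₁⟩ := exists_eventually_norm_le hL.continuousAt
  obtain ⟨C₂, hC₂, h₂⟩ := exists_eventually_norm_le (ContDiffAt.continuousAt_fderiv hA)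
  obtain ⟨C₃, hC₃, h₃⟩ := exists_eventually_norm_le (ContDiffAt.continuousAt_fderiv hLA)
  refine hw.contDiffAt_rpow_sub_one_smul (hLA.smul hA) (C' := C₁ + C₁ * C₂ + C₃) ?_ hs
  filter_upwards [h₁, h₂, h₃, ContDiffAt.eventually_one hA, ContDiffAt.eventually_one hLA]
    with y k₁ k₂ k₃ k₄ k₅
  have e₁ : ‖hsForm (𝒢 y) (ℋ (f y)) (covL ℋ f X y) (fderiv ℝ f y)‖ ≤ C₁ * ‖fderiv ℝ f y‖ :=
    (ContinuousLinearMap.le_opNorm _ _).trans (by gcongr)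
  constructor
  · rw [norm_smul]
    calc _ ≤ C₁ * ‖fderiv ℝ f y‖ * ‖fderiv ℝ f y‖ := by gcongr
      _ ≤ (C₁ + C₁ * C₂ + C₃) * ‖fderiv ℝ f y‖ * ‖fderiv ℝ f y‖ := by
        gcongr
        have := mul_pos hC₁ hC₂
        linarith
      _ = _ := by ring
  · have h6 : HasFDerivAt (fun y => hsForm (𝒢 y) (ℋ (f y)) (covL ℋ f X y) (fderiv ℝ f y) •
        fderiv ℝ f y) _ y := (k₅.differentiableAt (by simp)).hasFDerivAt.smul
      (k₄.differentiableAt (by simp)).hasFDerivAt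
    rw [h6.fderiv]
    refine (norm_add_le _ _).trans ?_
    rw [norm_smul, ContinuousLinearMap.norm_smulRight_apply]
    calc _ ≤ C₁ * ‖fderiv ℝ f y‖ * C₂ + C₃ * ‖fderiv ℝ f y‖ := by gcongr
      _ ≤ C₁ * ‖fderiv ℝ f y‖ + (C₁ * ‖fderiv ℝ f y‖ * C₂ + C₃ * ‖fderiv ℝ f y‖) :=
        le_add_of_nonneg_left (by positivity)
      _ = _ := by ring

theorem contDiffAt_linForm : ContDiffAt ℝ 1 (linForm 𝒢 ℋ f s X) z := by
  have h1 := (contDiffAt_rpow_smul_covL hG hH hz hfV hf hs hX).add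
    ((contDiffAt_rpow_sub_one_smul_fderiv hG hH hz hfV hf hs hX).const_smul (2 : ℝ))
  refine h1.congr_of_eventuallyEq (Filter.Eventually.of_forall fun y => ?_)
  simp only [linForm, linMap, fnormSq, smul_smul]
  congr 2
  ring

theorem differentiableAt_rpow_smul_fderiv (h0 : s ≠ 0) :
    DifferentiableAt ℝ (fun y => (fnormSq 𝒢 ℋ f y ^ (s - 1) *
      hsForm (𝒢 y) (ℋ (f y)) (covL ℋ f X y) (fderiv ℝ f y)) • fderiv ℝ f y) z := by
  refine (((contDiffAt_rpow_sub_one_smul_fderiv hG hH hz hfV hf hs hX).differentiableAt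
    (by simp)).const_smul s⁻¹).congr_of_eventuallyEq (Filter.Eventually.of_forall fun y => ?_)
  simp only [Pi.smul_apply, smul_smul]
  congr 1
  field_simp

/-- The divergence of `linForm`, term by term. -/
theorem divE_linForm : divE 𝒢 ℋ f (linForm 𝒢 ℋ f s X) z =
    divE 𝒢 ℋ f (fun y => fnormSq 𝒢 ℋ f y ^ s • covL ℋ f X y) z +
    (2 * s) • divE 𝒢 ℋ f (fun y => (fnormSq 𝒢 ℋ f y ^ (s - 1) *
      hsForm (𝒢 y) (ℋ (f y)) (covL ℋ f X y) (fderiv ℝ f y)) • fderiv ℝ f y) z := by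
  have h1 := (contDiffAt_rpow_smul_covL hG hH hz hfV hf hs hX).differentiableAt (by simp)
  -- For `s = 0` the second one-form need not be differentiable at zeros of `df`, but its
  -- coefficient `2 s` removes it.
  by_cases h0 : s = 0
  · rw [h0, mul_zero, zero_smul, add_zero]
    congr 1
    funext y
    simp [linForm, linMap, fnormSq]
  · have h2 := differentiableAt_rpow_smul_fderiv hG hH hz hfV hf hs hX h0
    rw [← divE_add_smul h1 h2]
    congr 1
    funext y
    simp only [linForm, linMap, fnormSq, smul_smul]

end LinForm

section Identity

variable {𝒢 : Euc m → Form m} {ℋ : Euc n → Form n} {U : Set (Euc m)} {V : Set (Euc n)}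
  {f : ℝ × Euc m → Euc n} {t : ℝ} {z : Euc m}

/-- The `p`-tension field, `p = 2 s + 2`. -/
def tension (𝒢 : Euc m → Form m) (ℋ : Euc n → Form n) (f : ℝ × Euc m → Euc n) (s : ℝ)
    (a : ℝ × Euc m) : Euc n := divP 𝒢 ℋ f (pForm 𝒢 ℋ f s) a

/-- The one-form `⟨W, T⟩ - ⟨v, T'⟩`, where `T` and `T'` are the derivatives of `|df|^{2s} df` in the
directions `v` and `W`. -/
def greenForm (𝒢 : Euc m → Form m) (ℋ : Euc n → Form n) (f : Euc m → Euc n) (s : ℝ)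
    (W v : Euc m → Euc n) (y : Euc m) : Euc m →L[ℝ] ℝ :=
  pairForm ℋ f W (linForm 𝒢 ℋ f s v) y - pairForm ℋ f v (linForm 𝒢 ℋ f s W) y

variable (hG : IsMetricOn 𝒢 U) (hH : IsMetricOn ℋ V) (hz : z ∈ U)

include hG hH hz in
theorem contDiffAt_greenForm {f : Euc m → Euc n} (hfV : f z ∈ V) (hf : ContDiffAt ℝ ∞ f z) {s : ℝ}
    (hs : 0 < fnormSq 𝒢 ℋ f z ∨ s = 0 ∨ 1 < 2 * s) {W v : Euc m → Euc n}
    (hW : ContDiffAt ℝ 2 W z) (hv : ContDiffAt ℝ 2 v z) :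
    ContDiffAt ℝ 1 (greenForm 𝒢 ℋ f s W v) z :=
  (contDiffAt_pairForm hH hfV hf (hW.of_le (by norm_num))
    (contDiffAt_linForm hG hH hz hfV hf hs hv)).sub
  (contDiffAt_pairForm hH hfV hf (hv.of_le (by norm_num))
    (contDiffAt_linForm hG hH hz hfV hf hs hW))

-- Expanding both pairings by the product rule, the terms `⟨∇W, T(∇v)⟩` and `⟨∇v, T(∇W)⟩` cancel by
-- self-adjointness of the linearisation.
include hG hH hz in
theorem divForm_greenForm {f : Euc m → Euc n} (hfV : f z ∈ V) (hf : ContDiffAt ℝ ∞ f z) {s : ℝ}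
    (hs : 0 < fnormSq 𝒢 ℋ f z ∨ s = 0 ∨ 1 < 2 * s) {W v : Euc m → Euc n}
    (hW : ContDiffAt ℝ 2 W z) (hv : ContDiffAt ℝ 2 v z) :
    divForm 𝒢 (greenForm 𝒢 ℋ f s W v) z =
      ℋ (f z) (W z) (divE 𝒢 ℋ f (linForm 𝒢 ℋ f s v) z) -
      ℋ (f z) (v z) (divE 𝒢 ℋ f (linForm 𝒢 ℋ f s W) z) := by
  have h1 := contDiffAt_linForm hG hH hz hfV hf hs hv
  have h2 := contDiffAt_linForm hG hH hz hfV hf hs hW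
  unfold greenForm
  rw [divForm_sub
    ((contDiffAt_pairForm hH hfV hf (hW.of_le (by norm_num)) h1).differentiableAt (by simp))
    ((contDiffAt_pairForm hH hfV hf (hv.of_le (by norm_num)) h2).differentiableAt (by simp)),
    divForm_pairForm hH hfV hf (hW.differentiableAt (by simp)) (h1.differentiableAt (by simp)),
    divForm_pairForm hH hfV hf (hv.differentiableAt (by simp)) (h2.differentiableAt (by simp)),
    linForm, linForm, hsForm_linMap (hG.inner z hz) (hH.inner _ hfV)]
  ring

variable (hfV : f (t, z) ∈ V) (hf : ContDiffAt ℝ ∞ f (t, z))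

theorem fderiv_slice_eventually {f : ℝ × Euc m → Euc n} {t : ℝ} {z : Euc m}
    (hf : ContDiffAt ℝ ∞ f (t, z)) :
    ∀ᶠ y in 𝓝 z, DifferentiableAt ℝ f (t, y) ∧ fderiv ℝ (fun y => f (t, y)) y = spat f (t, y) := by
  have h1 : ∀ᶠ a in 𝓝 (t, z), DifferentiableAt ℝ f a :=
    (ContDiffAt.eventually_one (hf.of_le (by simp))).mono
      fun a ha => ha.differentiableAt (by simp)
  filter_upwards [((contDiff_slice t).continuous.tendsto z).eventually h1] with y hy
  exact ⟨hy, fderiv_slice hy⟩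

include hG hH hz hfV hf

/-- The time derivative of `|df|^{2s} df` is the linearisation in the direction of the variation
field. -/
theorem covForm_pForm_eq_linForm (hfe : ∀ᶠ a in 𝓝 (t, z), ContDiffAt ℝ ∞ f a) {s : ℝ}
    (hs : 0 ≤ s) : ∀ᶠ y in 𝓝 z,
    covForm ℋ f (pForm 𝒢 ℋ f s) (timeDir m) (t, y) =
      linForm 𝒢 ℋ (fun y => f (t, y)) s (fun y => fderiv ℝ f (t, y) (timeDir m)) y := by
  have h1 := ((isWeight_spat hG hH hz hfV hf).contDiffAt_one_smul hs).2
  have hsl := (contDiff_slice (m := m) t).continuous.tendsto z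
  have h2 : ∀ᶠ a in 𝓝 (t, z), ContDiffAt ℝ 1 (fun b => fderiv ℝ f b (timeDir m)) a :=
    ContDiffAt.eventually_one
      (((hf.fderiv_right (m := ∞) (by simp)).of_le (by simp)).clm_apply contDiffAt_const)
  filter_upwards [hsl.eventually h1, hsl.eventually h2, fderiv_slice_eventually hf,
    hG.isOpen.mem_nhds hz, hsl.eventually (hf.continuousAt.tendsto.eventually
      (hH.isOpen.mem_nhds hfV)), hsl.eventually hfe] with y k1 k2 k3 k4 k5 hfy
  rw [covForm_pForm hG hH k4 k5 hfy k1, linForm, k3.2]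
  congr 1
  ext1 w
  rw [covForm_spat hH k5 hfy, covL_apply, covE_slice k3.1 (k2.differentiableAt (by simp))]

/-- The integrand of the first variation is a divergence. -/
theorem first_variation_identity (hfe : ∀ᶠ a in 𝓝 (t, z), ContDiffAt ℝ ∞ f a) {s : ℝ}
    (hs : 0 ≤ s)
    (hs' : 0 < normSq 𝒢 ℋ f (t, z) ∨ s = 0 ∨ 1 < 2 * s) {W : Euc m → Euc n}
    (hW : ContDiffAt ℝ 2 W z) :
    ℋ (f (t, z)) (W z) (covE ℋ f (tension 𝒢 ℋ f s) (t, z) (timeDir m)) +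
      ℋ (f (t, z)) (fderiv ℝ f (t, z) (timeDir m))
        (-(normSq 𝒢 ℋ f (t, z) ^ s • formTrace (𝒢 z) fun u w =>
            curvE ℋ (f (t, z)) (W z) (spat f (t, z) u) (spat f (t, z) w)) -
          divE 𝒢 ℋ (fun y => f (t, y)) (linForm 𝒢 ℋ (fun y => f (t, y)) s W) z) =
      divForm 𝒢 (greenForm 𝒢 ℋ (fun y => f (t, y)) s W
        (fun y => fderiv ℝ f (t, y) (timeDir m))) z := by
  have hf0 : ContDiffAt ℝ ∞ (fun y => f (t, y)) z := hf.comp z (contDiff_slice t).contDiffAt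
  have hv : ContDiffAt ℝ ∞ (fun b => fderiv ℝ f b (timeDir m)) (t, z) :=
    (hf.fderiv_right (m := ∞) (by simp)).clm_apply contDiffAt_const
  have hv0 : ContDiffAt ℝ 2 (fun y => fderiv ℝ f (t, y) (timeDir m)) z :=
    (hv.comp z (contDiff_slice t).contDiffAt).of_le
      ENat.LEInfty.out
  have hw := isWeight_spat hG hH hz hfV hf
  have hS : ContDiffAt ℝ 2 (pForm 𝒢 ℋ f s) (t, z) := hw.contDiffAt_two_smul hs hs'
  have hfs := (fderiv_slice_eventually hf).self_of_nhds
  have hnq : fnormSq 𝒢 ℋ (fun y => f (t, y)) z = normSq 𝒢 ℋ f (t, z) := by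
    rw [fnormSq, normSq, hfs.2]
  have hT : ContDiffAt ℝ 1 (covForm ℋ f (pForm 𝒢 ℋ f s) (timeDir m)) (t, z) :=
    contDiffAt_covForm hH hfV hf (k := 2) (by simp) (by norm_num) hS _
  rw [divForm_greenForm hG hH hz (f := fun y => f (t, y)) hfV hf0 (by rwa [hnq]) hW hv0,
    ← divE_congr (covForm_pForm_eq_linForm hG hH hz hfV hf hfe hs),
    ← divP_eq_divE hfs.1 (hT.differentiableAt (by simp))]
  unfold tension
  rw [covE_divP hG hH hz hfV hf hS]
  simp only [map_add, map_sub, map_neg]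
  -- The pair symmetry and the two skew symmetries of the curvature, with the two indices of the
  -- trace interchanged, exchange the roles of `W` and the velocity.
  have hcurv : ℋ (f (t, z)) (W z) (formTrace (𝒢 z) fun u w =>
        curvE ℋ (f (t, z)) (fderiv ℝ f (t, z) (timeDir m)) (spat f (t, z) u)
          (pForm 𝒢 ℋ f s (t, z) w)) =
      ℋ (f (t, z)) (fderiv ℝ f (t, z) (timeDir m)) (normSq 𝒢 ℋ f (t, z) ^ s •
        formTrace (𝒢 z) fun u w =>
          curvE ℋ (f (t, z)) (W z) (spat f (t, z) u) (spat f (t, z) w)) := by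
    rw [map_smul, clm_formTrace, clm_formTrace, ← formTrace_smul,
      ← (hG.inner z hz).formTrace_swap]
    refine formTrace_congr _ fun i j => ?_
    set v := fderiv ℝ f (t, z) (timeDir m)
    have e1 : curvE ℋ (f (t, z)) v (spat f (t, z) (stdVec j)) (pForm 𝒢 ℋ f s (t, z) (stdVec i)) =
        normSq 𝒢 ℋ f (t, z) ^ s •
          curvE ℋ (f (t, z)) v (spat f (t, z) (stdVec j)) (spat f (t, z) (stdVec i)) := by
      simp only [pForm, _root_.smul_apply, curvE, map_smul, smul_sub, smul_add]
    rw [e1, map_smul, (hH.inner _ hfV).symm, hH.curvE_pair hfV, curvE_swap, map_neg,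
      _root_.neg_apply, hH.curvE_inner_skew hfV, neg_neg, (hH.inner _ hfV).symm,
      (hH.inner _ hfV).symm]
  rw [hcurv]
  ring

theorem contDiffAt_tension_one {s : ℝ} (hs : 0 ≤ s)
    (hs' : 0 < normSq 𝒢 ℋ f (t, z) ∨ s = 0 ∨ 1 < 2 * s) :
    ContDiffAt ℝ 1 (tension 𝒢 ℋ f s) (t, z) :=
  contDiffAt_divP hG hH hz hfV hf (k := 2) (by simp) (by norm_num)
    ((isWeight_spat hG hH hz hfV hf).contDiffAt_two_smul hs hs')

/-- For continuity it is enough that `|df|^{2s} df` is `C¹`, which holds at zeros of `df` for every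
`s ≥ 0`. This is why the energy is finite for every member of a variation, regular or not. -/
theorem continuousAt_tension {s : ℝ} (hs : 0 ≤ s) : ContinuousAt (tension 𝒢 ℋ f s) (t, z) :=
  (contDiffAt_divP hG hH hz hfV hf (l := 0) (k := 1) (by simp) (by norm_num)
    ((isWeight_spat hG hH hz hfV hf).contDiffAt_one_smul hs).1).continuousAt

end Identity

section Energy

variable {P : Type*} [NormedAddCommGroup P] [NormedSpace ℝ P] {ℋ : Euc n → Form n}
  {V : Set (Euc n)} {f τ : P → Euc n} {a : P}

theorem sqrt_rpow_eq {r : ℝ} (hr : 0 ≤ r) (q : ℝ) : √r ^ q = r ^ (q / 2) := by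
  rw [Real.sqrt_eq_rpow, ← Real.rpow_mul hr]
  congr 1
  ring

/-- The derivative of `|τ|^q` along a map. -/
theorem energy_density (hH : IsMetricOn ℋ V) (ha : f a ∈ V) (hf : ContDiffAt ℝ ∞ f a)
    (hτ : ContDiffAt ℝ 1 τ a) {q : ℝ} (hq : 2 ≤ q) (ξ : P) :
    ContDiffAt ℝ 1 (fun b => √(ℋ (f b) (τ b) (τ b)) ^ q) a ∧
    fderiv ℝ (fun b => √(ℋ (f b) (τ b) (τ b)) ^ q) a ξ =
      q * ℋ (f a) (√(ℋ (f a) (τ a) (τ a)) ^ (q - 2) • τ a) (covE ℋ f τ a ξ) := by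
  have hnn : ∀ b, f b ∈ V → 0 ≤ ℋ (f b) (τ b) (τ b) := by
    intro b hb
    by_cases h0 : τ b = 0
    · simp [h0]
    · exact ((hH.inner _ hb).pos _ h0).le
  have hr : ContDiffAt ℝ 1 (fun b => ℋ (f b) (τ b) (τ b)) a :=
    ((((hH.contDiffAt ha).comp a hf).of_le (by simp)).clm_apply hτ).clm_apply hτ
  have heq : (fun b => √(ℋ (f b) (τ b) (τ b)) ^ q) =ᶠ[𝓝 a]
      fun b => (ℋ (f b) (τ b) (τ b)) ^ (q / 2) := by
    filter_upwards [hf.continuousAt.tendsto.eventually (hH.isOpen.mem_nhds ha)] with b hb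
    exact sqrt_rpow_eq (hnn b hb) q
  -- The exponent `q / 2` is at least one, so the power is `C¹` also at zeros of `τ`.
  have hc : ContDiffAt ℝ 1 (fun b => (ℋ (f b) (τ b) (τ b)) ^ (q / 2)) a :=
    (Real.contDiff_rpow_const_of_le (n := 1) (p := q / 2) (by norm_num; linarith)).contDiffAt.comp
      a hr
  refine ⟨hc.congr_of_eventuallyEq heq, ?_⟩
  have hd := (Real.hasDerivAt_rpow_const (x := ℋ (f a) (τ a) (τ a)) (p := q / 2)
    (Or.inr (by linarith))).comp_hasFDerivAt a (hr.differentiableAt (by simp)).hasFDerivAt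
  have hd' : HasFDerivAt (fun b => (ℋ (f b) (τ b) (τ b)) ^ (q / 2)) _ a := hd
  rw [heq.fderiv_eq, hd'.fderiv]
  have hi := hH.hasFDerivAt_inner ha (hf.differentiableAt (by simp))
    (hτ.differentiableAt (by simp)) (hτ.differentiableAt (by simp)) ξ
  simp only [_root_.smul_apply, smul_eq_mul]
  rw [hi, (hH.inner _ ha).symm (covE ℋ f τ a ξ), sqrt_rpow_eq (hnn a ha), map_smul,
    _root_.smul_apply, smul_eq_mul, show (q - 2) / 2 = q / 2 - 1 by ring]
  ring

end Energy

end

/-! ### The curvature and both tension fields in arbitrary charts. -/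

section
section CurvatureNatural

variable {n : ℕ} {ℋ ℋ' : Euc n → Form n} {V V' : Set (Euc n)} {β : Euc n → Euc n} {z : Euc n}

/-- The curvature tensor does not depend on the coordinates. -/
theorem curvE_natural (hH : IsMetricOn ℋ V) (hH' : IsMetricOn ℋ' V')
    (hV : ∀ᶠ y in 𝓝 z, y ∈ V ∧ β y ∈ V' ∧ ContDiffAt ℝ ∞ β y ∧
      Function.Surjective (fderiv ℝ β y) ∧
      ∀ u w, ℋ y u w = ℋ' (β y) (fderiv ℝ β y u) (fderiv ℝ β y w)) (u v w : Euc n) :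
    curvE ℋ' (β z) (fderiv ℝ β z u) (fderiv ℝ β z v) (fderiv ℝ β z w) =
      fderiv ℝ β z (curvE ℋ z u v w) := by
  obtain ⟨hz, hz', hβ, -, -⟩ := hV.self_of_nhds
  have hid : ∀ y, HasFDerivAt (fun y : Euc n => y) (ContinuousLinearMap.id ℝ (Euc n)) y :=
    hasFDerivAt_id
  have hfid : ∀ y, fderiv ℝ (fun y : Euc n => y) y = ContinuousLinearMap.id ℝ (Euc n) :=
    fun y => (hid y).fderiv
  have nat : ∀ y, (∀ᶠ y in 𝓝 y, y ∈ V ∧ β y ∈ V' ∧ ContDiffAt ℝ ∞ β y ∧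
      Function.Surjective (fderiv ℝ β y) ∧
      ∀ u w, ℋ y u w = ℋ' (β y) (fderiv ℝ β y u) (fderiv ℝ β y w)) →
      ∀ {X X' : Euc n → Euc n}, DifferentiableAt ℝ X y →
      (∀ᶠ y in 𝓝 y, X' y = fderiv ℝ β y (X y)) → ∀ u,
      covE ℋ' β X' y u = fderiv ℝ β y (covE ℋ (fun y => y) X y u) := by
    intro y hy X X' hX hX' u
    obtain ⟨k1, k2, k3, k4, -⟩ := hy.self_of_nhds
    have := covE_natural hH hH' (a := fun y => y) (α := fun y => y) (f := fun y => y)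
      (f' := β) (β := β) (z := y) contDiffAt_id contDiffAt_id (by simp) (by simp) k1 k2 k3 k4
      (hy.mono fun y h => h.2.2.2.2) contDiffAt_id (by simp) hX hX' u
    rwa [hfid] at this
  -- Naturality of the covariant derivative, used twice: it carries second derivatives of the
  -- constant field `w` along the identity to those of `Dβ w` along `β`. Comparing commutators
  -- yields the claim without expanding the curvature.
  have hc : ∀ a b : Euc n, covE ℋ' β (fun y => covE ℋ' β (fun y => fderiv ℝ β y w) y b) z a =
      fderiv ℝ β z (covE ℋ (fun y => y) (fun y => covE ℋ (fun y => y) (fun _ => w) y b) z a) := by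
    intro a b
    refine nat z hV ?_ ?_ a
    · have : (fun y => covE ℋ (fun y => y) (fun _ => w) y b) = fun y => chr ℋ y b w := by
        funext y
        rw [covE, hfid]
        simp
      rw [this]
      exact ((hH.differentiableAt_chr hz).clm_apply (differentiableAt_const _)).clm_apply
        (differentiableAt_const _)
    · filter_upwards [hV.eventually_nhds] with y hy
      exact nat y hy (differentiableAt_const w) (Filter.Eventually.of_forall fun _ => rfl) b
  have e1 := hH'.covE_commutator hz' hβ (X := fun y => fderiv ℝ β y w)
    (((hβ.fderiv_right (m := ∞) (by simp)).clm_apply contDiffAt_const).of_le ENat.LEInfty.out) u v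
  have e2 := hH.covE_commutator (f := fun y => y) hz contDiffAt_id (X := fun _ => w)
    contDiffAt_const u v
  rw [hc, hc] at e1
  rw [hfid] at e2
  rw [e2, map_add] at e1
  exact (add_left_cancel e1).symm

end CurvatureNatural

variable {m n : ℕ}
  {M : Type*} [TopologicalSpace M] [ChartedSpace (EuclideanSpace ℝ (Fin m)) M]
  [IsManifold (𝓡 m) ∞ M]
  {N : Type*} [TopologicalSpace N] [ChartedSpace (EuclideanSpace ℝ (Fin n)) N]
  [IsManifold (𝓡 n) ∞ N]

/-- The curvature tensor in arbitrary charts. -/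
theorem curvature_coordL (h : Metric n N) {y₀ y : N} (hy : y ∈ (ch n y₀).source) (u v w : Euc n) :
    curvature h y (coordL n y₀ y u) (coordL n y₀ y v) (coordL n y₀ y w) =
      coordL n y₀ y (curvE (metE h y₀) (ch n y₀ y) u v w) := by
  have hyy := mem_extChartAt_source (I := 𝓡 n) y
  have key := curvE_natural (β := trans n y₀ y) (z := ch n y₀ y) (isMetricOn_metE h y₀)
    (isMetricOn_metE h y) (by
      filter_upwards [eventually_mem_overlap hy hyy] with z hz
      refine ⟨hz.1, (trans_mem_overlap hz).1, contDiffAt_trans hz, fun w => ?_, metE_trans h hz⟩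
      refine ⟨fderiv ℝ (trans n y y₀) (trans n y₀ y z) w, ?_⟩
      have := fderiv_trans_inverse (trans_mem_overlap hz) w
      rwa [trans_trans hz] at this) u v w
  rw [trans_ch hy, ← coordL_eq hy] at key
  rw [← key]
  exact curvature_eq h y _ _ _

section SingleMap

variable (g : Metric m M) (h : Metric n N) {φ : M → N} {x₀ x : M} {y₀ : N}
  (hx : x ∈ (ch m x₀).source) (hy : φ x ∈ (ch n y₀).source)

include hx hy in
theorem fnormSq_nonneg :
    0 ≤ fnormSq (metE g x₀) (metE h y₀) (repMap m n x₀ y₀ φ) (ch m x₀ x) :=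
  hsForm_nonneg (isInner_metE g ((ch m x₀).map_source hx)) (isInner_metE h (by
    rw [repMap_ch y₀ φ hx]
    exact (ch n y₀).map_source hy)) _

include hx hy

theorem innerHom_eq_hsForm {S T : TangentSpace (𝓡 m) x → TangentSpace (𝓡 n) (φ x)}
    {S' T' : Euc m →L[ℝ] Euc n} (hS : ∀ w, S (coordL m x₀ x w) = coordL n y₀ (φ x) (S' w))
    (hT : ∀ w, T (coordL m x₀ x w) = coordL n y₀ (φ x) (T' w)) :
    innerHom g h x (φ x) S T =
      hsForm (metE g x₀ (ch m x₀ x)) (metE h y₀ (repMap m n x₀ y₀ φ (ch m x₀ x))) S' T' := by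
  rw [hsForm_apply, repMap_ch y₀ φ hx]
  exact innerHom_eq g h hx hy hS hT

variable (hφ : ContMDiffAt (𝓡 m) (𝓡 n) ∞ φ x)
include hφ

theorem dnorm_rpow_eq (r : ℝ) : dnorm g h φ x ^ r =
    fnormSq (metE g x₀) (metE h y₀) (repMap m n x₀ y₀ φ) (ch m x₀ x) ^ (r / 2) := by
  rw [← sqrt_rpow_eq (fnormSq_nonneg g h hx hy), dnorm,
    innerHom_eq_hsForm g h hx hy (mfderiv_coordL hx hy hφ) (mfderiv_coordL hx hy hφ)]
  rfl

theorem fnormSq_pos (h0 : mfderiv (𝓡 m) (𝓡 n) φ x ≠ 0) :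
    0 < fnormSq (metE g x₀) (metE h y₀) (repMap m n x₀ y₀ φ) (ch m x₀ x) := by
  refine hsForm_pos (isInner_metE g ((ch m x₀).map_source hx)) (isInner_metE h (by
    rw [repMap_ch y₀ φ hx]
    exact (ch n y₀).map_source hy)) fun h1 => h0 ?_
  ext1 w
  have h2 := mfderiv_coordL hx hy hφ (coordInv m x₀ x w)
  rw [h1] at h2
  refine Eq.trans ?_ (h2.trans (map_zero _))
  exact congrArg _ (coordL_coordInv hx w).symm

end SingleMap

section Global

variable (g : Metric m M) (h : Metric n N) {φ : M → N} (hφ : ContMDiff (𝓡 m) (𝓡 n) ∞ φ)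
  {x₀ x : M} {y₀ : N} (hx : x ∈ (ch m x₀).source) (hy : φ x ∈ (ch n y₀).source)
include hφ hx hy

omit [IsManifold (𝓡 m) ∞ M] [IsManifold (𝓡 n) ∞ N] in
/-- Points near `x` in the chart at `x₀`. -/
theorem eventually_chart {P : Euc m → Prop}
    (h : ∀ x' ∈ (ch m x₀).source, φ x' ∈ (ch n y₀).source → P (ch m x₀ x')) :
    ∀ᶠ z in 𝓝 (ch m x₀ x), P z := by
  filter_upwards [eventually_mem_source hx,
    eventually_map_mem hx hφ.continuous.continuousAt hy] with z h2 h3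
  have := h _ ((ch m x₀).map_target h2) h3
  rwa [(ch m x₀).right_inv h2] at this

/-- The `p`-tension field in arbitrary charts. -/
theorem pTension_eq {p : ℝ} (hp : 2 ≤ p) : pTension p g h φ x = coordL n y₀ (φ x)
    (divE (metE g x₀) (metE h y₀) (repMap m n x₀ y₀ φ)
      (fun z => fnormSq (metE g x₀) (metE h y₀) (repMap m n x₀ y₀ φ) z ^ ((p - 2) / 2) •
        fderiv ℝ (repMap m n x₀ y₀ φ) z) (ch m x₀ x)) := by
  have hw := isWeight_fderiv (isMetricOn_metE g x₀) (isMetricOn_metE h y₀)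
    ((ch m x₀).map_source hx) (f := repMap m n x₀ y₀ φ) (z := ch m x₀ x)
    (by rw [repMap_ch y₀ φ hx]; exact (ch n y₀).map_source hy)
    (contDiffAt_repMap hx hy hφ.contMDiffAt)
  refine divergence_eq g h hx hy hφ.contMDiffAt
    ((hw.contDiffAt_one_smul (s := (p - 2) / 2) (by linarith)).1.differentiableAt (by simp)) ?_
  refine eventually_chart hφ hx hy (P := fun z => ∀ w, dnorm g h φ ((ch m x₀).symm z) ^ (p - 2) •
    mfderiv (𝓡 m) (𝓡 n) φ ((ch m x₀).symm z) (coordL m x₀ ((ch m x₀).symm z) w) = _) ?_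
  intro x' hx' hy' w
  rw [(ch m x₀).left_inv hx', dnorm_rpow_eq g h hx' hy' hφ.contMDiffAt]
  exact (congrArg (_ • ·) (mfderiv_coordL hx' hy' hφ.contMDiffAt w)).trans (map_smul _ _ _).symm

theorem eventually_covDeriv_eq {V : ∀ x, TangentSpace (𝓡 n) (φ x)} {X : Euc m → Euc n}
    (hV : ∀ᶠ z in 𝓝 (ch m x₀ x), V ((ch m x₀).symm z) =
      coordL n y₀ (φ ((ch m x₀).symm z)) (X z)) (hX : ContDiffAt ℝ 1 X (ch m x₀ x)) :
    ∀ᶠ z in 𝓝 (ch m x₀ x), ∀ w, covDeriv h φ V ((ch m x₀).symm z)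
      (coordL m x₀ ((ch m x₀).symm z) w) =
      coordL n y₀ (φ ((ch m x₀).symm z)) (covL (metE h y₀) (repMap m n x₀ y₀ φ) X z w) := by
  filter_upwards [hV.eventually_nhds, ContDiffAt.eventually_one hX, eventually_mem_source hx,
    eventually_map_mem hx hφ.continuous.continuousAt hy] with z h1 h2 h3 h4 w
  have := covDeriv_eq h ((ch m x₀).map_target h3) h4 hφ.contMDiffAt (V := V) (X := X)
    (by rw [(ch m x₀).right_inv h3]; exact h2.differentiableAt (by simp))
    (by rwa [(ch m x₀).right_inv h3]) w
  rwa [(ch m x₀).right_inv h3, ← covL_apply] at this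

theorem trace_curvature_eq (τ : Euc n) :
    trace g x (fun u w => curvature h (φ x) (coordL n y₀ (φ x) τ) (mfderiv (𝓡 m) (𝓡 n) φ x u)
      (mfderiv (𝓡 m) (𝓡 n) φ x w)) =
    coordL n y₀ (φ x) (formTrace (metE g x₀ (ch m x₀ x)) fun u w =>
      curvE (metE h y₀) (repMap m n x₀ y₀ φ (ch m x₀ x)) τ
        (fderiv ℝ (repMap m n x₀ y₀ φ) (ch m x₀ x) u)
        (fderiv ℝ (repMap m n x₀ y₀ φ) (ch m x₀ x) w)) := by
  set A := fderiv ℝ (repMap m n x₀ y₀ φ) (ch m x₀ x)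
  set y := repMap m n x₀ y₀ φ (ch m x₀ x) with hyd
  have hyy : y = ch n y₀ (φ x) := repMap_ch y₀ φ hx
  let B : Euc m →ₗ[ℝ] Euc m →ₗ[ℝ] Euc n := LinearMap.mk₂ ℝ
    (fun u w => coordL n y₀ (φ x) (curvE (metE h y₀) y τ (A (coordInv m x₀ x u))
      (A (coordInv m x₀ x w))))
    (by intro a b c; simp only [curvE, map_add, _root_.add_apply, map_sub]; abel)
    (by intro a b c; simp only [curvE, map_smul, _root_.smul_apply, map_sub, map_add, smul_sub,
      smul_add])
    (by intro a b c; simp only [curvE, map_add, map_sub]; abel)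
    (by intro a b c; simp only [curvE, map_smul, map_sub, map_add, smul_sub, smul_add])
  have h1 := trace_eq g hx B
  have h2 : ∀ u, mfderiv (𝓡 m) (𝓡 n) φ x u = coordL n y₀ (φ x) (A (coordInv m x₀ x u)) := by
    intro u
    refine Eq.trans ?_ (mfderiv_coordL hx hy hφ.contMDiffAt (coordInv m x₀ x u))
    exact congrArg _ (coordL_coordInv hx u).symm
  refine Eq.trans ?_ (h1.trans ?_)
  · refine congrArg (trace g x) ?_
    funext u w
    refine (congrArg₂ (fun a b => curvature h (φ x) (coordL n y₀ (φ x) τ) a b) (h2 u) (h2 w)).trans ?_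
    rw [curvature_coordL h hy, ← hyy]
    rfl
  · rw [clm_formTrace]
    refine formTrace_congr _ fun i j => ?_
    change coordL n y₀ (φ x) (curvE (metE h y₀) y τ
      (A (coordInv m x₀ x (coordL m x₀ x (stdVec i))))
      (A (coordInv m x₀ x (coordL m x₀ x (stdVec j))))) = _
    rw [coordInv_coordL hx, coordInv_coordL hx]

/-- The `(p, q)`-tension field in arbitrary charts. -/
theorem pqTension_eq {p : ℝ} (q : ℝ) {W : Euc m → Euc n}
    (hW : ∀ᶠ z in 𝓝 (ch m x₀ x), weightedTension p q g h φ ((ch m x₀).symm z) =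
      coordL n y₀ (φ ((ch m x₀).symm z)) (W z)) (hW2 : ContDiffAt ℝ 2 W (ch m x₀ x))
    (hs : 0 < fnormSq (metE g x₀) (metE h y₀) (repMap m n x₀ y₀ φ) (ch m x₀ x) ∨
      (p - 2) / 2 = 0 ∨ 1 < 2 * ((p - 2) / 2)) :
    pqTension p q g h φ x = coordL n y₀ (φ x)
      (-(fnormSq (metE g x₀) (metE h y₀) (repMap m n x₀ y₀ φ) (ch m x₀ x) ^ ((p - 2) / 2) •
          formTrace (metE g x₀ (ch m x₀ x)) fun u w =>
            curvE (metE h y₀) (repMap m n x₀ y₀ φ (ch m x₀ x)) (W (ch m x₀ x))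
              (fderiv ℝ (repMap m n x₀ y₀ φ) (ch m x₀ x) u)
              (fderiv ℝ (repMap m n x₀ y₀ φ) (ch m x₀ x) w)) -
        divE (metE g x₀) (metE h y₀) (repMap m n x₀ y₀ φ)
          (linForm (metE g x₀) (metE h y₀) (repMap m n x₀ y₀ φ) ((p - 2) / 2) W)
          (ch m x₀ x)) := by
  have hme := isMetricOn_metE g x₀
  have hmh := isMetricOn_metE h y₀
  have hzt := (ch m x₀).map_source hx
  have hfV : repMap m n x₀ y₀ φ (ch m x₀ x) ∈ (ch n y₀).target := by
    rw [repMap_ch y₀ φ hx]; exact (ch n y₀).map_source hy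
  have hf := contDiffAt_repMap hx hy hφ.contMDiffAt
  have hcov := eventually_covDeriv_eq h hφ hx hy hW (hW2.of_le (by norm_num))
  have hmf : ∀ᶠ z in 𝓝 (ch m x₀ x), ∀ w, mfderiv (𝓡 m) (𝓡 n) φ ((ch m x₀).symm z)
      (coordL m x₀ ((ch m x₀).symm z) w) =
      coordL n y₀ (φ ((ch m x₀).symm z)) (fderiv ℝ (repMap m n x₀ y₀ φ) z w) :=
    eventually_chart hφ hx hy fun x' hx' hy' w => by
      rw [(ch m x₀).left_inv hx']
      exact mfderiv_coordL hx' hy' hφ.contMDiffAt w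
  have hdn : ∀ r : ℝ, ∀ᶠ z in 𝓝 (ch m x₀ x), dnorm g h φ ((ch m x₀).symm z) ^ r =
      fnormSq (metE g x₀) (metE h y₀) (repMap m n x₀ y₀ φ) z ^ (r / 2) := fun r =>
    eventually_chart hφ hx hy fun x' hx' hy' => by
      rw [(ch m x₀).left_inv hx']
      exact dnorm_rpow_eq g h hx' hy' hφ.contMDiffAt r
  have hin : ∀ᶠ z in 𝓝 (ch m x₀ x), innerHom g h ((ch m x₀).symm z) (φ ((ch m x₀).symm z))
      (covDeriv h φ (weightedTension p q g h φ) ((ch m x₀).symm z))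
      (mfderiv (𝓡 m) (𝓡 n) φ ((ch m x₀).symm z)) =
      hsForm (metE g x₀ z) (metE h y₀ (repMap m n x₀ y₀ φ z))
        (covL (metE h y₀) (repMap m n x₀ y₀ φ) W z) (fderiv ℝ (repMap m n x₀ y₀ φ) z) := by
    filter_upwards [hcov, hmf, eventually_mem_source hx,
      eventually_map_mem hx hφ.continuous.continuousAt hy] with z h1 h2 h3 h4
    have := innerHom_eq_hsForm g h ((ch m x₀).map_target h3) h4 h1 h2
    rwa [(ch m x₀).right_inv h3] at this
  have d1 := divergence_eq g h hx hy hφ.contMDiffAt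
    (S := fun y u => (dnorm g h φ y ^ (p - 2)) • covDeriv h φ (weightedTension p q g h φ) y u)
    ((contDiffAt_rpow_smul_covL hme hmh hzt hfV hf hs hW2).differentiableAt (by simp)) (by
      filter_upwards [hcov, hdn (p - 2)] with z h1 h2 w
      rw [h2]
      exact (congrArg (_ • ·) (h1 w)).trans (map_smul _ _ _).symm)
  have d2 : (p - 2) • divergence g h φ (fun y u => (dnorm g h φ y ^ (p - 4) *
        innerHom g h y (φ y) (covDeriv h φ (weightedTension p q g h φ) y)
          (mfderiv (𝓡 m) (𝓡 n) φ y)) • mfderiv (𝓡 m) (𝓡 n) φ y u) x =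
      (p - 2) • coordL n y₀ (φ x) (divE (metE g x₀) (metE h y₀) (repMap m n x₀ y₀ φ) (fun y =>
        (fnormSq (metE g x₀) (metE h y₀) (repMap m n x₀ y₀ φ) y ^ ((p - 2) / 2 - 1) *
        hsForm (metE g x₀ y) (metE h y₀ (repMap m n x₀ y₀ φ y))
          (covL (metE h y₀) (repMap m n x₀ y₀ φ) W y) (fderiv ℝ (repMap m n x₀ y₀ φ) y)) •
          fderiv ℝ (repMap m n x₀ y₀ φ) y) (ch m x₀ x)) := by
    -- For `p = 2` the last one-form may be singular, but the coefficient vanishes on both sides.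
    -- Otherwise it is differentiable, and `(p - 4) / 2 = s - 1` matches the exponents.
    by_cases h0 : p = 2
    · rw [h0, sub_self]
      exact (zero_smul ℝ _).trans (zero_smul ℝ _).symm
    · congr 1
      refine divergence_eq g h hx hy hφ.contMDiffAt (differentiableAt_rpow_smul_fderiv hme hmh hzt
        hfV hf hs hW2 (fun h1 => h0 (by linarith))) ?_
      filter_upwards [hmf, hdn (p - 4), hin] with z h1 h2 h3 w
      rw [h2, h3, show (p - 4) / 2 = (p - 2) / 2 - 1 by ring]
      exact (congrArg (_ • ·) (h1 w)).trans (map_smul _ _ _).symm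
  have hWx := hW.self_of_nhds
  rw [(ch m x₀).left_inv hx] at hWx
  have e0 : pTension p g h φ x = coordL n y₀ (φ x) (coordInv n y₀ (φ x) (pTension p g h φ x)) :=
    (coordL_coordInv hy (pTension p g h φ x)).symm
  set τ' : Euc n := coordInv n y₀ (φ x) (pTension p g h φ x) with hτ'
  set c : ℝ := vnorm h (φ x) (pTension p g h φ x) ^ (q - 2) with hc
  -- The factor `|τ_p|^{q-2}` is moved into the first slot of the curvature, which is linear; there
  -- it turns `τ_p` into `W`.
  have e1 : W (ch m x₀ x) = c • τ' := by
    refine coordL_injective hy ?_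
    rw [← hWx, map_smul]
    exact congrArg (c • ·) e0
  have e2 : trace g x (fun u w => curvature h (φ x) (pTension p g h φ x)
      (mfderiv (𝓡 m) (𝓡 n) φ x u) (mfderiv (𝓡 m) (𝓡 n) φ x w)) = _ :=
    (congrArg (fun t => trace g x (fun u w => curvature h (φ x) t
      (mfderiv (𝓡 m) (𝓡 n) φ x u) (mfderiv (𝓡 m) (𝓡 n) φ x w))) e0).trans
      (trace_curvature_eq g h hφ hx hy τ')
  have e3 := hdn (p - 2)
  have e3 := e3.self_of_nhds
  rw [(ch m x₀).left_inv hx] at e3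
  rw [divE_linForm hme hmh hzt hfV hf hs hW2, e1]
  simp only [curvE_smul_left, formTrace_smul]
  rw [map_sub, map_neg, map_add, map_smul, map_smul, map_smul, ← e2,
    show 2 * ((p - 2) / 2) = p - 2 by ring, ← d1, ← d2, ← e3]
  have key : ∀ (a : ℝ) (A B C : Euc n), -((a * c) • A) - B - C = -(a • c • A) - (B + C) :=
    fun a A B C => by rw [smul_smul, sub_sub]
  exact key _ _ _ _

end Global

end

/-! ### Families of maps in fixed charts. -/

section
variable {m n : ℕ}
  {M : Type*} [TopologicalSpace M] [ChartedSpace (EuclideanSpace ℝ (Fin m)) M]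
  {N : Type*} [TopologicalSpace N] [ChartedSpace (EuclideanSpace ℝ (Fin n)) N]

/-- A family of maps in the charts at `x₀` and `y₀`. -/
def famMap (m n : ℕ) {M : Type*} [TopologicalSpace M] [ChartedSpace (EuclideanSpace ℝ (Fin m)) M]
    {N : Type*} [TopologicalSpace N] [ChartedSpace (EuclideanSpace ℝ (Fin n)) N]
    (x₀ : M) (y₀ : N) (Φ : ℝ → M → N) (a : ℝ × Euc m) : Euc n := repMap m n x₀ y₀ (Φ a.1) a.2

variable {Φ : ℝ → M → N} {ε : ℝ}
  (hΦ : ContMDiffOn (𝓘(ℝ, ℝ).prod (𝓡 m)) (𝓡 n) ∞ (fun a : ℝ × M => Φ a.1 a.2)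
    (Ioo (-ε) ε ×ˢ univ))
  {x₀ x : M} {y₀ : N} {t : ℝ} (ht : t ∈ Ioo (-ε) ε)

include hΦ ht

theorem contMDiffAt_family (x : M) : ContMDiffAt (𝓘(ℝ, ℝ).prod (𝓡 m)) (𝓡 n) ∞
    (fun a : ℝ × M => Φ a.1 a.2) (t, x) :=
  hΦ.contMDiffAt ((isOpen_Ioo.prod isOpen_univ).mem_nhds ⟨ht, mem_univ x⟩)

theorem contMDiff_slice : ContMDiff (𝓡 m) (𝓡 n) ∞ (Φ t) := fun x =>
  (contMDiffAt_family hΦ ht x).comp x (f := fun y : M => (t, y))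
    (contMDiffAt_const.prodMk contMDiffAt_id)

theorem contMDiffAt_time (x : M) : ContMDiffAt 𝓘(ℝ, ℝ) (𝓡 n) ∞ (fun s => Φ s x) t :=
  (contMDiffAt_family hΦ ht x).comp t (f := fun s : ℝ => (s, x))
    (contMDiffAt_id.prodMk contMDiffAt_const)

variable (hx : x ∈ (ch m x₀).source) (hy : Φ t x ∈ (ch n y₀).source)
include hx

theorem continuousAt_family_symm :
    ContinuousAt (fun a : ℝ × Euc m => Φ a.1 ((ch m x₀).symm a.2)) (t, ch m x₀ x) := by
  have h1 : ContinuousAt (fun a : ℝ × M => Φ a.1 a.2) (t, (ch m x₀).symm (ch m x₀ x)) := by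
    rw [(ch m x₀).left_inv hx]
    exact (contMDiffAt_family hΦ ht x).continuousAt
  have h2 : ContinuousAt (fun a : ℝ × Euc m => (a.1, (ch m x₀).symm a.2)) (t, ch m x₀ x) :=
    continuousAt_fst.prodMk (ContinuousAt.comp
      (f := (Prod.snd : ℝ × Euc m → Euc m)) (x := (t, ch m x₀ x))
      (continuousAt_extChartAt_symm'' ((ch m x₀).map_source hx)) continuousAt_snd)
  exact ContinuousAt.comp (f := fun a : ℝ × Euc m => (a.1, (ch m x₀).symm a.2))
    (g := fun a : ℝ × M => Φ a.1 a.2) h1 h2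

include hy

theorem eventually_family {P : ℝ × Euc m → Prop}
    (h : ∀ t' ∈ Ioo (-ε) ε, ∀ x' ∈ (ch m x₀).source, Φ t' x' ∈ (ch n y₀).source →
      P (t', ch m x₀ x')) : ∀ᶠ a in 𝓝 (t, ch m x₀ x), P a := by
  have h1 := (continuousAt_family_symm hΦ ht hx).eventually
    ((isOpen_extChartAt_source y₀).mem_nhds (by
      simp only
      rw [(ch m x₀).left_inv hx]
      exact hy))
  filter_upwards [h1, (continuous_fst.tendsto (t, ch m x₀ x)).eventually (isOpen_Ioo.mem_nhds ht),
    (continuous_snd.tendsto (t, ch m x₀ x)).eventually (eventually_mem_source hx)] with a k1 k2 k3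
  have := h a.1 k2 _ ((ch m x₀).map_target k3) k1
  rwa [(ch m x₀).right_inv k3] at this

variable [IsManifold (𝓡 m) ∞ M] [IsManifold (𝓡 n) ∞ N]

theorem contDiffAt_famMap : ContDiffAt ℝ ∞ (famMap m n x₀ y₀ Φ) (t, ch m x₀ x) := by
  rw [← contMDiffAt_iff_contDiffAt]
  have h1 : ContMDiffAt (𝓘(ℝ, ℝ).prod (𝓡 m)) (𝓡 n) ∞ (fun a : ℝ × M => Φ a.1 a.2)
      (t, (ch m x₀).symm (ch m x₀ x)) := contMDiffAt_family hΦ ht _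
  have h2 : ContMDiffAt 𝓘(ℝ, ℝ × Euc m) (𝓘(ℝ, ℝ).prod (𝓡 m)) ∞
      (fun a : ℝ × Euc m => (a.1, (ch m x₀).symm a.2)) (t, ch m x₀ x) := by
    refine ContMDiffAt.prodMk contDiffAt_fst.contMDiffAt ?_
    have h3 : ContMDiffAt 𝓘(ℝ, Euc m) (𝓡 m) ∞ (ch m x₀).symm (ch m x₀ x) :=
      (contMDiffOn_extChartAt_symm x₀).contMDiffAt
        ((isOpen_extChartAt_target x₀).mem_nhds ((ch m x₀).map_source hx))
    exact ContMDiffAt.comp (f := (Prod.snd : ℝ × Euc m → Euc m)) (t, ch m x₀ x) h3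
      contDiffAt_snd.contMDiffAt
  have h4 := ContMDiffAt.comp (f := fun a : ℝ × Euc m => (a.1, (ch m x₀).symm a.2))
    (g := fun a : ℝ × M => Φ a.1 a.2) (t, ch m x₀ x) h1 h2
  refine ContMDiffAt.comp (g := ch n y₀) (I' := 𝓡 n) (t, ch m x₀ x) ?_ h4
  refine contMDiffAt_extChartAt' ?_
  simp only
  rw [(ch m x₀).left_inv hx]
  rwa [extChartAt_source] at hy

theorem eventually_contDiffAt_famMap :
    ∀ᶠ a in 𝓝 (t, ch m x₀ x), ContDiffAt ℝ ∞ (famMap m n x₀ y₀ Φ) a :=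
  eventually_family hΦ ht hx hy fun _ ht' _ hx' hy' => contDiffAt_famMap hΦ ht' hx' hy'

theorem fderiv_repMap_eq : fderiv ℝ (repMap m n x₀ y₀ (Φ t)) (ch m x₀ x) =
    spat (famMap m n x₀ y₀ Φ) (t, ch m x₀ x) :=
  fderiv_slice ((contDiffAt_famMap hΦ ht hx hy).differentiableAt (by simp))

theorem fnormSq_eq_normSq (g : Metric m M) (h : Metric n N) :
    fnormSq (metE g x₀) (metE h y₀) (repMap m n x₀ y₀ (Φ t)) (ch m x₀ x) =
      normSq (metE g x₀) (metE h y₀) (famMap m n x₀ y₀ Φ) (t, ch m x₀ x) := by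
  rw [fnormSq, normSq, fderiv_repMap_eq hΦ ht hx hy]
  rfl

omit hΦ ht [IsManifold (𝓡 m) ∞ M] [IsManifold (𝓡 n) ∞ N] in
theorem famMap_mem : famMap m n x₀ y₀ Φ (t, ch m x₀ x) ∈ (ch n y₀).target := by
  rw [famMap, repMap_ch y₀ (Φ t) hx]
  exact (ch n y₀).map_source hy

/-- The `p`-tension fields of a family in arbitrary charts. -/
theorem pTension_family (g : Metric m M) (h : Metric n N) {p : ℝ} (hp : 2 ≤ p) :
    pTension p g h (Φ t) x = coordL n y₀ (Φ t x)
      (tension (metE g x₀) (metE h y₀) (famMap m n x₀ y₀ Φ) ((p - 2) / 2) (t, ch m x₀ x)) := by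
  have hf := contDiffAt_famMap hΦ ht hx hy
  have hw := isWeight_spat (isMetricOn_metE g x₀) (isMetricOn_metE h y₀) ((ch m x₀).map_source hx)
    (famMap_mem hx hy) hf
  have h1 : DifferentiableAt ℝ (pForm (metE g x₀) (metE h y₀) (famMap m n x₀ y₀ Φ) ((p - 2) / 2))
      (t, ch m x₀ x) :=
    (hw.contDiffAt_one_smul (s := (p - 2) / 2) (by linarith)).1.differentiableAt (by simp)
  refine (pTension_eq g h (contMDiff_slice hΦ ht) hx hy hp).trans
    (congrArg (coordL n y₀ (Φ t x)) ?_)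
  rw [tension, divP_eq_divE (hf.differentiableAt (by simp)) h1]
  refine divE_congr ?_
  refine eventually_chart (contMDiff_slice hΦ ht) hx hy (P := fun z => _ = _) ?_
  intro x' hx' hy'
  rw [fnormSq_eq_normSq hΦ ht hx' hy', fderiv_repMap_eq hΦ ht hx' hy', pForm]

/-- The norms of the `p`-tension fields of a family. -/
theorem vnorm_pTension_family (g : Metric m M) (h : Metric n N) {p : ℝ} (hp : 2 ≤ p) :
    vnorm h (Φ t x) (pTension p g h (Φ t) x) =
      √(metE h y₀ (famMap m n x₀ y₀ Φ (t, ch m x₀ x))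
        (tension (metE g x₀) (metE h y₀) (famMap m n x₀ y₀ Φ) ((p - 2) / 2) (t, ch m x₀ x))
        (tension (metE g x₀) (metE h y₀) (famMap m n x₀ y₀ Φ) ((p - 2) / 2) (t, ch m x₀ x))) := by
  rw [pTension_family hΦ ht hx hy g h hp, vnorm_coordL h hy, famMap, repMap_ch y₀ (Φ t) hx]

-- The velocity is defined in the preferred chart at `Φ 0 x`. The curve stays in the chart at `y₀`
-- for small times, and the change of coordinates acts by its derivative `coordL`.
omit ht hy in
theorem variationField_eq (h0 : (0 : ℝ) ∈ Ioo (-ε) ε) (hy : Φ 0 x ∈ (ch n y₀).source) :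
    variationField n Φ x = coordL n y₀ (Φ 0 x)
      (fderiv ℝ (famMap m n x₀ y₀ Φ) (0, ch m x₀ x) (timeDir m)) := by
  have hyy := mem_extChartAt_source (I := 𝓡 n) (Φ 0 x)
  have hγ := contMDiffAt_time hΦ h0 x
  have h1 : variationField n Φ x = fderiv ℝ (fun s => ch n (Φ 0 x) (Φ s x)) 0 1 := by
    have := (hγ.mdifferentiableAt (by simp)).mfderiv
    simp only [modelWithCornersSelf_coe, range_id, fderivWithin_univ] at this
    exact congrArg (fun L : ℝ →L[ℝ] Euc n => L 1) this
  have h2 := hasDerivAt_time ((contDiffAt_famMap hΦ h0 hx hy).differentiableAt (by simp))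
  have h3 : (fun s => famMap m n x₀ y₀ Φ (s, ch m x₀ x)) = fun s => ch n y₀ (Φ s x) := by
    funext s
    rw [famMap, repMap_ch y₀ (Φ s) hx]
  rw [h3] at h2
  have h4 : HasFDerivAt (trans n y₀ (Φ 0 x)) (coordL n y₀ (Φ 0 x)) (ch n y₀ (Φ 0 x)) := by
    rw [coordL_eq hy]
    exact ((contDiffAt_trans (mem_overlap hy hyy)).differentiableAt (by simp)).hasFDerivAt
  have h5 : HasDerivAt (fun s => trans n y₀ (Φ 0 x) (ch n y₀ (Φ s x))) _ 0 :=
    HasFDerivAt.comp_hasDerivAt (f := fun s => ch n y₀ (Φ s x)) (l := trans n y₀ (Φ 0 x)) 0 h4 h2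
  have h6 : (fun s => ch n (Φ 0 x) (Φ s x)) =ᶠ[𝓝 0]
      fun s => trans n y₀ (Φ 0 x) (ch n y₀ (Φ s x)) := by
    filter_upwards [hγ.continuousAt.eventually ((isOpen_extChartAt_source y₀).mem_nhds hy)]
      with s hs
    rw [trans_ch hs]
  rw [h1, h6.fderiv_eq, h5.hasFDerivAt.fderiv]
  exact one_smul ℝ _

end

/-! ### The Green one-form without reference to charts. -/

section
variable {m n : ℕ}
  {M : Type*} [TopologicalSpace M] [ChartedSpace (EuclideanSpace ℝ (Fin m)) M]
  [IsManifold (𝓡 m) ∞ M]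
  {N : Type*} [TopologicalSpace N] [ChartedSpace (EuclideanSpace ℝ (Fin n)) N]
  [IsManifold (𝓡 n) ∞ N]

section Green

variable (p : ℝ) (g : Metric m M) (h : Metric n N)

/-- The covariant derivative of `|dφ|^{p-2} dφ` along a variation of `φ` with field `V`. -/
def linHom (φ : M → N) (V : ∀ x, TangentSpace (𝓡 n) (φ x)) (x : M) (u : TangentSpace (𝓡 m) x) :
    TangentSpace (𝓡 n) (φ x) :=
  dnorm g h φ x ^ (p - 2) • covDeriv h φ V x u +
    ((p - 2) * (dnorm g h φ x ^ (p - 4) *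
      innerHom g h x (φ x) (covDeriv h φ V x) (mfderiv (𝓡 m) (𝓡 n) φ x))) •
      mfderiv (𝓡 m) (𝓡 n) φ x u

/-- The one-form whose divergence measures the failure of symmetry of the linearised
`p`-tension field. -/
def green (φ : M → N) (W V : ∀ x, TangentSpace (𝓡 n) (φ x)) (x : M) (u : Euc m) : ℝ :=
  innerForm h (φ x) (W x) (linHom p g h φ V x u) - innerForm h (φ x) (V x) (linHom p g h φ W x u)

variable {φ : M → N} (hφ : ContMDiff (𝓡 m) (𝓡 n) ∞ φ)
  {x₀ x : M} {y₀ : N} (hx : x ∈ (ch m x₀).source) (hy : φ x ∈ (ch n y₀).source)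
include hφ hx hy

theorem linHom_eq {V : ∀ x, TangentSpace (𝓡 n) (φ x)} {X : Euc m → Euc n}
    (hV : ∀ᶠ z in 𝓝 (ch m x₀ x), V ((ch m x₀).symm z) =
      coordL n y₀ (φ ((ch m x₀).symm z)) (X z)) (hX : ContDiffAt ℝ 1 X (ch m x₀ x)) (w : Euc m) :
    linHom p g h φ V x (coordL m x₀ x w) = coordL n y₀ (φ x)
      (linForm (metE g x₀) (metE h y₀) (repMap m n x₀ y₀ φ) ((p - 2) / 2) X (ch m x₀ x) w) := by
  have h1 := covDeriv_eq h hx hy hφ.contMDiffAt (hX.differentiableAt (by simp)) hV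
  have h2 := mfderiv_coordL hx hy hφ.contMDiffAt
  have h3 := innerHom_eq_hsForm g h hx hy (S' := covL (metE h y₀) (repMap m n x₀ y₀ φ) X
    (ch m x₀ x)) h1 h2
  have key : ∀ (a b : ℝ) (A B : Euc n), a • coordL n y₀ (φ x) A + b • coordL n y₀ (φ x) B =
      coordL n y₀ (φ x) (a • A + b • B) := fun a b A B => by
    rw [map_add, map_smul, map_smul]
  have h4 := dnorm_rpow_eq g h hx hy hφ.contMDiffAt
  refine Eq.trans ?_ ((key (fnormSq (metE g x₀) (metE h y₀) (repMap m n x₀ y₀ φ) (ch m x₀ x) ^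
    ((p - 2) / 2)) ((p - 2) * (fnormSq (metE g x₀) (metE h y₀) (repMap m n x₀ y₀ φ)
      (ch m x₀ x) ^ ((p - 4) / 2) * hsForm (metE g x₀ (ch m x₀ x))
        (metE h y₀ (repMap m n x₀ y₀ φ (ch m x₀ x)))
        (covL (metE h y₀) (repMap m n x₀ y₀ φ) X (ch m x₀ x))
        (fderiv ℝ (repMap m n x₀ y₀ φ) (ch m x₀ x))))
    (covL (metE h y₀) (repMap m n x₀ y₀ φ) X (ch m x₀ x) w)
    (fderiv ℝ (repMap m n x₀ y₀ φ) (ch m x₀ x) w)).trans ?_)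
  · refine congrArg₂ (fun a b : Euc n => a + b)
      (congrArg₂ (fun (a : ℝ) (b : Euc n) => a • b) (h4 (p - 2)) (h1 w))
      (congrArg₂ (fun (a : ℝ) (b : Euc n) => a • b) ?_ (h2 w))
    rw [h3, h4]
  · rw [show (p - 4) / 2 = (p - 2) / 2 - 1 by ring, show p - 2 = 2 * ((p - 2) / 2) by ring]
    simp only [linForm, linMap, fnormSq, _root_.add_apply, _root_.smul_apply,
      show 2 * ((p - 2) / 2) / 2 = (p - 2) / 2 by ring]

/-- Since `green` depends on no choice of charts, this shows that the forms `greenForm` of different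
charts define one and the same one-form. -/
theorem green_eq {W V : ∀ x, TangentSpace (𝓡 n) (φ x)} {Y X : Euc m → Euc n}
    (hW : ∀ᶠ z in 𝓝 (ch m x₀ x), W ((ch m x₀).symm z) =
      coordL n y₀ (φ ((ch m x₀).symm z)) (Y z)) (hY : ContDiffAt ℝ 1 Y (ch m x₀ x))
    (hV : ∀ᶠ z in 𝓝 (ch m x₀ x), V ((ch m x₀).symm z) =
      coordL n y₀ (φ ((ch m x₀).symm z)) (X z)) (hX : ContDiffAt ℝ 1 X (ch m x₀ x)) (w : Euc m) :
    green p g h φ W V x (coordL m x₀ x w) = greenForm (metE g x₀) (metE h y₀)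
      (repMap m n x₀ y₀ φ) ((p - 2) / 2) Y X (ch m x₀ x) w := by
  have hWx := hW.self_of_nhds
  have hVx := hV.self_of_nhds
  rw [(ch m x₀).left_inv hx] at hWx hVx
  have h1 : innerForm h (φ x) (W x) (linHom p g h φ V x (coordL m x₀ x w)) = _ :=
    (congrArg₂ (fun a b => innerForm h (φ x) a b) hWx
      (linHom_eq p g h hφ hx hy hV hX w)).trans (inner_coordL h hy _ _)
  have h2 : innerForm h (φ x) (V x) (linHom p g h φ W x (coordL m x₀ x w)) = _ :=
    (congrArg₂ (fun a b => innerForm h (φ x) a b) hVx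
      (linHom_eq p g h hφ hx hy hW hY w)).trans (inner_coordL h hy _ _)
  rw [green, h1, h2, ← repMap_ch y₀ φ hx]
  rfl

end Green

end

/-! ### Local expressions of a variation: continuity and regularity. -/

section
variable {m n : ℕ}
  {M : Type*} [TopologicalSpace M] [ChartedSpace (EuclideanSpace ℝ (Fin m)) M]
  [IsManifold (𝓡 m) ∞ M]
  {N : Type*} [TopologicalSpace N] [ChartedSpace (EuclideanSpace ℝ (Fin n)) N]
  [IsManifold (𝓡 n) ∞ N]

section Family

variable (p q : ℝ) (g : Metric m M) (h : Metric n N) (x₀ : M) (y₀ : N) (Φ : ℝ → M → N)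

/-- The variation field of a family in the charts at `x₀` and `y₀`. -/
def chartVelocity (m n : ℕ) {M : Type*} [TopologicalSpace M]
    [ChartedSpace (EuclideanSpace ℝ (Fin m)) M]
    {N : Type*} [TopologicalSpace N] [ChartedSpace (EuclideanSpace ℝ (Fin n)) N]
    (x₀ : M) (y₀ : N) (Φ : ℝ → M → N) (z : Euc m) : Euc n :=
  fderiv ℝ (famMap m n x₀ y₀ Φ) (0, z) (timeDir m)

/-- The `p`-tension fields of a family in the charts at `x₀` and `y₀`. -/
def chartTension (a : ℝ × Euc m) : Euc n :=
  tension (metE g x₀) (metE h y₀) (famMap m n x₀ y₀ Φ) ((p - 2) / 2) a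

/-- The norms of the `p`-tension fields of a family in the charts at `x₀` and `y₀`. -/
def chartTensionNorm (a : ℝ × Euc m) : ℝ :=
  √(metE h y₀ (famMap m n x₀ y₀ Φ a) (chartTension p g h x₀ y₀ Φ a)
    (chartTension p g h x₀ y₀ Φ a))

/-- The field `|τ_p|^{q-2} τ_p` of the map `Φ 0` in the charts at `x₀` and `y₀`. -/
def chartWeighted (z : Euc m) : Euc n :=
  chartTensionNorm p g h x₀ y₀ Φ (0, z) ^ (q - 2) • chartTension p g h x₀ y₀ Φ (0, z)

/-- The density `|τ_p(Φ t)|^q`. -/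
def density (t : ℝ) (x : M) : ℝ := vnorm h (Φ t x) (pTension p g h (Φ t) x) ^ q

/-- The regularity hypotheses at the point `z` of the chart at `x₀`. -/
structure IsRegularAt (z : Euc m) : Prop where
  weight : 0 < normSq (metE g x₀) (metE h y₀) (famMap m n x₀ y₀ Φ) (0, z) ∨ (p - 2) / 2 = 0 ∨
    1 < 2 * ((p - 2) / 2)
  smooth : ContDiffAt ℝ 2 (chartWeighted p q g h x₀ y₀ Φ) z

end Family

variable {p q : ℝ} (hp : 2 ≤ p) (hq : 2 ≤ q) (g : Metric m M) (h : Metric n N)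
  {Φ : ℝ → M → N} {ε : ℝ}
  (hΦ : ContMDiffOn (𝓘(ℝ, ℝ).prod (𝓡 m)) (𝓡 n) ∞ (fun a : ℝ × M => Φ a.1 a.2)
    (Ioo (-ε) ε ×ˢ univ))
  {x₀ x : M} {y₀ : N}

section Continuity

omit [IsManifold (𝓡 m) ∞ M] in
theorem tendsto_chart (t : ℝ) {x₀ x : M} (hx : x ∈ (ch m x₀).source) :
    Filter.Tendsto (fun a : ℝ × M => ((a.1, ch m x₀ a.2) : ℝ × Euc m)) (𝓝 (t, x))
      (𝓝 (t, ch m x₀ x)) := by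
  refine ContinuousAt.prodMk continuousAt_fst ?_
  exact ContinuousAt.comp (f := (Prod.snd : ℝ × M → M)) (x := (t, x))
    (continuousAt_extChartAt' (I := 𝓡 m) hx) continuousAt_snd

variable {t : ℝ} (ht : t ∈ Ioo (-ε) ε)
include hp hΦ ht

theorem eventually_density_eq (q : ℝ) (hx : x ∈ (ch m x₀).source)
    (hy : Φ t x ∈ (ch n y₀).source) : ∀ᶠ a in 𝓝 (t, x), density p q g h Φ a.1 a.2 =
      chartTensionNorm p g h x₀ y₀ Φ (a.1, ch m x₀ a.2) ^ q := by
  filter_upwards [(continuous_fst.tendsto (t, x)).eventually (isOpen_Ioo.mem_nhds ht),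
    (continuous_snd.tendsto (t, x)).eventually ((isOpen_extChartAt_source x₀).mem_nhds hx),
    (contMDiffAt_family hΦ ht x).continuousAt.eventually
      ((isOpen_extChartAt_source y₀).mem_nhds hy)] with a h1 h2 h3
  rw [density, vnorm_pTension_family hΦ h1 h2 h3 g h hp]
  rfl

theorem continuousAt_chartTension (hx : x ∈ (ch m x₀).source)
    (hy : Φ t x ∈ (ch n y₀).source) :
    ContinuousAt (chartTension p g h x₀ y₀ Φ) (t, ch m x₀ x) :=
  continuousAt_tension (isMetricOn_metE g x₀) (isMetricOn_metE h y₀) ((ch m x₀).map_source hx)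
    (famMap_mem hx hy) (contDiffAt_famMap hΦ ht hx hy) (by linarith)

theorem continuousAt_density {q : ℝ} (hq : 0 ≤ q) (x : M) : ContinuousAt (density p q g h Φ t) x := by
  have hx := mem_extChartAt_source (I := 𝓡 m) x
  have hy := mem_extChartAt_source (I := 𝓡 n) (Φ t x)
  have h1 := continuousAt_chartTension hp g h hΦ ht hx hy
  have h2 : ContinuousAt (fun a => metE h (Φ t x) (famMap m n x (Φ t x) Φ a)) (t, ch m x x) :=
    ((isMetricOn_metE h (Φ t x)).contDiffAt (famMap_mem hx hy)).continuousAt.comp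
      (contDiffAt_famMap hΦ ht hx hy).continuousAt
  have h3 : ContinuousAt (fun a => chartTensionNorm p g h x (Φ t x) Φ a ^ q) (t, ch m x x) :=
    ((h2.clm_apply h1).clm_apply h1).sqrt.rpow_const (Or.inr hq)
  have h4 : ContinuousAt (fun a : ℝ × M => density p q g h Φ a.1 a.2) (t, x) :=
    (ContinuousAt.comp (x := (t, x)) (f := fun a : ℝ × M => ((a.1, ch m x a.2) : ℝ × Euc m))
      h3 (tendsto_chart t hx)).congr
      ((eventually_density_eq hp g h hΦ ht q hx hy).mono fun _ ha => ha.symm)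
  exact h4.comp (f := fun y : M => (t, y)) (x := x) (by fun_prop)

end Continuity

variable (h0 : (0 : ℝ) ∈ Ioo (-ε) ε) (hx : x ∈ (ch m x₀).source) (hy : Φ 0 x ∈ (ch n y₀).source)

section Fields

include hΦ h0 hx hy

theorem weightedTension_eq (hp : 2 ≤ p) (q : ℝ) : weightedTension p q g h (Φ 0) x =
    coordL n y₀ (Φ 0 x) (chartWeighted p q g h x₀ y₀ Φ (ch m x₀ x)) :=
  (congrArg₂ (fun (a : ℝ) (b : Euc n) => a ^ (q - 2) • b)
    (vnorm_pTension_family hΦ h0 hx hy g h hp) (pTension_family hΦ h0 hx hy g h hp)).trans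
    (map_smul _ _ _).symm

theorem eventually_weightedTension_eq (hp : 2 ≤ p) (q : ℝ) : ∀ᶠ z in 𝓝 (ch m x₀ x),
    weightedTension p q g h (Φ 0) ((ch m x₀).symm z) =
      coordL n y₀ (Φ 0 ((ch m x₀).symm z)) (chartWeighted p q g h x₀ y₀ Φ z) :=
  eventually_chart (contMDiff_slice hΦ h0) hx hy fun x' hx' hy' => by
    rw [(ch m x₀).left_inv hx']
    exact weightedTension_eq g h hΦ h0 hx' hy' hp q

theorem eventually_variationField_eq : ∀ᶠ z in 𝓝 (ch m x₀ x),
    variationField n Φ ((ch m x₀).symm z) =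
      coordL n y₀ (Φ 0 ((ch m x₀).symm z)) (chartVelocity m n x₀ y₀ Φ z) :=
  eventually_chart (contMDiff_slice hΦ h0) hx hy fun x' hx' hy' => by
    rw [(ch m x₀).left_inv hx']
    exact variationField_eq hΦ hx' h0 hy'

theorem contDiffAt_chartVelocity : ContDiffAt ℝ ∞ (chartVelocity m n x₀ y₀ Φ) (ch m x₀ x) := by
  have h1 : ContDiffAt ℝ ∞ (fun a => fderiv ℝ (famMap m n x₀ y₀ Φ) a (timeDir m))
      (0, ch m x₀ x) :=
    ((contDiffAt_famMap hΦ h0 hx hy).fderiv_right (m := ∞) (by simp)).clm_apply contDiffAt_const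
  exact h1.comp (ch m x₀ x) (contDiff_slice 0).contDiffAt

end Fields

section Regular

include hΦ h0 hp

/-- A map into the tangent bundle of `N` is `C²` only if its fibre component in the trivialisation
is; this component is the field in the charts at `x₀` and `Φ 0 x₀`. -/
theorem contDiffAt_chartWeighted
    (hW : ContMDiffAt (𝓡 m) (𝓡 n).tangent 2
      (fun y => (⟨Φ 0 y, weightedTension p q g h (Φ 0) y⟩ : TangentBundle (𝓡 n) N)) x₀) :
    ContDiffAt ℝ 2 (chartWeighted p q g h x₀ (Φ 0 x₀) Φ) (ch m x₀ x₀) := by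
  have hx := mem_extChartAt_source (I := 𝓡 m) x₀
  have hy := mem_extChartAt_source (I := 𝓡 n) (Φ 0 x₀)
  have h1 := ((contMDiffAt_totalSpace
    (E := fun y : N => TangentSpace (𝓡 n) y)).1 hW).2
  have h2 := ((contMDiffAt_iff_of_mem_source (mem_chart_source (Euc m) x₀)
    (mem_chart_source (Euc n) _)).1 h1).2
  rw [modelWithCornersSelf_coe, range_id, contDiffWithinAt_univ] at h2
  refine h2.congr_of_eventuallyEq ?_
  filter_upwards [eventually_weightedTension_eq g h hΦ h0 hx hy hp q,
    eventually_map_mem hx (contMDiff_slice hΦ h0).continuous.continuousAt hy] with z k1 k2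
  refine Eq.symm ((trivializationAt_snd (Φ 0 x₀) _ _).trans ?_)
  exact (congrArg (coordInv n (Φ 0 x₀) (Φ 0 ((ch m x₀).symm z))) k1).trans
    (coordInv_coordL k2 _)

/-- Regularity is an open condition: it persists around a point of `D`, including outside `D`. This
allows `D` to have an arbitrary boundary. -/
theorem eventually_isRegularAt {D : Set M} (hreg : IsRegularOn p q g h (Φ 0) D) (hD : x₀ ∈ D) :
    ∀ᶠ z in 𝓝 (ch m x₀ x₀), IsRegularAt p q g h x₀ (Φ 0 x₀) Φ z := by
  have hx := mem_extChartAt_source (I := 𝓡 m) x₀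
  have hy := mem_extChartAt_source (I := 𝓡 n) (Φ 0 x₀)
  have h1 : ∀ᶠ z in 𝓝 (ch m x₀ x₀),
      0 < normSq (metE g x₀) (metE h (Φ 0 x₀)) (famMap m n x₀ (Φ 0 x₀) Φ) (0, z) ∨
      (p - 2) / 2 = 0 ∨ 1 < 2 * ((p - 2) / 2) := by
    rcases hreg.1 with h2 | h3 | h4
    · exact Filter.Eventually.of_forall fun z => Or.inr (Or.inl (by rw [h2]; norm_num))
    · exact Filter.Eventually.of_forall fun z => Or.inr (Or.inr (by linarith))
    · have h5 := fnormSq_pos g h hx hy (contMDiff_slice hΦ h0).contMDiffAt (h4 x₀ hD)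
      rw [fnormSq_eq_normSq hΦ h0 hx hy] at h5
      have h6 := (contDiffAt_normSq (isMetricOn_metE g x₀) (isMetricOn_metE h (Φ 0 x₀))
        ((ch m x₀).map_source hx) (famMap_mem hx hy)
        (contDiffAt_famMap hΦ h0 hx hy)).continuousAt
      have h7 : ContinuousAt (fun z : Euc m => normSq (metE g x₀) (metE h (Φ 0 x₀))
          (famMap m n x₀ (Φ 0 x₀) Φ) (0, z)) (ch m x₀ x₀) :=
        h6.comp (f := fun z : Euc m => ((0, z) : ℝ × Euc m))
          (contDiff_slice 0).continuous.continuousAt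
      exact (h7.eventually (lt_mem_nhds h5)).mono fun z hz => Or.inl hz
  have h2 := contDiffAt_chartWeighted hp g h hΦ h0 (hreg.2 x₀ hD)
  filter_upwards [h1, h2.eventually (by simp)] with z k1 k2
  exact ⟨k1, k2⟩

end Regular

end

/-! ### The derivative of the energy density, and the Green form of a variation. -/

section
variable {m n : ℕ}
  {M : Type*} [TopologicalSpace M] [ChartedSpace (EuclideanSpace ℝ (Fin m)) M]
  [IsManifold (𝓡 m) ∞ M]
  {N : Type*} [TopologicalSpace N] [ChartedSpace (EuclideanSpace ℝ (Fin n)) N]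
  [IsManifold (𝓡 n) ∞ N]

variable {p q : ℝ} (hp : 2 ≤ p) (hq : 2 ≤ q) (g : Metric m M) (h : Metric n N)
  {Φ : ℝ → M → N} {ε : ℝ}
  (hΦ : ContMDiffOn (𝓘(ℝ, ℝ).prod (𝓡 m)) (𝓡 n) ∞ (fun a : ℝ × M => Φ a.1 a.2)
    (Ioo (-ε) ε ×ˢ univ)) (h0 : (0 : ℝ) ∈ Ioo (-ε) ε)
  {x₀ x : M} {y₀ : N} (hx : x ∈ (ch m x₀).source) (hy : Φ 0 x ∈ (ch n y₀).source)

section Density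

include hp hq hΦ h0 hx hy

/-- The derivative of the energy density in the charts at `x₀` and `y₀`. -/
theorem chartDensity_deriv (hr : IsRegularAt p q g h x₀ y₀ Φ (ch m x₀ x)) :
    ContDiffAt ℝ 1 (fun a => chartTensionNorm p g h x₀ y₀ Φ a ^ q) (0, ch m x₀ x) ∧
    fderiv ℝ (fun a => chartTensionNorm p g h x₀ y₀ Φ a ^ q) (0, ch m x₀ x) (timeDir m) =
      q * metE h y₀ (famMap m n x₀ y₀ Φ (0, ch m x₀ x))
        (chartWeighted p q g h x₀ y₀ Φ (ch m x₀ x))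
        (covE (metE h y₀) (famMap m n x₀ y₀ Φ) (chartTension p g h x₀ y₀ Φ) (0, ch m x₀ x)
          (timeDir m)) := by
  have hf := contDiffAt_famMap hΦ h0 hx hy
  exact energy_density (isMetricOn_metE h y₀) (famMap_mem hx hy) hf
    (contDiffAt_tension_one (isMetricOn_metE g x₀) (isMetricOn_metE h y₀) ((ch m x₀).map_source hx)
      (famMap_mem hx hy) hf (by linarith) hr.weight) hq (timeDir m)

/-- Differentiability is needed near `(0, x)` jointly in time and space, to dominate the difference
quotients later; it follows since being `C¹` at the point implies being `C¹` nearby. -/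
theorem eventually_hasDerivAt_density (hr : IsRegularAt p q g h x₀ y₀ Φ (ch m x₀ x)) :
    ∀ᶠ a in 𝓝 ((0 : ℝ), x), HasDerivAt (fun s => density p q g h Φ s a.2)
      (fderiv ℝ (fun b => chartTensionNorm p g h x₀ y₀ Φ b ^ q) (a.1, ch m x₀ a.2) (timeDir m))
      a.1 := by
  have h1 := (chartDensity_deriv hp hq g h hΦ h0 hx hy hr).1
  filter_upwards [(tendsto_chart 0 hx).eventually (h1.eventually (by simp)),
    (eventually_density_eq hp g h hΦ h0 q hx hy).eventually_nhds] with a k1 k2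
  refine (hasDerivAt_time (k1.differentiableAt (by simp))).congr_of_eventuallyEq ?_
  have h2 : ContinuousAt (fun s : ℝ => (s, a.2)) a.1 := by fun_prop
  exact h2.eventually k2

theorem continuousAt_deriv_density (hr : IsRegularAt p q g h x₀ y₀ Φ (ch m x₀ x)) :
    ContinuousAt (fun a : ℝ × M => deriv (fun s => density p q g h Φ s a.2) a.1) (0, x) := by
  have h1 := (chartDensity_deriv hp hq g h hΦ h0 hx hy hr).1
  have h2 : ContinuousAt (fun a : ℝ × M =>
      fderiv ℝ (fun b => chartTensionNorm p g h x₀ y₀ Φ b ^ q) (a.1, ch m x₀ a.2) (timeDir m))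
      (0, x) :=
    (ContinuousAt.comp (x := ((0 : ℝ), x))
      (f := fun a : ℝ × M => ((a.1, ch m x₀ a.2) : ℝ × Euc m))
      (h1.continuousAt_fderiv (by simp)) (tendsto_chart 0 hx)).clm_apply continuousAt_const
  refine h2.congr ?_
  filter_upwards [eventually_hasDerivAt_density hp hq g h hΦ h0 hx hy hr] with a ha
  exact ha.deriv.symm

/-- The integrand of the first variation formula is a divergence. -/
theorem deriv_density_add (hr : IsRegularAt p q g h x₀ y₀ Φ (ch m x₀ x)) :
    q⁻¹ * deriv (fun s => density p q g h Φ s x) 0 +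
      innerForm h (Φ 0 x) (variationField n Φ x) (pqTension p q g h (Φ 0) x) =
    divForm (metE g x₀) (greenForm (metE g x₀) (metE h y₀) (repMap m n x₀ y₀ (Φ 0)) ((p - 2) / 2)
      (chartWeighted p q g h x₀ y₀ Φ) (chartVelocity m n x₀ y₀ Φ)) (ch m x₀ x) := by
  have h1 := (eventually_hasDerivAt_density hp hq g h hΦ h0 hx hy hr).self_of_nhds.deriv
  have h2 := (chartDensity_deriv hp hq g h hΦ h0 hx hy hr).2
  have h3 := pqTension_eq g h (contMDiff_slice hΦ h0) hx hy q
    (eventually_weightedTension_eq g h hΦ h0 hx hy hp q) hr.smooth (by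
      rw [fnormSq_eq_normSq hΦ h0 hx hy]
      exact hr.weight)
  have h4 := (congrArg₂ (fun a b => innerForm h (Φ 0 x) a b) (variationField_eq hΦ hx h0 hy)
    h3).trans (inner_coordL h hy _ _)
  have h5 := first_variation_identity (isMetricOn_metE g x₀) (isMetricOn_metE h y₀)
    ((ch m x₀).map_source hx) (famMap_mem hx hy) (contDiffAt_famMap hΦ h0 hx hy)
    (eventually_contDiffAt_famMap hΦ h0 hx hy) (s := (p - 2) / 2) (by linarith) hr.weight hr.smooth
  refine Eq.trans ?_ h5
  refine congrArg₂ (fun a b : ℝ => a + b) ?_ (h4.trans ?_)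
  · simp only at h1
    rw [h1, h2, inv_mul_cancel_left₀ (by linarith)]
    rfl
  · rw [← repMap_ch y₀ (Φ 0) hx, fnormSq_eq_normSq hΦ h0 hx hy, fderiv_repMap_eq hΦ h0 hx hy]
    rfl

end Density

section Green

include hΦ h0 hx hy

theorem green_chart (hp : 2 ≤ p) (hr : IsRegularAt p q g h x₀ y₀ Φ (ch m x₀ x)) (w : Euc m) :
    green p g h (Φ 0) (weightedTension p q g h (Φ 0)) (variationField n Φ) x (coordL m x₀ x w) =
      greenForm (metE g x₀) (metE h y₀) (repMap m n x₀ y₀ (Φ 0)) ((p - 2) / 2)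
        (chartWeighted p q g h x₀ y₀ Φ) (chartVelocity m n x₀ y₀ Φ) (ch m x₀ x) w :=
  green_eq p g h (contMDiff_slice hΦ h0) hx hy
    (eventually_weightedTension_eq g h hΦ h0 hx hy hp q) (hr.smooth.of_le (by norm_num))
    (eventually_variationField_eq hΦ h0 hx hy)
    ((contDiffAt_chartVelocity hΦ h0 hx hy).of_le (by simp)) w

theorem contDiffAt_green_chart (hr : IsRegularAt p q g h x₀ y₀ Φ (ch m x₀ x)) :
    ContDiffAt ℝ 1 (greenForm (metE g x₀) (metE h y₀) (repMap m n x₀ y₀ (Φ 0)) ((p - 2) / 2)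
      (chartWeighted p q g h x₀ y₀ Φ) (chartVelocity m n x₀ y₀ Φ)) (ch m x₀ x) :=
  contDiffAt_greenForm (isMetricOn_metE g x₀) (isMetricOn_metE h y₀) ((ch m x₀).map_source hx)
    (famMap_mem (Φ := Φ) (t := 0) hx hy)
    (contDiffAt_repMap hx hy (contMDiff_slice hΦ h0).contMDiffAt)
    (by
      rw [fnormSq_eq_normSq hΦ h0 hx hy]
      exact hr.weight) hr.smooth
    ((contDiffAt_chartVelocity hΦ h0 hx hy).of_le ENat.LEInfty.out)

theorem eventually_chartVelocity_eq_zero {D : Set M} (hD : IsClosed D)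
    (hsupp : ∀ t ∈ Ioo (-ε) ε, ∀ x ∉ D, Φ t x = Φ 0 x) (hxD : x ∉ D) :
    ∀ᶠ z in 𝓝 (ch m x₀ x), chartVelocity m n x₀ y₀ Φ z = 0 := by
  filter_upwards [(tendsto_symm hx).eventually (hD.isOpen_compl.mem_nhds hxD),
    eventually_chart (contMDiff_slice hΦ h0) hx hy
      (P := fun z => DifferentiableAt ℝ (famMap m n x₀ y₀ Φ) (0, z)) (fun x' hx' hy' =>
        (contDiffAt_famMap hΦ h0 hx' hy').differentiableAt (by simp))] with z k1 k2
  refine (hasDerivAt_time k2).unique ((hasDerivAt_const (0 : ℝ)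
    (famMap m n x₀ y₀ Φ (0, z))).congr_of_eventuallyEq ?_)
  filter_upwards [isOpen_Ioo.mem_nhds h0] with s hs
  simp only [famMap, repMap]
  rw [hsupp s hs _ k1]

theorem eventually_green_eq_zero {D : Set M} (hD : IsClosed D)
    (hsupp : ∀ t ∈ Ioo (-ε) ε, ∀ x ∉ D, Φ t x = Φ 0 x) (hxD : x ∉ D) (W : Euc m → Euc n) (s : ℝ) :
    ∀ᶠ z in 𝓝 (ch m x₀ x), greenForm (metE g x₀) (metE h y₀) (repMap m n x₀ y₀ (Φ 0)) s W
      (chartVelocity m n x₀ y₀ Φ) z = 0 := by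
  filter_upwards [(eventually_chartVelocity_eq_zero hΦ h0 hx hy hD hsupp hxD).eventually_nhds]
    with z hz
  have h1 : covL (metE h y₀) (repMap m n x₀ y₀ (Φ 0)) (chartVelocity m n x₀ y₀ Φ) z = 0 := by
    have h2 : chartVelocity m n x₀ y₀ Φ =ᶠ[𝓝 z] fun _ => 0 := hz
    rw [covL, h2.fderiv_eq, hz.self_of_nhds]
    simp
  simp [greenForm, pairForm, linForm, linMap, h1, hz.self_of_nhds]

end Green

end

/-! ### The first variation formula. -/

section
variable {m n : ℕ}
  {M : Type*} [TopologicalSpace M] [T2Space M] [ChartedSpace (EuclideanSpace ℝ (Fin m)) M]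
  [IsManifold (𝓡 m) ∞ M] [MeasurableSpace M] [BorelSpace M]
  {N : Type*} [TopologicalSpace N] [ChartedSpace (EuclideanSpace ℝ (Fin n)) N]
  [IsManifold (𝓡 n) ∞ N]

variable {p q : ℝ} (hp : 2 ≤ p) (hq : 2 ≤ q) (g : Metric m M) (h : Metric n N)
  {Φ : ℝ → M → N} {ε : ℝ}
  (hΦ : ContMDiffOn (𝓘(ℝ, ℝ).prod (𝓡 m)) (𝓡 n) ∞ (fun a : ℝ × M => Φ a.1 a.2)
    (Ioo (-ε) ε ×ˢ univ))
  {D : Set M} (hD : IsCompact D)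

include hp hΦ hD in
theorem integrableOn_density {t : ℝ} (ht : t ∈ Ioo (-ε) ε) (hq : 0 ≤ q) :
    IntegrableOn (density p q g h Φ t) D (riemannianVolume g) :=
  ContinuousOn.integrableOn_compact hD fun x _ =>
    (continuousAt_density hp g h hΦ ht hq x).continuousWithinAt

variable (h0 : (0 : ℝ) ∈ Ioo (-ε) ε) (hreg : IsRegularOn p q g h (Φ 0) D)
include hp hq hΦ hD h0 hreg

omit [T2Space M] [MeasurableSpace M] [BorelSpace M] hD in
theorem continuousOn_deriv_density :
    ContinuousOn (fun x => deriv (fun s => density p q g h Φ s x) 0) D := fun x hx => by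
  have h1 := continuousAt_deriv_density hp hq g h hΦ h0 (mem_extChartAt_source (I := 𝓡 m) x)
    (mem_extChartAt_source (I := 𝓡 n) (Φ 0 x))
    (eventually_isRegularAt hp g h hΦ h0 hreg hx).self_of_nhds
  exact (h1.comp (f := fun y : M => ((0 : ℝ), y)) (x := x) (by fun_prop)).continuousWithinAt

/-- Differentiation of the energy under the integral sign. -/
theorem hasDerivAt_integral_density :
    HasDerivAt (fun t => ∫ x in D, density p q g h Φ t x ∂(riemannianVolume g))
      (∫ x in D, deriv (fun s => density p q g h Φ s x) 0 ∂(riemannianVolume g)) 0 := by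
  have hc := continuousOn_deriv_density hp hq g h hΦ h0 hreg
  obtain ⟨C, hC⟩ := hD.exists_bound_of_continuousOn hc
  -- `C` bounds the time derivative on `D` at time zero. Its joint continuity at the points `(0, x)`
  -- gives the bound `C + 1` nearby, and compactness of `D` makes the time interval uniform in `x`.
  have h1 : ∀ᶠ t in 𝓝 (0 : ℝ), ∀ x ∈ D, DifferentiableAt ℝ (fun s => density p q g h Φ s x) t ∧
      ‖deriv (fun s => density p q g h Φ s x) t‖ ≤ C + 1 := by
    refine hD.eventually_forall_of_forall_eventually fun x hx => ?_
    have hxs := mem_extChartAt_source (I := 𝓡 m) x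
    have hys := mem_extChartAt_source (I := 𝓡 n) (Φ 0 x)
    have hr := (eventually_isRegularAt hp g h hΦ h0 hreg hx).self_of_nhds
    have h2 := (continuousAt_deriv_density hp hq g h hΦ h0 hxs hys hr).norm
    filter_upwards [eventually_hasDerivAt_density hp hq g h hΦ h0 hxs hys hr,
      h2.eventually (gt_mem_nhds (lt_of_le_of_lt (hC x hx) (lt_add_one C)))] with a k1 k2
    exact ⟨k1.differentiableAt, k2.le⟩
  have hm : IsFiniteMeasure ((riemannianVolume g).restrict D) :=
    ⟨by simpa using hD.measure_lt_top⟩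
  refine (hasDerivAt_integral_of_dominated_loc_of_deriv_le (bound := fun _ => C + 1)
    (F := fun t x => density p q g h Φ t x)
    (F' := fun t x => deriv (fun s => density p q g h Φ s x) t) (s := {t | ∀ x ∈ D,
      DifferentiableAt ℝ (fun s => density p q g h Φ s x) t ∧
      ‖deriv (fun s => density p q g h Φ s x) t‖ ≤ C + 1}) h1 ?_ ?_ ?_ ?_ ?_ ?_).2
  · filter_upwards [isOpen_Ioo.mem_nhds h0] with t ht
    exact (integrableOn_density hp g h hΦ hD ht (by linarith)).aestronglyMeasurable
  · exact integrableOn_density hp g h hΦ hD h0 (by linarith)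
  · exact (hc.integrableOn_compact hD).aestronglyMeasurable
  · exact ae_restrict_of_forall_mem hD.measurableSet fun x hx t ht => (ht x hx).2
  · exact integrable_const _
  · exact ae_restrict_of_forall_mem hD.measurableSet fun x hx t ht => (ht x hx).1.hasDerivAt

variable [SecondCountableTopology M]
  (hsupp : ∀ t ∈ Ioo (-ε) ε, ∀ x ∉ D, Φ t x = Φ 0 x)
include hsupp

/-- The integrand is the divergence of the Green form of `W` and the variation field. Since the
field vanishes off `D`, so do the form and its divergence; the form is `C¹` across the boundary of
`D` because regularity is open. -/
theorem integral_divergence_eq_zero :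
    ∫ x in D, (q⁻¹ * deriv (fun s => density p q g h Φ s x) 0 +
      innerForm h (Φ 0 x) (variationField n Φ x) (pqTension p q g h (Φ 0) x))
      ∂(riemannianVolume g) = 0 ∧
    ContinuousOn (fun x => q⁻¹ * deriv (fun s => density p q g h Φ s x) 0 +
      innerForm h (Φ 0 x) (variationField n Φ x) (pqTension p q g h (Φ 0) x)) D := by
  set F : M → ℝ := fun x => q⁻¹ * deriv (fun s => density p q g h Φ s x) 0 +
      innerForm h (Φ 0 x) (variationField n Φ x) (pqTension p q g h (Φ 0) x) with hF
  set γ : M → N → Euc m → Euc m →L[ℝ] ℝ := fun x y =>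
    greenForm (metE g x) (metE h y) (repMap m n x y (Φ 0)) ((p - 2) / 2)
      (chartWeighted p q g h x y Φ) (chartVelocity m n x y Φ) with hγ
  -- The Green form read at each point in the charts centred there, and set to zero off `D`. Near a
  -- point of `D` it must be compared with the form in one fixed pair of charts.
  set θ : M → Euc m →L[ℝ] ℝ := D.indicator fun x => γ x (Φ 0 x) (ch m x x) with hθ
  have hφ := contMDiff_slice hΦ h0
  have key : ∀ x ∈ D, ∀ᶠ z in 𝓝 (ch m x x), chartForm θ x z = γ x (Φ 0 x) z ∧
      ContDiffAt ℝ 1 (γ x (Φ 0 x)) z ∧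
      D.indicator F ((ch m x).symm z) = divForm (metE g x) (γ x (Φ 0 x)) z := by
    intro x hxD
    have hx := mem_extChartAt_source (I := 𝓡 m) x
    have hy := mem_extChartAt_source (I := 𝓡 n) (Φ 0 x)
    filter_upwards [eventually_isRegularAt hp g h hΦ h0 hreg hxD, eventually_mem_source hx,
      eventually_map_mem hx hφ.continuous.continuousAt hy] with z hr hz hzy
    obtain ⟨x', hx', rfl⟩ : ∃ x' ∈ (ch m x).source, ch m x x' = z :=
      ⟨_, (ch m x).map_target hz, (ch m x).right_inv hz⟩
    rw [(ch m x).left_inv hx'] at hzy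
    refine ⟨?_, contDiffAt_green_chart g h hΦ h0 hx' hzy hr, ?_⟩
    · ext w
      rw [chartForm, (ch m x).left_inv hx', ContinuousLinearMap.comp_apply]
      by_cases hD' : x' ∈ D
      · have hxx := mem_extChartAt_source (I := 𝓡 m) x'
        have hyy := mem_extChartAt_source (I := 𝓡 n) (Φ 0 x')
        have hr' := (eventually_isRegularAt hp g h hΦ h0 hreg hD').self_of_nhds
        -- The form in the charts centred at `x'` and the form in the charts at `x` both represent
        -- `green` at `x'`, hence agree.
        have k1 := green_chart g h hΦ h0 hxx hyy hp hr' (coordL m x x' w)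
        rw [coordL_self] at k1
        rw [hθ, indicator_of_mem hD', hγ]
        simp only
        rw [← k1]
        exact green_chart g h hΦ h0 hx' hzy hp hr w
      · rw [hθ, indicator_of_notMem hD', hγ]
        simp only
        rw [(eventually_green_eq_zero g h hΦ h0 hx' hzy hD.isClosed hsupp hD' _ _).self_of_nhds]
        rfl
    · rw [(ch m x).left_inv hx']
      by_cases hD' : x' ∈ D
      · rw [indicator_of_mem hD']
        exact deriv_density_add hp hq g h hΦ h0 hx' hzy hr
      · have k1 : γ x (Φ 0 x) =ᶠ[𝓝 (ch m x x')] fun _ => 0 :=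
          eventually_green_eq_zero g h hΦ h0 hx' hzy hD.isClosed hsupp hD' _ _
        rw [indicator_of_notMem hD', divForm, k1.fderiv_eq, k1.self_of_nhds]
        simp [formTrace]
  obtain ⟨h1, h2⟩ := integral_divForm_eq_zero g hD (G := D.indicator F) (θ := θ)
    (fun x hx => indicator_of_notMem hx _) (fun x hx => indicator_of_notMem hx _) (by
      intro x hxD
      filter_upwards [(key x hxD).eventually_nhds] with z hz
      have k1 : chartForm θ x =ᶠ[𝓝 z] γ x (Φ 0 x) := hz.mono fun _ hy => hy.1
      obtain ⟨k2, k3, k4⟩ := hz.self_of_nhds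
      refine ⟨k3.congr_of_eventuallyEq k1, k4.trans ?_⟩
      rw [divForm, divForm, k1.fderiv_eq, k1.self_of_nhds])
  rw [integral_indicator hD.measurableSet] at h1
  exact ⟨h1, h2.continuousOn.congr fun x hx => (indicator_of_mem hx _).symm⟩

/-- The first variation formula. -/
theorem first_variation_of_family :
    ContinuousOn (fun x => innerForm h (Φ 0 x) (variationField n Φ x) (pqTension p q g h (Φ 0) x))
      D ∧
    HasDerivAt (fun t => pqEnergy p q g h (Φ t) D)
      (-∫ x in D, innerForm h (Φ 0 x) (variationField n Φ x) (pqTension p q g h (Φ 0) x)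
        ∂(riemannianVolume g)) 0 := by
  obtain ⟨h1, h2⟩ := integral_divergence_eq_zero hp hq g h hΦ hD h0 hreg hsupp
  have h3 : ContinuousOn (fun x => q⁻¹ * deriv (fun s => density p q g h Φ s x) 0) D :=
    (continuousOn_deriv_density hp hq g h hΦ h0 hreg).const_mul _
  -- The pairing with `τ_{p,q}` is continuous as the difference of two continuous functions, the
  -- divergence and the time derivative of the density.
  have h4 : ContinuousOn (fun x =>
      innerForm h (Φ 0 x) (variationField n Φ x) (pqTension p q g h (Φ 0) x)) D :=
    (h2.sub h3).congr fun x _ => by simp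
  refine ⟨h4, ?_⟩
  rw [integral_add (h3.integrableOn_compact hD) (h4.integrableOn_compact hD)] at h1
  rw [← eq_neg_of_add_eq_zero_left h1, integral_const_mul]
  have := (hasDerivAt_integral_density hp hq g h hΦ hD h0 hreg).const_mul q⁻¹
  refine this.congr_of_eventuallyEq (Filter.Eventually.of_forall fun t => ?_)
  change 1 / q * ∫ x in D, density p q g h Φ t x ∂(riemannianVolume g) = _
  rw [one_div]

omit hΦ h0 hreg hsupp in
/-- The first variation formula for a variation of `φ`. -/
theorem IsVariation.first_variation {φ : M → N} (hε : 0 < ε) (hv : IsVariation m n φ D ε Φ)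
    (hreg : IsRegularOn p q g h φ D) :
    (∀ t ∈ Ioo (-ε) ε, IntegrableOn (density p q g h Φ t) D (riemannianVolume g)) ∧
    ContinuousOn (fun x => h.inner (φ x) (variationField n Φ x) (pqTension p q g h φ x)) D ∧
    HasDerivAt (fun t => pqEnergy p q g h (Φ t) D)
      (-∫ x in D, h.inner (φ x) (variationField n Φ x) (pqTension p q g h φ x)
        ∂(riemannianVolume g)) 0 := by
  obtain rfl := hv.zero
  have h0 : (0 : ℝ) ∈ Ioo (-ε) ε := ⟨by linarith, hε⟩
  exact ⟨fun t ht => integrableOn_density hp g h hv.smooth hD ht (by linarith),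
    first_variation_of_family hp hq g h hv.smooth hD h0 hreg hv.support⟩

end

/-! ### Variations supported in a chart. -/

section
variable {m n : ℕ}
  {M : Type*} [TopologicalSpace M] [ChartedSpace (EuclideanSpace ℝ (Fin m)) M]
  [IsManifold (𝓡 m) ∞ M]
  {N : Type*} [TopologicalSpace N] [ChartedSpace (EuclideanSpace ℝ (Fin n)) N]
  [IsManifold (𝓡 n) ∞ N]

section BumpVariation

variable (m n) in
/-- The domain of the charts at `x₀` and `φ x₀`. -/
def chartDomain (φ : M → N) (x₀ : M) : Set M := (ch m x₀).source ∩ φ ⁻¹' (ch n (φ x₀)).source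

open Classical in
/-- The variation of `φ` that moves the values in the chart at `φ x₀` in the direction `w`, at the
speed `η`. -/
def bumpVariation (φ : M → N) (x₀ : M) (η : M → ℝ) (w : Euc n) (t : ℝ) (x : M) : N :=
  if x ∈ chartDomain m n φ x₀ then
    (ch n (φ x₀)).symm (ch n (φ x₀) (φ x) + (t * η x) • w) else φ x

variable {φ : M → N} (hφ : ContMDiff (𝓡 m) (𝓡 n) ∞ φ) {x₀ : M} {η : M → ℝ} (w : Euc n)

omit [IsManifold (𝓡 m) ∞ M] [IsManifold (𝓡 n) ∞ N] in
theorem bumpVariation_of_eq_zero {x : M} {t : ℝ} (hx : t * η x = 0) :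
    bumpVariation (m := m) φ x₀ η w t x = φ x := by
  rw [bumpVariation]
  split_ifs with h
  · rw [hx, zero_smul, add_zero, (ch n (φ x₀)).left_inv h.2]
  · rfl

include hφ

omit [IsManifold (𝓡 m) ∞ M] [IsManifold (𝓡 n) ∞ N] in
theorem isOpen_chartDomain : IsOpen (chartDomain m n φ x₀) :=
  (isOpen_extChartAt_source x₀).inter ((isOpen_extChartAt_source _).preimage hφ.continuous)

variable (hη : ContMDiff (𝓡 m) 𝓘(ℝ, ℝ) ∞ η) (hc : IsCompact (tsupport η))
  (hs : tsupport η ⊆ chartDomain m n φ x₀)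
include hη

omit [IsManifold (𝓡 m) ∞ M] in
theorem contMDiffAt_chart_add {x : M} (hx : x ∈ chartDomain m n φ x₀) (t : ℝ) :
    ContMDiffAt (𝓘(ℝ, ℝ).prod (𝓡 m)) 𝓘(ℝ, Euc n) ∞
      (fun a : ℝ × M => ch n (φ x₀) (φ a.2) + (a.1 * η a.2) • w) (t, x) := by
  have h1 : ContMDiffAt (𝓡 m) 𝓘(ℝ, Euc n) ∞ (fun y => ch n (φ x₀) (φ y)) x :=
    (contMDiffAt_extChartAt' (by simpa [extChartAt_source] using hx.2)).comp x hφ.contMDiffAt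
  have h2 : ContMDiffAt (𝓘(ℝ, ℝ).prod (𝓡 m)) 𝓘(ℝ, ℝ) ∞ (fun a : ℝ × M => η a.2) (t, x) :=
    ContMDiffAt.comp (g := η) (f := (Prod.snd : ℝ × M → M)) (t, x) hη.contMDiffAt contMDiffAt_snd
  have h3 : ContMDiffAt (𝓘(ℝ, ℝ).prod (𝓡 m)) 𝓘(ℝ, ℝ) ∞ (fun a : ℝ × M => a.1) (t, x) :=
    contMDiffAt_fst
  exact (ContMDiffAt.comp (g := fun y => ch n (φ x₀) (φ y)) (f := (Prod.snd : ℝ × M → M)) (t, x)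
    h1 contMDiffAt_snd).add ((h3.mul h2).smul contMDiffAt_const)

include hc hs

omit [IsManifold (𝓡 m) ∞ M] in
theorem exists_bumpVariation_mem : ∃ ε, 0 < ε ∧ ∀ t ∈ Ioo (-ε) ε, ∀ x ∈ chartDomain m n φ x₀,
    ch n (φ x₀) (φ x) + (t * η x) • w ∈ (ch n (φ x₀)).target := by
  -- At time zero the displaced points lie in the open target of the chart. Compactness of the
  -- support of `η` keeps them there for a uniform time.
  have h1 : ∀ᶠ t in 𝓝 (0 : ℝ), ∀ x ∈ tsupport η,
      ch n (φ x₀) (φ x) + (t * η x) • w ∈ (ch n (φ x₀)).target := by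
    refine hc.eventually_forall_of_forall_eventually fun x hx => ?_
    refine (contMDiffAt_chart_add hφ w hη (hs hx) 0).continuousAt.eventually
      ((isOpen_extChartAt_target _).mem_nhds ?_)
    simpa using (ch n (φ x₀)).map_source (hs hx).2
  obtain ⟨ε, hε, h2⟩ := Metric.eventually_nhds_iff_ball.1 h1
  refine ⟨ε, hε, fun t ht x hx => ?_⟩
  by_cases hxs : x ∈ tsupport η
  · exact h2 t (by rwa [Real.ball_eq_Ioo, zero_sub, zero_add]) x hxs
  · rw [image_eq_zero_of_notMem_tsupport hxs, mul_zero, zero_smul, add_zero]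
    exact (ch n (φ x₀)).map_source hx.2

omit [IsManifold (𝓡 m) ∞ M] in
theorem exists_isVariation_bumpVariation :
    ∃ ε, 0 < ε ∧ IsVariation m n φ (tsupport η) ε (bumpVariation (m := m) φ x₀ η w) := by
  obtain ⟨ε, hε, h1⟩ := exists_bumpVariation_mem hφ w hη hc hs
  refine ⟨ε, hε, ?_, ?_, ?_⟩
  · rintro ⟨t, x⟩ ⟨ht, -⟩
    refine ContMDiffAt.contMDiffWithinAt ?_
    -- On the support the family is smooth through the chart; off it, the family is locally constant
    -- in time and equal to `φ`. This takes care of the case distinction in the definition.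
    by_cases hxs : x ∈ tsupport η
    · have hx := hs hxs
      have h2 : ContMDiffAt 𝓘(ℝ, Euc n) (𝓡 n) ∞ (ch n (φ x₀)).symm
          (ch n (φ x₀) (φ x) + (t * η x) • w) :=
        (contMDiffOn_extChartAt_symm _).contMDiffAt
          ((isOpen_extChartAt_target _).mem_nhds (h1 t ht x hx))
      refine (ContMDiffAt.comp (g := (ch n (φ x₀)).symm)
        (f := fun a : ℝ × M => ch n (φ x₀) (φ a.2) + (a.1 * η a.2) • w) (t, x) h2
        (contMDiffAt_chart_add hφ w hη hx t)).congr_of_eventuallyEq ?_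
      filter_upwards [(continuous_snd.tendsto (t, x)).eventually
        ((isOpen_chartDomain hφ).mem_nhds hx)] with a ha
      exact if_pos ha
    · refine (ContMDiffAt.comp (g := φ) (f := (Prod.snd : ℝ × M → M)) (t, x)
        hφ.contMDiffAt contMDiffAt_snd).congr_of_eventuallyEq ?_
      filter_upwards [(continuous_snd.tendsto (t, x)).eventually
        ((isClosed_tsupport η).isOpen_compl.mem_nhds hxs)] with a ha
      exact bumpVariation_of_eq_zero w (by rw [image_eq_zero_of_notMem_tsupport ha, mul_zero])
  · funext x
    exact bumpVariation_of_eq_zero w (zero_mul _)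
  · intro t _ x hx
    exact bumpVariation_of_eq_zero w (by rw [image_eq_zero_of_notMem_tsupport hx, mul_zero])

theorem variationField_bumpVariation {x : M} (hx : x ∈ chartDomain m n φ x₀) :
    variationField n (bumpVariation (m := m) φ x₀ η w) x =
      coordL n (φ x₀) (φ x) (η x • w) := by
  obtain ⟨ε, hε, h1⟩ := exists_bumpVariation_mem hφ w hη hc hs
  obtain ⟨ε', hε', h2⟩ := exists_isVariation_bumpVariation hφ w hη hc hs
  have h0 : (0 : ℝ) ∈ Ioo (-ε) ε := ⟨by linarith, hε⟩
  have h0' : (0 : ℝ) ∈ Ioo (-ε') ε' := ⟨by linarith, hε'⟩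
  have e0 : bumpVariation (m := m) φ x₀ η w 0 x = φ x := bumpVariation_of_eq_zero w (zero_mul _)
  have hy : bumpVariation (m := m) φ x₀ η w 0 x ∈ (ch n (φ x₀)).source := by rw [e0]; exact hx.2
  have h3 := variationField_eq h2.smooth hx.1 h0' hy
  have h4 : fderiv ℝ (famMap m n x₀ (φ x₀) (bumpVariation (m := m) φ x₀ η w)) (0, ch m x₀ x)
      (timeDir m) = η x • w := by
    refine (hasDerivAt_time ((contDiffAt_famMap h2.smooth h0' hx.1 hy).differentiableAt
      (by simp))).unique ?_
    have h5 : HasDerivAt (fun s : ℝ => ch n (φ x₀) (φ x) + (s * η x) • w) (η x • w) 0 := by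
      simpa using (((hasDerivAt_id (0 : ℝ)).mul_const (η x)).smul_const w).const_add
        (ch n (φ x₀) (φ x))
    refine h5.congr_of_eventuallyEq ?_
    filter_upwards [isOpen_Ioo.mem_nhds h0] with s hs'
    rw [famMap, repMap_ch _ _ hx.1, bumpVariation, if_pos hx,
      (ch n (φ x₀)).right_inv (h1 s hs' x hx)]
  rw [h4] at h3
  exact h3.trans (by rw [e0])

end BumpVariation

end

/-! ### The Euler–Lagrange equation. -/

section
variable {m n : ℕ}
  {M : Type*} [TopologicalSpace M] [T2Space M] [SecondCountableTopology M]
  [ChartedSpace (EuclideanSpace ℝ (Fin m)) M]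
  [IsManifold (𝓡 m) ∞ M] [MeasurableSpace M] [BorelSpace M]
  {N : Type*} [TopologicalSpace N] [ChartedSpace (EuclideanSpace ℝ (Fin n)) N]
  [IsManifold (𝓡 n) ∞ N]

variable {p q : ℝ} (hp : 2 ≤ p) (hq : 2 ≤ q) (g : Metric m M) (h : Metric n N)
  {φ : M → N} (hφ : ContMDiff (𝓡 m) (𝓡 n) ∞ φ) (hreg : IsRegularOn p q g h φ univ)
include hp hq hφ hreg

theorem IsPQHarmonic.integral_eq_zero (hh : IsPQHarmonic p q g h φ) {x₀ : M} {η : M → ℝ}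
    (w : Euc n) (hη : ContMDiff (𝓡 m) 𝓘(ℝ, ℝ) ∞ η) (hc : IsCompact (tsupport η))
    (hs : tsupport η ⊆ chartDomain m n φ x₀) :
    ContinuousOn (fun x => η x *
      innerForm h (φ x) (coordL n (φ x₀) (φ x) w) (pqTension p q g h φ x)) (tsupport η) ∧
    ∫ x in tsupport η, η x *
      innerForm h (φ x) (coordL n (φ x₀) (φ x) w) (pqTension p q g h φ x)
      ∂(riemannianVolume g) = 0 := by
  obtain ⟨ε, hε, hv⟩ := exists_isVariation_bumpVariation hφ w hη hc hs
  obtain ⟨-, h1, h2⟩ := hv.first_variation hp hq g h hc hε ⟨hreg.1.imp_right (Or.imp_right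
    fun h x _ => h x (mem_univ x)), fun x _ => hreg.2 x (mem_univ x)⟩
  have h3 := neg_eq_zero.1 (h2.unique (hh _ ε _ hc hε hv))
  have h4 : ∀ x ∈ tsupport η, h.inner (φ x)
      (variationField n (bumpVariation (m := m) φ x₀ η w) x) (pqTension p q g h φ x) =
      η x * innerForm h (φ x) (coordL n (φ x₀) (φ x) w) (pqTension p q g h φ x) := fun x hx => by
    refine (congrArg (fun a => innerForm h (φ x) a (pqTension p q g h φ x))
      (variationField_bumpVariation hφ w hη hc hs (hs hx))).trans ?_
    rw [map_smul, map_smul]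
    rfl
  refine ⟨h1.congr fun x hx => (h4 x hx).symm, ?_⟩
  rw [← h3]
  exact setIntegral_congr_fun hc.measurableSet fun x hx => (h4 x hx).symm

theorem IsPQHarmonic.pqTension_eq_zero (hh : IsPQHarmonic p q g h φ) (x₀ : M) :
    pqTension p q g h φ x₀ = 0 := by
  by_contra hne
  -- The direction of the test variation, constant in the chart at `φ x₀`; at `x₀` the function `k`
  -- is then `|τ_{p,q}(φ)|²`.
  set w : Euc n := pqTension p q g h φ x₀ with hw
  set k : M → ℝ := fun x =>
    innerForm h (φ x) (coordL n (φ x₀) (φ x) w) (pqTension p q g h φ x) with hk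
  have hk0 : 0 < k x₀ := by
    simp only [hk]
    rw [coordL_self]
    exact (isInner_innerForm h (φ x₀)).pos w hne
  have bump : ∀ U ∈ 𝓝 x₀, ∃ f : SmoothBumpFunction (𝓡 m) x₀, tsupport f ⊆ U := fun U hU => by
    obtain ⟨f, -, hf⟩ := (SmoothBumpFunction.nhds_basis_tsupport (I := 𝓡 m) x₀).mem_iff.1 hU
    exact ⟨f, hf⟩
  have hU : chartDomain m n φ x₀ ∈ 𝓝 x₀ := (isOpen_chartDomain hφ).mem_nhds
    ⟨mem_extChartAt_source x₀, mem_extChartAt_source (φ x₀)⟩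
  have main : ∀ f : SmoothBumpFunction (𝓡 m) x₀, tsupport f ⊆ chartDomain m n φ x₀ →
      tsupport f ∈ 𝓝 x₀ ∧ (∀ᶠ x in 𝓝 x₀, 0 < f x * k x) ∧
      ContinuousOn (fun x => f x * k x) (tsupport f) ∧
      ∫ x in tsupport f, f x * k x ∂(riemannianVolume g) = 0 := fun f hf => by
    obtain ⟨h1, h2⟩ := hh.integral_eq_zero hp hq g h hφ hreg w f.contMDiff
      f.hasCompactSupport hf
    refine ⟨f.tsupport_mem_nhds, ?_, h1, h2⟩
    refine (h1.continuousAt f.tsupport_mem_nhds).eventually (lt_mem_nhds ?_)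
    change 0 < f x₀ * k x₀
    rwa [f.eq_one, one_mul]
  -- A first bump function only serves to show that `k` is positive near `x₀`, since continuity is
  -- known for `f k`. The second one, `f'`, is supported where `k > 0`, so that `f' k` is
  -- nonnegative.
  obtain ⟨f, hf⟩ := bump _ hU
  have hkpos : ∀ᶠ x in 𝓝 x₀, 0 < k x := (main f hf).2.1.mono fun x hx => by
    by_contra! hx'
    exact not_lt.2 (mul_nonpos_of_nonneg_of_nonpos f.nonneg hx') hx
  obtain ⟨f', hf'⟩ := bump _ (Filter.inter_mem hU hkpos)
  obtain ⟨h1, h2, h3, h4⟩ := main f' (hf'.trans inter_subset_left)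
  have hcpt : IsCompact (tsupport f') := f'.hasCompactSupport
  rw [setIntegral_eq_zero_iff_of_nonneg_ae (ae_restrict_of_forall_mem hcpt.measurableSet
    fun x hx => mul_nonneg f'.nonneg (le_of_lt (hf' hx).2)) (h3.integrableOn_compact hcpt)] at h4
  have h5 := (ae_restrict_iff' hcpt.measurableSet).1 h4
  -- A nonnegative function with zero integral vanishes almost everywhere, but `f' k` is positive on
  -- a neighbourhood of `x₀`, which has positive volume.
  have h6 : ∀ᶠ x in 𝓝 x₀, ¬(x ∈ tsupport f' → f' x * k x = (0 : M → ℝ) x) := by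
    filter_upwards [h1, h2] with x hx hx' hc
    exact hx'.ne' (hc hx)
  exact (Measure.measure_pos_of_mem_nhds (riemannianVolume g) h6).ne' h5

/-- The Euler–Lagrange equation. -/
theorem isPQHarmonic_iff : IsPQHarmonic p q g h φ ↔ ∀ x, pqTension p q g h φ x = 0 := by
  refine ⟨fun hh => hh.pqTension_eq_zero hp hq g h hφ hreg, fun h0 D ε Φ hD hε hv => ?_⟩
  obtain ⟨-, -, h2⟩ := hv.first_variation hp hq g h hD hε ⟨hreg.1.imp_right (Or.imp_right
    fun h x _ => h x (mem_univ x)), fun x _ => hreg.2 x (mem_univ x)⟩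
  have h3 : ∀ x, h.inner (φ x) (variationField n Φ x) (pqTension p q g h φ x) = 0 := fun x => by
    rw [h0 x]
    exact map_zero _
  simpa only [h3, integral_zero, neg_zero] using h2

end

end

end PQHarmonic

theorem theorem2p1 {m n : ℕ}
    {M : Type*} [TopologicalSpace M] [T2Space M] [SecondCountableTopology M]
    [ChartedSpace (EuclideanSpace ℝ (Fin m)) M] [IsManifold (𝓡 m) ∞ M]
    [MeasurableSpace M] [BorelSpace M]
    {N : Type*} [TopologicalSpace N] [T2Space N] [SecondCountableTopology N]
    [ChartedSpace (EuclideanSpace ℝ (Fin n)) N] [IsManifold (𝓡 n) ∞ N]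
    (g : PQHarmonic.Metric m M) (h : PQHarmonic.Metric n N)
    (p q : ℝ) (hp : 2 ≤ p) (hq : 2 ≤ q)
    (φ : M → N) (hφ : ContMDiff (𝓡 m) (𝓡 n) ∞ φ) :
    (∀ (D : Set M) (ε : ℝ) (Φ : ℝ → M → N), IsCompact D → 0 < ε →
      PQHarmonic.IsVariation m n φ D ε Φ → PQHarmonic.IsRegularOn p q g h φ D →
      (∀ t ∈ Ioo (-ε) ε, IntegrableOn
        (fun x => PQHarmonic.vnorm h (Φ t x) (PQHarmonic.pTension p g h (Φ t) x) ^ q)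
        D (PQHarmonic.riemannianVolume g)) ∧
      IntegrableOn
        (fun x => h.inner (φ x) (PQHarmonic.variationField n Φ x)
          (PQHarmonic.pqTension p q g h φ x))
        D (PQHarmonic.riemannianVolume g) ∧
      HasDerivAt (fun t => PQHarmonic.pqEnergy p q g h (Φ t) D)
        (-∫ x in D, h.inner (φ x) (PQHarmonic.variationField n Φ x)
          (PQHarmonic.pqTension p q g h φ x) ∂(PQHarmonic.riemannianVolume g)) 0) ∧
    (PQHarmonic.IsRegularOn p q g h φ univ →
      (PQHarmonic.IsPQHarmonic p q g h φ ↔ ∀ x, PQHarmonic.pqTension p q g h φ x = 0)) := by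
  refine ⟨fun D ε Φ hD hε hv hreg => ?_, fun hreg =>
    PQHarmonic.isPQHarmonic_iff hp hq g h hφ hreg⟩
  obtain ⟨h1, h2, h3⟩ := hv.first_variation hp hq g h hD hε hreg
  exact ⟨h1, h2.integrableOn_compact hD, h3⟩
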